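/- Let $(M,g)$ be a connected smooth Riemannian manifold of dimension $2m+1$ ($m\ge 0$) with Levi-Civita connection $\nabla$. Equip the vector bundle $TM\oplus\mathbb R\to M$ with the fibre metric $h((X,r),(Y,s))=g(X,Y)+rs$ and with the rolling connection $$\nabla^{R}_Y(X,r)=\big(\nabla_YX+rY,\;Y(r)-g(X,Y)\big).$$ Let $x_0\in M$ and suppose that the holonomy group $H^{\nabla^R}|_{x_0}$ of $\nabla^R$ (parallel transports along piecewise smooth loops at $x_0$) is contained in $\mathrm U(m+1)$, i.e. there is a real linear isometry $\varphi:(T_{x_0}M\oplus\mathbb R,h)\to\mathbb C^{m+1}$ with $\varphi\, H^{\nabla^R}|_{x_0}\,\varphi^{-1}\subset \mathrm U(m+1)$. Then for every such $\varphi$ there is an $h$-orthogonal complex structure $J^R$ on $TM\oplus\mathbb R$ with $\nabla^RJ^R=0$ and $J^R_{x_0}=\varphi^{-1}\circ i\circ\varphi$, and it has the form $$J^R(0,1)=(Z,0),\qquad J^R(X,0)=(JX,-\alpha(X)),\qquad \alpha=g(Z,\cdot),$$ where $Z$ is a Killing vector field of unit length and $J$ is a smooth $(1,1)$-tensor field such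 that $$JX=\nabla_XZ,\qquad (\nabla_XJ)Y=g(Z,Y)X-g(X,Y)Z$$ for all vectors (vector fields) $X,Y$ on $M$. Moreover: * $\alpha$ is a contact form (it has no zeros and $d\alpha$ is nondegenerate on $\ker\alpha$) with Reeb field $Z$ ($\alpha(Z)=1$, $d\alpha(Z,\cdot)=0$); * $J$ maps the contact distribution $D=\ker\alpha$ to itself, $J^2=-\mathrm{id}$ on $D$, and $g(JX,JY)=g(X,Y)$ for $X,Y\in D$; * $(Z,\alpha,J,g)$ is a Sasakian structure on $M$: $\alpha$ is a contact form with Reeb field $Z$, $J^2=-\mathrm{id}+Z\otimes\alpha$, $g(JX,JY)=g(X,Y)-\alpha(X)\alpha(Y)$, $d\alpha(X,Y)=2g(JX,Y)$, and the almost complex structure $I$ on the cone $M\times\mathbb R_+$ (coordinate $s$ on $\mathbb R_+$) given by $IX=JX-\alpha(X)\,s\partial_s$ for $X$ tangent to $M$ and $I(s\partial_s)=Z$ is integrable, i.e. its Nijenhuis tensor vanishes. -/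

import Mathlib

open Bundle NormedSpace FiberBundle VectorField
open scoped Manifold ContDiff Topology

namespace RollingHolonomy

/-! ## Parallel transport and holonomy of a connection on a vector bundle -/

noncomputable section Holonomy

variable {E : Type*} [NormedAddCommGroup E] [NormedSpace ℝ E]
  {H : Type*} [TopologicalSpace H] {I : ModelWithCorners ℝ E H}
  {M : Type*} [TopologicalSpace M] [ChartedSpace H M]
  {F : Type*} [NormedAddCommGroup F] [NormedSpace ℝ F]
  {V : M → Type*} [TopologicalSpace (TotalSpace F V)]
  [∀ x, AddCommGroup (V x)] [∀ x, Module ℝ (V x)] [∀ x, TopologicalSpace (V x)]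
  [∀ x, IsTopologicalAddGroup (V x)] [∀ x, ContinuousSMul ℝ (V x)] [FiberBundle F V]

/-- The covariant derivative `DW/dt` at `t` of a section `W` along a curve `γ`. In the local frame
`e_i` given by the trivialization at `γ t`, with `W s = ∑ W^i(s) e_i(γ s)`, this is
`∑ (W^i)'(t) e_i(γ t) + ∇_{γ'(t)} (∑ W^i(t) e_i)`; here `extend F (W t)` is the local
section `∑ W^i(t) e_i`. -/
def covDerivAlong (cov : CovariantDerivative I F V) (γ : ℝ → M) (W : ∀ t, V (γ t)) (t : ℝ) :
    V (γ t) :=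
  (trivializationAt F V (γ t)).symm (γ t)
      (deriv (fun s : ℝ => (trivializationAt F V (γ t) ⟨γ s, W s⟩).2) t)
    + cov (extend F (W t)) (γ t) (mfderiv 𝓘(ℝ, ℝ) I γ t (1 : ℝ))

/-- `W` is a parallel section along the curve `γ`. -/
def IsParallelAlong (cov : CovariantDerivative I F V) (γ : ℝ → M) (W : ∀ t, V (γ t)) : Prop :=
  MDifferentiable 𝓘(ℝ, ℝ) (I.prod 𝓘(ℝ, F)) (fun t => TotalSpace.mk' F (γ t) (W t)) ∧
    ∀ t, covDerivAlong cov γ W t = 0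

/-- `IsParallelTransport cov x y B`: the map `B` is the parallel transport from `V x` to `V y` along
some piecewise smooth path from `x` to `y`, that is, along a finite concatenation of paths
`γ : [0, 1] → M` that are restrictions of smooth curves `ℝ → M`. -/
inductive IsParallelTransport (cov : CovariantDerivative I F V) :
    ∀ x y : M, (V x ≃ₗ[ℝ] V y) → Prop
  | refl (x : M) : IsParallelTransport cov x x (LinearEquiv.refl ℝ (V x))
  | smooth (γ : ℝ → M) (hγ : ContMDiff 𝓘(ℝ, ℝ) I ∞ γ) (B : V (γ 0) ≃ₗ[ℝ] V (γ 1))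
      (hB : ∀ v, ∃ W : ∀ t, V (γ t), IsParallelAlong cov γ W ∧ W 0 = v ∧ W 1 = B v) :
      IsParallelTransport cov (γ 0) (γ 1) B
  | trans {x y z : M} {B : V x ≃ₗ[ℝ] V y} {C : V y ≃ₗ[ℝ] V z}
      (hB : IsParallelTransport cov x y B) (hC : IsParallelTransport cov y z C) :
      IsParallelTransport cov x z (B.trans C)

/-- The holonomy group at `x`: all parallel transports along piecewise smooth loops based at `x`.
(These already form a group, with inverses given by reversed loops, so that taking the generated
subgroup adds no element.) -/
def holonomyGroup (cov : CovariantDerivative I F V) (x : M) : Subgroup (V x ≃ₗ[ℝ] V x) :=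
  Subgroup.closure {B | IsParallelTransport cov x x B}

end Holonomy

/-! ## The Levi-Civita connection -/

set_option linter.unusedSectionVars false

noncomputable section LeviCivita

variable {E : Type*} [NormedAddCommGroup E] [NormedSpace ℝ E] [FiniteDimensional ℝ E]
  {H : Type*} [TopologicalSpace H] (I : ModelWithCorners ℝ E H)
  {M : Type*} [TopologicalSpace M] [ChartedSpace H M]
  [RiemannianBundle (fun x : M => TangentSpace I x)]

/-- The Koszul expression for `g(∇_X Y, Z)`. -/
def koszul (X Y Z : Π x : M, TangentSpace I x) (x : M) : ℝ :=
  (1 / 2 : ℝ) *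
    (d% (fun y => inner ℝ (Y y) (Z y)) x (X x) + d% (fun y => inner ℝ (X y) (Z y)) x (Y x)
      - d% (fun y => inner ℝ (X y) (Y y)) x (Z x)
      + inner ℝ (mlieBracket I X Y x) (Z x) - inner ℝ (mlieBracket I X Z x) (Y x)
      - inner ℝ (mlieBracket I Y Z x) (X x))

/-- The tangent vector that represents a linear form on a tangent space. -/
def rieszTangent (x : M) : (TangentSpace I x →L[ℝ] ℝ) →ₗ[ℝ] TangentSpace I x :=
  haveI : FiniteDimensional ℝ (TangentSpace I x) := inferInstanceAs (FiniteDimensional ℝ E)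
  haveI : CompleteSpace (TangentSpace I x) := FiniteDimensional.complete ℝ _
  { toFun := fun l => (InnerProductSpace.toDual ℝ (TangentSpace I x)).symm l
    map_add' := fun a b => by simp
    map_smul' := fun a b => by simp }

lemma inner_rieszTangent (x : M) (l : TangentSpace I x →L[ℝ] ℝ) (w : TangentSpace I x) :
    inner ℝ (rieszTangent I x l) w = l w := by
  have : FiniteDimensional ℝ (TangentSpace I x) := inferInstanceAs (FiniteDimensional ℝ E)
  have : CompleteSpace (TangentSpace I x) := FiniteDimensional.complete ℝ _
  exact InnerProductSpace.toDual_symm_apply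

variable [IsManifold I ∞ M] [IsContMDiffRiemannianBundle I ∞ E (fun x : M => TangentSpace I x)]
variable {I}

lemma mdifferentiableAt_inner_tangent {x : M} {X Y : Π x : M, TangentSpace I x}
    (hX : MDiffAt (T% X) x) (hY : MDiffAt (T% Y) x) :
    MDiffAt (fun y => (inner ℝ (X y) (Y y) : ℝ)) x :=
  MDifferentiableAt.inner_bundle (IB := I) (F := E) (E := fun x : M => TangentSpace I x) hX hY

lemma koszul_tensorial_left {x : M} {Y Z : Π x : M, TangentSpace I x} (hY : MDiffAt (T% Y) x)
    (hZ : MDiffAt (T% Z) x) : TensorialAt I E (fun X => koszul I X Y Z x) x where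
  smul {f X} hf hX := by
    have h1 := mdifferentiableAt_inner_tangent hX hZ
    have h2 := mdifferentiableAt_inner_tangent hX hY
    simp [koszul, inner_smul_left, mvfderiv_fun_mul hf h1, mvfderiv_fun_mul hf h2,
      mlieBracket_smul_left hf hX, inner_add_left, inner_smul_right]
    ring
  add {X X'} hX hX' := by
    have h1 := mdifferentiableAt_inner_tangent hX hZ
    have h2 := mdifferentiableAt_inner_tangent hX hY
    have h1' := mdifferentiableAt_inner_tangent hX' hZ
    have h2' := mdifferentiableAt_inner_tangent hX' hY
    simp [koszul, inner_add_left, mvfderiv_fun_add h1 h1', mvfderiv_fun_add h2 h2',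
      mlieBracket_add_left hX hX', inner_add_right]
    ring

lemma koszul_tensorial_right {x : M} {X Y : Π x : M, TangentSpace I x} (hX : MDiffAt (T% X) x)
    (hY : MDiffAt (T% Y) x) : TensorialAt I E (fun Z => koszul I X Y Z x) x where
  smul {f Z} hf hZ := by
    have h1 := mdifferentiableAt_inner_tangent hX hZ
    have h2 := mdifferentiableAt_inner_tangent hY hZ
    simp [koszul, inner_smul_right, mvfderiv_fun_mul hf h1, mvfderiv_fun_mul hf h2,
      mlieBracket_smul_right hf hZ, inner_add_left, inner_smul_left]
    rw [real_inner_comm (Z x) (Y x), real_inner_comm (Z x) (X x)]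
    ring
  add {Z Z'} hZ hZ' := by
    have h1 := mdifferentiableAt_inner_tangent hX hZ
    have h2 := mdifferentiableAt_inner_tangent hY hZ
    have h1' := mdifferentiableAt_inner_tangent hX hZ'
    have h2' := mdifferentiableAt_inner_tangent hY hZ'
    simp [koszul, inner_add_left, mvfderiv_fun_add h1 h1', mvfderiv_fun_add h2 h2',
      mlieBracket_add_right hZ hZ', inner_add_right]
    ring

/-- The bilinear form `(X, Z) ↦ koszul X Y Z` on the tangent space at `x`. -/
def koszulForm {x : M} {Y : Π x : M, TangentSpace I x} (hY : MDiffAt (T% Y) x) :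
    TangentSpace I x →L[ℝ] TangentSpace I x →L[ℝ] ℝ :=
  TensorialAt.mkHom₂ (F := E) (F' := E) (I := I) (fun X Z => koszul I X Y Z x) x
    (fun _ hZ => koszul_tensorial_left hY hZ) (fun _ hX => koszul_tensorial_right hX hY)

open scoped Classical in
/-- The map `Y ↦ (v ↦ ∇_v Y)` determined by the Koszul formula, for `Y` differentiable at `x`
(and the value `0` otherwise). -/
def leviCivitaFun (Y : Π x : M, TangentSpace I x) (x : M) :
    TangentSpace I x →L[ℝ] TangentSpace I x :=
  haveI : FiniteDimensional ℝ (TangentSpace I x) := inferInstanceAs (FiniteDimensional ℝ E)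
  if hY : MDiffAt (T% Y) x then
    LinearMap.toContinuousLinearMap (rieszTangent I x ∘ₗ (koszulForm hY).toLinearMap)
  else 0

lemma inner_leviCivitaFun {x : M} {X Y Z : Π x : M, TangentSpace I x} (hX : MDiffAt (T% X) x)
    (hY : MDiffAt (T% Y) x) (hZ : MDiffAt (T% Z) x) :
    inner ℝ (leviCivitaFun Y x (X x)) (Z x) = koszul I X Y Z x := by
  rw [leviCivitaFun, dif_pos hY]
  exact (inner_rieszTangent I x _ _).trans (TensorialAt.mkHom₂_apply _ _ hX hZ)

lemma leviCivitaFun_ext {x : M} {A B : TangentSpace I x →L[ℝ] TangentSpace I x}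
    (h : ∀ X Z : Π x : M, TangentSpace I x, MDiffAt (T% X) x → MDiffAt (T% Z) x →
      (inner ℝ (A (X x)) (Z x) : ℝ) = inner ℝ (B (X x)) (Z x)) : A = B := by
  ext v
  refine ext_inner_right ℝ fun w => ?_
  simpa using h (extend E v) (extend E w) (mdifferentiableAt_extend ..)
    (mdifferentiableAt_extend ..)

variable (I M) in
/-- The Levi-Civita connection; `leviCivita I M Y x v` is `∇_v Y` at `x`. -/
def leviCivita : CovariantDerivative I E (fun x : M => TangentSpace I x) where
  toFun := leviCivitaFun
  isCovariantDerivativeOnUniv :=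
    { add := by
        intro Y Y' x hY hY' _
        have hs : MDiffAt (T% (Y + Y')) x := mdifferentiableAt_add_section hY hY'
        refine leviCivitaFun_ext fun X Z hX hZ => ?_
        have h1 := mdifferentiableAt_inner_tangent hX hY
        have h2 := mdifferentiableAt_inner_tangent hY hZ
        have h1' := mdifferentiableAt_inner_tangent hX hY'
        have h2' := mdifferentiableAt_inner_tangent hY' hZ
        rw [inner_leviCivitaFun hX hs hZ, add_apply, inner_add_left,
          inner_leviCivitaFun hX hY hZ, inner_leviCivitaFun hX hY' hZ]
        simp [koszul, inner_add_left, mvfderiv_fun_add h1 h1', mvfderiv_fun_add h2 h2',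
          mlieBracket_add_right hY hY', mlieBracket_add_left hY hY', inner_add_right]
        ring
      leibniz := by
        intro Y f x hY hf _
        have hs : MDiffAt (T% (f • Y)) x := hf.smul_section hY
        refine leviCivitaFun_ext fun X Z hX hZ => ?_
        have h1 := mdifferentiableAt_inner_tangent hX hY
        have h2 := mdifferentiableAt_inner_tangent hY hZ
        rw [inner_leviCivitaFun hX hs hZ, add_apply, inner_add_left,
          smul_apply, inner_smul_left, inner_leviCivitaFun hX hY hZ]
        simp [koszul, inner_smul_right, inner_smul_left, mvfderiv_fun_mul hf h1,
          mvfderiv_fun_mul hf h2, mlieBracket_smul_right hf hY, mlieBracket_smul_left hf hY,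
          inner_add_left]
        rw [real_inner_comm (X x) (Y x)]
        ring }

/-- The Levi-Civita connection is torsion free. -/
lemma leviCivita_torsion : (leviCivita I M).torsion = 0 := by
  rw [CovariantDerivative.torsion_eq_zero_iff]
  intro X Y x hX hY
  refine ext_inner_right ℝ fun w => ?_
  have hZ : MDiffAt (T% (extend E w)) x := mdifferentiableAt_extend ..
  have h1 := inner_leviCivitaFun hX hY hZ
  have h2 := inner_leviCivitaFun hY hX hZ
  simp only [extend_apply_self] at h1 h2
  rw [inner_sub_left]
  change inner ℝ (leviCivitaFun Y x (X x)) w - inner ℝ (leviCivitaFun X x (Y x)) w = _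
  rw [h1, h2]
  simp only [koszul, extend_apply_self, mlieBracket_swap_apply (V := Y) (W := X), inner_neg_left,
    fun y => real_inner_comm (X y) (Y y)]
  ring

/-- The Levi-Civita connection is metric. -/
lemma leviCivita_metric {x : M} {Y Z : Π x : M, TangentSpace I x} (hY : MDiffAt (T% Y) x)
    (hZ : MDiffAt (T% Z) x) (v : TangentSpace I x) :
    d% (fun y => (inner ℝ (Y y) (Z y) : ℝ)) x v =
      inner ℝ (leviCivita I M Y x v) (Z x) + inner ℝ (Y x) (leviCivita I M Z x v) := by
  have hX : MDiffAt (T% (extend E v)) x := mdifferentiableAt_extend ..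
  have h1 := inner_leviCivitaFun hX hY hZ
  have h2 := inner_leviCivitaFun hX hZ hY
  simp only [extend_apply_self] at h1 h2
  rw [real_inner_comm (leviCivita I M Z x v) (Y x)]
  change _ = inner ℝ (leviCivitaFun Y x v) (Z x) + inner ℝ (leviCivitaFun Z x v) (Y x)
  rw [h1, h2]
  simp only [koszul, mlieBracket_swap_apply (V := Z) (W := Y), inner_neg_left, extend_apply_self,
    fun y => real_inner_comm (Y y) (Z y)]
  ring

end LeviCivita

/-! ## The rolling connection -/

noncomputable section Rolling

variable {E : Type*} [NormedAddCommGroup E] [NormedSpace ℝ E] [FiniteDimensional ℝ E]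
  {H : Type*} [TopologicalSpace H] (I : ModelWithCorners ℝ E H)
  (M : Type*) [TopologicalSpace M] [ChartedSpace H M]

/-- The vector bundle `TM ⊕ ℝ` over `M`. -/
abbrev RollingBundle : M → Type _ := (fun x : M => TangentSpace I x) ×ᵇ (Bundle.Trivial M ℝ)

variable {I M}

variable [IsManifold I ∞ M]

lemma mdifferentiableAt_tangentPart {σ : Π x, RollingBundle I M x} {x : M}
    (hσ : MDifferentiableAt I (I.prod 𝓘(ℝ, E × ℝ)) (fun y => TotalSpace.mk' (E × ℝ) y (σ y)) x) :
    MDifferentiableAt I (I.prod 𝓘(ℝ, E)) (fun y => TotalSpace.mk' E y (σ y).1) x := by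
  rw [mdifferentiableAt_section] at hσ ⊢
  exact (ContinuousLinearMap.fst ℝ E ℝ).mdifferentiableAt.comp x hσ

lemma mdifferentiableAt_realPart {σ : Π x, RollingBundle I M x} {x : M}
    (hσ : MDifferentiableAt I (I.prod 𝓘(ℝ, E × ℝ)) (fun y => TotalSpace.mk' (E × ℝ) y (σ y)) x) :
    MDifferentiableAt I 𝓘(ℝ, ℝ) (fun y => (σ y).2) x := by
  rw [mdifferentiableAt_section] at hσ
  have h := (ContinuousLinearMap.snd ℝ E ℝ).mdifferentiableAt.comp (I := I) x hσ
  exact h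

variable [RiemannianBundle (fun x : M => TangentSpace I x)]

/-- The fibre metric `h_c((X, r), (Y, s)) = g(X, Y) + c⁻¹ r s` on `TM ⊕ ℝ`. -/
def rollingMetric (c : ℝ) (x : M) (p q : RollingBundle I M x) : ℝ :=
  (inner ℝ (p.1 : TangentSpace I x) q.1 : ℝ) + c⁻¹ * ((p.2 : ℝ) * (q.2 : ℝ))

variable [IsContMDiffRiemannianBundle I ∞ E (fun x : M => TangentSpace I x)]

variable (I M) in
/-- The rolling connection
`∇^{R,c}_v (X, r) = (∇_v X + r(x) v, v(r) - c g(X, v))` on `TM ⊕ ℝ`. -/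
def rollingConnection (c : ℝ) : CovariantDerivative I (E × ℝ) (RollingBundle I M) where
  toFun σ x :=
    (leviCivita I M (fun y => (σ y).1) x
        + ((σ x).2 : ℝ) • ContinuousLinearMap.id ℝ (TangentSpace I x)).prod
      (mvfderiv I (F := ℝ) (fun y => (σ y).2) x - c • innerSL ℝ ((σ x).1 : TangentSpace I x))
  isCovariantDerivativeOnUniv :=
    { add := by
        intro σ τ x hσ hτ _
        have h1 := (leviCivita I M).isCovariantDerivativeOnUniv.add
          (mdifferentiableAt_tangentPart hσ) (mdifferentiableAt_tangentPart hτ)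
        have h2 := mvfderiv_fun_add (mdifferentiableAt_realPart hσ) (mdifferentiableAt_realPart hτ)
        refine ContinuousLinearMap.ext fun v => Prod.ext ?_ ?_
        · have h3 := DFunLike.congr_fun h1 v
          change leviCivita I M (fun y => (σ y).1 + (τ y).1) x v + ((σ x).2 + (τ x).2 : ℝ) • v
            = (leviCivita I M (fun y => (σ y).1) x v + ((σ x).2 : ℝ) • v)
              + (leviCivita I M (fun y => (τ y).1) x v + ((τ x).2 : ℝ) • v)
          have h4 : leviCivita I M (fun y => (σ y).1 + (τ y).1) x v =
            leviCivita I M (fun y => (σ y).1) x v + leviCivita I M (fun y => (τ y).1) x v := h3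
          rw [h4, add_smul]
          abel
        · have h3 := DFunLike.congr_fun h2 v
          rw [add_apply] at h3
          change mvfderiv I (F := ℝ) (fun y => (σ y).2 + (τ y).2) x v
              - c * inner ℝ ((σ x).1 + (τ x).1 : TangentSpace I x) v
            = (mvfderiv I (F := ℝ) (fun y => (σ y).2) x v
                - c * inner ℝ ((σ x).1 : TangentSpace I x) v)
              + (mvfderiv I (F := ℝ) (fun y => (τ y).2) x v
                - c * inner ℝ ((τ x).1 : TangentSpace I x) v)
          rw [inner_add_left]
          linear_combination h3
      leibniz := by
        intro σ f x hσ hf _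
        have h1 := (leviCivita I M).isCovariantDerivativeOnUniv.leibniz
          (mdifferentiableAt_tangentPart hσ) hf
        have h2 := mvfderiv_fun_mul hf (mdifferentiableAt_realPart hσ)
        refine ContinuousLinearMap.ext fun v => Prod.ext ?_ ?_
        · have h3 : leviCivita I M (fun y => f y • (σ y).1) x v =
            f x • leviCivita I M (fun y => (σ y).1) x v
              + mvfderiv I f x v • ((σ x).1 : TangentSpace I x) := DFunLike.congr_fun h1 v
          change leviCivita I M (fun y => f y • (σ y).1) x v + (f x * (σ x).2 : ℝ) • v
            = f x • (leviCivita I M (fun y => (σ y).1) x v + ((σ x).2 : ℝ) • v)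
              + mvfderiv I f x v • ((σ x).1 : TangentSpace I x)
          rw [h3, smul_add, smul_smul]
          abel
        · have h3 := DFunLike.congr_fun h2 v
          change mvfderiv I (F := ℝ) (fun y => f y * (σ y).2) x v
              - c * inner ℝ (f x • (σ x).1 : TangentSpace I x) v
            = f x * (mvfderiv I (F := ℝ) (fun y => (σ y).2) x v
                - c * inner ℝ ((σ x).1 : TangentSpace I x) v)
              + mvfderiv I f x v * (σ x).2
          rw [real_inner_smul_left]
          change _ = f x * mvfderiv I (F := ℝ) (fun y => (σ y).2) x v
            + (σ x).2 * mvfderiv I f x v at h3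
          linear_combination h3 }

/-- The rolling holonomy group at `x` of `M` rolling on the unit sphere: the holonomy group of
the rolling connection with `c = 1`. -/
def rollingHolonomy (x : M) : Subgroup (RollingBundle I M x ≃ₗ[ℝ] RollingBundle I M x) :=
  holonomyGroup (rollingConnection I M 1) x

/-- A real linear isometry of `(T_xM ⊕ ℝ, h_1)` onto `ℂ^k` with its standard real inner product. -/
def IsUnitaryFrame {k : ℕ} {x : M}
    (φ : RollingBundle I M x ≃ₗ[ℝ] EuclideanSpace ℂ (Fin k)) : Prop :=
  ∀ p q, (inner ℂ (φ p) (φ q) : ℂ).re = rollingMetric 1 x p q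

/-- The rolling holonomy group at `x` is contained in `U(k)`, where `U(k)` acts on
`T_xM ⊕ ℝ` through the identification `φ` with `ℂ^k`. -/
def RollingHolonomySubsetUnitary {k : ℕ} {x : M}
    (φ : RollingBundle I M x ≃ₗ[ℝ] EuclideanSpace ℂ (Fin k)) : Prop :=
  ∀ B ∈ rollingHolonomy x, ∃ U ∈ Matrix.unitaryGroup (Fin k) ℂ,
    ∀ p, φ (B p) = WithLp.toLp 2 (U.mulVec (φ p).ofLp)

/-- `JR` is a complex structure on `TM ⊕ ℝ` that is orthogonal for `h_1` and parallel for the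
rolling connection with `c = 1`, i.e. `∇^R_v (JR σ) = JR (∇^R_v σ)`. -/
structure IsParallelComplexStructure
    (JR : ∀ x : M, RollingBundle I M x →L[ℝ] RollingBundle I M x) : Prop where
  sq : ∀ x p, JR x (JR x p) = -p
  orthogonal : ∀ x p q, rollingMetric 1 x (JR x p) (JR x q) = rollingMetric 1 x p q
  parallel : ∀ (σ : Π x, RollingBundle I M x) (x : M),
    MDifferentiableAt I (I.prod 𝓘(ℝ, E × ℝ)) (fun y => TotalSpace.mk' (E × ℝ) y (σ y)) x →
    ∀ v : TangentSpace I x,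
      rollingConnection I M 1 (fun y => JR y (σ y)) x v = JR x (rollingConnection I M 1 σ x v)

end Rolling

/-! ## Killing fields, contact forms, Sasakian structures -/

noncomputable section Sasakian

variable {E : Type*} [NormedAddCommGroup E] [NormedSpace ℝ E]
  {H : Type*} [TopologicalSpace H] {I : ModelWithCorners ℝ E H}
  {M : Type*} [TopologicalSpace M] [ChartedSpace H M]

variable [IsManifold I ∞ M]

/-- A smooth vector field. -/
def SmoothVectorField (Z : Π x : M, TangentSpace I x) : Prop :=
  ContMDiff I (I.prod 𝓘(ℝ, E)) ∞ (fun x => TotalSpace.mk' E x (Z x))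

/-- A smooth one-form. -/
def SmoothOneForm (α : Π x : M, TangentSpace I x →L[ℝ] ℝ) : Prop :=
  ContMDiff I (I.prod 𝓘(ℝ, E →L[ℝ] ℝ)) ∞ (fun x => TotalSpace.mk' (E →L[ℝ] ℝ) x (α x))

/-- The value at `x` on `v, w` of the exterior derivative of the one-form `α`:
`dα(V, W) = V(α(W)) - W(α(V)) - α([V, W])`, for local vector fields `V`, `W` extending
`v`, `w`. -/
def extDerivOneForm (α : Π x : M, TangentSpace I x →L[ℝ] ℝ) (x : M) (v w : TangentSpace I x) : ℝ :=
  mvfderiv I (F := ℝ) (fun y => α y (extend E w y)) x v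
    - mvfderiv I (F := ℝ) (fun y => α y (extend E v y)) x w
    - α x (mlieBracket I (extend E v) (extend E w) x)

/-- The formula for `dα(V, W)` holds for all differentiable vector fields `V`, `W`. -/
lemma extDerivOneForm_apply [FiniteDimensional ℝ E] {α : Π x : M, TangentSpace I x →L[ℝ] ℝ}
    (hα : SmoothOneForm α) {V W : Π x : M, TangentSpace I x} {x : M}
    (hV : MDiffAt (T% V) x) (hW : MDiffAt (T% W) x) :
    extDerivOneForm α x (V x) (W x) =
      mvfderiv I (F := ℝ) (fun y => α y (W y)) x (V x)
        - mvfderiv I (F := ℝ) (fun y => α y (V y)) x (W x)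
        - α x (mlieBracket I V W x) := by
  have hd {V : Π x : M, TangentSpace I x} (hV : MDiffAt (T% V) x) :
      MDifferentiableAt I 𝓘(ℝ, ℝ) (fun y => α y (V y)) x := by
    have h := MDifferentiableAt.clm_bundle_apply (F₁ := E) (F₂ := ℝ)
      (E₁ := fun x : M => TangentSpace I x) (E₂ := Bundle.Trivial M ℝ) (b := id)
      ((hα x).mdifferentiableAt (by simp)) hV
    simp only [mdifferentiableAt_totalSpace] at h
    exact h.2
  let Φ (V W : Π x : M, TangentSpace I x) : ℝ :=
    mvfderiv I (F := ℝ) (fun y => α y (W y)) x (V x)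
        - mvfderiv I (F := ℝ) (fun y => α y (V y)) x (W x) - α x (mlieBracket I V W x)
  have key : Φ (extend E (V x)) (extend E (W x)) = Φ V W := by
    refine TensorialAt.pointwise₂ (I := I) (F := E) (F' := E) (Φ := Φ)
      (fun W hW => ⟨?_, ?_⟩) (fun V hV => ⟨?_, ?_⟩)
      (mdifferentiableAt_extend ..) hV (mdifferentiableAt_extend ..) hW (by simp) (by simp)
    · intro f V hf hV
      simp [Φ, mlieBracket_smul_left hf hV, mvfderiv_fun_mul hf (hd hV)]
      ring
    · intro V V' hV hV'
      simp [Φ, mlieBracket_add_left hV hV', mvfderiv_fun_add (hd hV) (hd hV')]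
      ring
    · intro f W hf hW
      simp [Φ, mlieBracket_smul_right hf hW, mvfderiv_fun_mul hf (hd hW)]
      ring
    · intro W W' hW hW'
      simp [Φ, mlieBracket_add_right hW hW', mvfderiv_fun_add (hd hW) (hd hW')]
      ring
  simpa [Φ, extDerivOneForm] using key

/-- A smooth `(1,1)`-tensor field. -/
def SmoothEndomorphismField (J : Π x : M, TangentSpace I x →L[ℝ] TangentSpace I x) : Prop :=
  ContMDiff I (I.prod 𝓘(ℝ, E →L[ℝ] E)) ∞ (fun x => TotalSpace.mk' (E →L[ℝ] E) x (J x))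

/-- A complex structure on the tangent spaces is integrable if its Nijenhuis tensor
`N(V, W) = [JV, JW] - J[JV, W] - J[V, JW] - [V, W]` vanishes. -/
def IsIntegrableComplexStructure (J : Π x : M, TangentSpace I x →L[ℝ] TangentSpace I x) : Prop :=
  (∀ x v, J x (J x v) = -v) ∧
  ∀ V W : Π x : M, TangentSpace I x, SmoothVectorField V → SmoothVectorField W → ∀ x : M,
    mlieBracket I (fun y => J y (V y)) (fun y => J y (W y)) x
      - J x (mlieBracket I (fun y => J y (V y)) W x)
      - J x (mlieBracket I V (fun y => J y (W y)) x)
      - mlieBracket I V W x = 0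

/-- The half line `ℝ_+`. -/
def halfLine : TopologicalSpace.Opens ℝ := ⟨Set.Ioi 0, isOpen_Ioi⟩

/-- The almost complex structure on the cone `M × ℝ_+` that corresponds to `(ξ, η, Φ)`: with
`s` the coordinate on `ℝ_+` it is given by `X ↦ Φ X - η(X) s ∂_s` for `X` tangent to `M`, and
`s ∂_s ↦ ξ`; that is `X + b ∂_s ↦ Φ X + (b / s) ξ - s η(X) ∂_s`. -/
def coneComplexStructure (ξ : Π x : M, TangentSpace I x) (η : Π x : M, TangentSpace I x →L[ℝ] ℝ)
    (Φ : Π x : M, TangentSpace I x →L[ℝ] TangentSpace I x) (p : M × halfLine) :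
    TangentSpace (I.prod 𝓘(ℝ, ℝ)) p →L[ℝ] TangentSpace (I.prod 𝓘(ℝ, ℝ)) p :=
  let X : (TangentSpace I p.1 × ℝ) →L[ℝ] TangentSpace I p.1 := ContinuousLinearMap.fst ℝ _ _
  let b : (TangentSpace I p.1 × ℝ) →L[ℝ] ℝ := ContinuousLinearMap.snd ℝ _ _
  let s : ℝ := p.2
  (Φ p.1 ∘L X + (s⁻¹ • b).smulRight (ξ p.1)).prod (-s • (η p.1 ∘L X))

/-- An almost contact structure: `η(ξ) = 1` and `Φ² = -id + ξ ⊗ η`. -/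
structure IsAlmostContactStructure (ξ : Π x : M, TangentSpace I x)
    (η : Π x : M, TangentSpace I x →L[ℝ] ℝ)
    (Φ : Π x : M, TangentSpace I x →L[ℝ] TangentSpace I x) : Prop where
  smooth_vectorField : SmoothVectorField ξ
  smooth_form : SmoothOneForm η
  smooth_tensor : SmoothEndomorphismField Φ
  form_apply : ∀ x, η x (ξ x) = 1
  tensor_sq : ∀ x v, Φ x (Φ x v) = -v + η x v • ξ x

/-- A contact form: a smooth one-form without zeros whose exterior derivative is
nondegenerate on its kernel. -/
structure IsContactForm (α : Π x : M, TangentSpace I x →L[ℝ] ℝ) : Prop where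
  smooth : SmoothOneForm α
  ne_zero : ∀ x, α x ≠ 0
  nondegenerate : ∀ x v, α x v = 0 →
    (∀ w, α x w = 0 → extDerivOneForm α x v w = 0) → v = 0

/-- The Reeb field of a contact form: `α(Z) = 1` and `dα(Z, ·) = 0`. -/
structure IsReebField (α : Π x : M, TangentSpace I x →L[ℝ] ℝ)
    (Z : Π x : M, TangentSpace I x) : Prop where
  smooth : SmoothVectorField Z
  form_apply : ∀ x, α x (Z x) = 1
  extDeriv_apply : ∀ x w, extDerivOneForm α x (Z x) w = 0

/-- A contact structure: an almost contact structure `(ξ, η, Φ)` in which `η` is a contact form with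
Reeb field `ξ`. -/
structure IsContactStructure (ξ : Π x : M, TangentSpace I x)
    (η : Π x : M, TangentSpace I x →L[ℝ] ℝ)
    (Φ : Π x : M, TangentSpace I x →L[ℝ] TangentSpace I x) : Prop
    extends IsAlmostContactStructure ξ η Φ where
  contact : IsContactForm η
  reeb : IsReebField η ξ

variable [RiemannianBundle (fun x : M => TangentSpace I x)]

/-- A Killing field: `L_Z g = 0`, that is `Z(g(X, Y)) = g([Z, X], Y) + g(X, [Z, Y])`. -/
structure IsKillingField (Z : Π x : M, TangentSpace I x) : Prop where
  smooth : SmoothVectorField Z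
  lieDeriv_metric : ∀ X Y : Π x : M, TangentSpace I x,
    SmoothVectorField X → SmoothVectorField Y → ∀ x : M,
      mvfderiv I (F := ℝ) (fun y => inner ℝ (X y) (Y y)) x (Z x)
        = (inner ℝ (mlieBracket I Z X x) (Y x) : ℝ) + inner ℝ (X x) (mlieBracket I Z Y x)

/-- The one-form `g(Z, ·)`. -/
def dualOneForm (Z : Π x : M, TangentSpace I x) (x : M) : TangentSpace I x →L[ℝ] ℝ :=
  innerSL ℝ (Z x)

/-- A contact metric structure `(ξ, η, Φ, g)`: a contact structure with
`g(ΦX, ΦY) = g(X, Y) - η(X) η(Y)` and `dη(X, Y) = 2 g(ΦX, Y)`. -/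
structure IsContactMetricStructure (ξ : Π x : M, TangentSpace I x)
    (η : Π x : M, TangentSpace I x →L[ℝ] ℝ)
    (Φ : Π x : M, TangentSpace I x →L[ℝ] TangentSpace I x) : Prop
    extends IsContactStructure ξ η Φ where
  compatible : ∀ x v w, (inner ℝ (Φ x v) (Φ x w) : ℝ) = inner ℝ v w - η x v * η x w
  extDeriv_eq : ∀ x v w, extDerivOneForm η x v w = 2 * inner ℝ (Φ x v) w

/-- A Sasakian structure: a contact metric structure whose almost complex structure on the
cone `M × ℝ_+` is integrable. -/
structure IsSasakianStructure (ξ : Π x : M, TangentSpace I x)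
    (η : Π x : M, TangentSpace I x →L[ℝ] ℝ)
    (Φ : Π x : M, TangentSpace I x →L[ℝ] TangentSpace I x) : Prop
    extends IsContactMetricStructure ξ η Φ where
  integrable : IsIntegrableComplexStructure (I := I.prod 𝓘(ℝ, ℝ)) (coneComplexStructure ξ η Φ)

end Sasakian

end RollingHolonomy

open RollingHolonomy

namespace RollingHolonomy

set_option linter.unusedSectionVars false

section LinearODE

open Set Metric

variable {E R : Type*} [NormedAddCommGroup E] [NormedSpace ℝ E] [NormedRing R] [NormedAlgebra ℝ R]

/-- Fundamental solutions of a linear differential equation with small coefficients. -/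
lemma exists_fundamental_solution [CompleteSpace R] (hone : ‖(1 : R)‖ ≤ 1) {A : ℝ → R} {K : ℝ}
    (hK : K ≤ 1 / 4) (hA : ContinuousOn A (Icc (-1) 2)) (hAK : ∀ t ∈ Icc (-1 : ℝ) 2, ‖A t‖ ≤ K) :
    ∃ U : ℝ → R, U 0 = 1 ∧ (∀ t ∈ Ioo (-1 : ℝ) 2, HasDerivAt U (A t * U t) t) ∧
      (∀ t ∈ Icc (0 : ℝ) 1, ‖U t‖ ≤ 3) ∧ ∀ t ∈ Icc (0 : ℝ) 1, ‖U t - 1‖ ≤ 3 * K := by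
  have hK0 : 0 ≤ K := (norm_nonneg _).trans (hAK 0 (by norm_num))
  lift K to NNReal using hK0
  have hpl : IsPicardLindelof (fun t (U : R) => A t * U)
      (⟨0, by norm_num⟩ : Icc (-1 : ℝ) 2) (1 : R) 1 0 (2 * K) K := by
    refine ⟨fun t ht => ?_, fun U _ => hA.mul continuousOn_const, fun t ht U hU => ?_, ?_⟩
    · refine LipschitzOnWith.of_dist_le_mul fun U _ V _ => ?_
      rw [dist_eq_norm, dist_eq_norm, ← mul_sub]
      exact (norm_mul_le _ _).trans (by gcongr; exact hAK t ht)
    · have h2 : ‖U‖ ≤ 2 := by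
        have := norm_le_norm_add_norm_sub' U 1
        rw [mem_closedBall, dist_eq_norm] at hU
        have h1 : ‖U - 1‖ ≤ 1 := by simpa using hU
        rw [norm_sub_rev] at this
        rw [norm_sub_rev] at h1
        linarith
      calc ‖A t * U‖ ≤ ‖A t‖ * ‖U‖ := norm_mul_le _ _
        _ ≤ K * 2 := by gcongr; exact hAK t ht
        _ = ((2 * K : NNReal) : ℝ) := by push_cast; ring
    · have : max ((2 : ℝ) - 0) (0 - -1) = 2 := by norm_num
      push_cast
      rw [this]
      linarith
  obtain ⟨U, hU0, hU⟩ := hpl.exists_eq_forall_mem_Icc_hasDerivWithinAt₀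
  have hder : ∀ t ∈ Ioo (-1 : ℝ) 2, HasDerivAt U (A t * U t) t := fun t ht =>
    (hU t (Ioo_subset_Icc_self ht)).hasDerivAt (Icc_mem_nhds ht.1 ht.2)
  have hcont : ContinuousOn U (Icc 0 1) := fun t ht =>
    (hder t ⟨by linarith [ht.1], by linarith [ht.2]⟩).continuousAt.continuousWithinAt
  have hbound : ∀ t ∈ Icc (0 : ℝ) 1, ‖U t‖ ≤ 3 := by
    intro t ht
    have := norm_le_gronwallBound_of_norm_deriv_right_le (f := U) (f' := fun t => A t * U t)
      (δ := 1) (K := K) (ε := 0) (a := 0) (b := 1) hcont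
      (fun s hs => (hder s ⟨by linarith [hs.1], by linarith [hs.2]⟩).hasDerivWithinAt)
      (by simpa [hU0] using hone)
      (fun s hs => by
        rw [add_zero]
        exact (norm_mul_le _ _).trans
          (by gcongr; exact hAK s ⟨by linarith [hs.1], by linarith [hs.2]⟩)) t ht
    refine this.trans ?_
    rw [gronwallBound_ε0, one_mul]
    calc Real.exp (K * (t - 0)) ≤ Real.exp 1 := by
          apply Real.exp_le_exp.2
          nlinarith [ht.1, ht.2, K.2]
      _ ≤ 3 := by linarith [Real.exp_one_lt_d9]
  refine ⟨U, hU0, hder, hbound, fun t ht => ?_⟩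
  have := (convex_Icc (0 : ℝ) 1).norm_image_sub_le_of_norm_hasDerivWithin_le (f := U)
    (f' := fun t => A t * U t) (C := K * 3)
    (fun s hs => (hder s ⟨by linarith [hs.1], by linarith [hs.2]⟩).hasDerivWithinAt)
    (fun s hs => (norm_mul_le _ _).trans (by
      gcongr
      · exact hAK s ⟨by linarith [hs.1], by linarith [hs.2]⟩
      · exact hbound s hs)) (left_mem_Icc.2 zero_le_one) ht
  rw [hU0] at this
  refine this.trans ?_
  rw [sub_zero, Real.norm_of_nonneg ht.1]
  nlinarith [ht.1, ht.2, K.2]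

/-- Parallel transport along short segments, for a connection form `Γ` on an open set. The
transport depends differentiably on the end point, with derivative `-Γ` at the start. -/
lemma exists_segment_transport [CompleteSpace R] (hone : ‖(1 : R)‖ ≤ 1) {Ω : Set E} (hΩ : IsOpen Ω)
    {Γ : E → E →L[ℝ] R} (hΓ : ContinuousOn Γ Ω) {u : E} (hu : u ∈ Ω) :
    ∃ δ > 0, ∃ U : E → ℝ → R,
      (∀ v, ‖v‖ < δ → (∀ t ∈ Ioo (-1 : ℝ) 2, u + t • v ∈ Ω) ∧ U v 0 = 1 ∧
        ∀ t ∈ Ioo (-1 : ℝ) 2, HasDerivAt (U v) (-(Γ (u + t • v) v * U v t)) t) ∧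
      U 0 1 = 1 ∧ HasFDerivAt (fun v => U v 1) (-Γ u) 0 := by
  have hev : ∀ᶠ w in 𝓝 u, w ∈ Ω ∧ ‖Γ w - Γ u‖ < 1 := by
    have hmem : ∀ᶠ w in 𝓝 u, w ∈ Ω := hΩ.mem_nhds hu
    refine hmem.and ?_
    have := (hΓ.continuousAt (hΩ.mem_nhds hu)).eventually (ball_mem_nhds (Γ u) one_pos)
    simpa [dist_eq_norm] using this
  obtain ⟨ε, hε, hball⟩ := Metric.eventually_nhds_iff.1 hev
  set C : ℝ := ‖Γ u‖ + 1 with hC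
  have hCpos : 0 < C := by positivity
  have hmem : ∀ v : E, ‖v‖ < ε / 2 → ∀ t ∈ Icc (-1 : ℝ) 2, dist (u + t • v) u < ε := by
    intro v hv t ht
    rw [dist_eq_norm, add_sub_cancel_left, norm_smul]
    have : ‖t‖ ≤ 2 := by rw [Real.norm_eq_abs, abs_le]; constructor <;> linarith [ht.1, ht.2]
    nlinarith [norm_nonneg v]
  have hCb : ∀ v : E, ‖v‖ < ε / 2 → ∀ t ∈ Icc (-1 : ℝ) 2, ‖Γ (u + t • v)‖ ≤ C := by
    intro v hv t ht
    have h1 := (hball (hmem v hv t ht)).2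
    have h2 := norm_le_norm_add_norm_sub' (Γ (u + t • v)) (Γ u)
    rw [norm_sub_rev] at h2
    rw [hC]
    rw [norm_sub_rev] at h1
    linarith
  set δ := min (ε / 2) (1 / (4 * C)) with hδ
  have hδpos : 0 < δ := by positivity
  have key : ∀ v : E, ‖v‖ < δ → ∃ U : ℝ → R, U 0 = 1 ∧
      (∀ t ∈ Ioo (-1 : ℝ) 2, HasDerivAt U (-(Γ (u + t • v) v) * U t) t) ∧
      (∀ t ∈ Icc (0 : ℝ) 1, ‖U t‖ ≤ 3) ∧ ∀ t ∈ Icc (0 : ℝ) 1, ‖U t - 1‖ ≤ 3 * (C * ‖v‖) := by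
    intro v hv
    have hv1 : ‖v‖ < ε / 2 := hv.trans_le (min_le_left _ _)
    have hv2 : ‖v‖ < 1 / (4 * C) := hv.trans_le (min_le_right _ _)
    refine exists_fundamental_solution hone (A := fun t => -(Γ (u + t • v) v)) ?_ ?_ fun t ht => ?_
    · rw [lt_div_iff₀ (by positivity)] at hv2
      linarith
    · refine ContinuousOn.neg (ContinuousOn.clm_apply ?_ continuousOn_const)
      exact hΓ.comp (by fun_prop) fun t ht => (hball (hmem v hv1 t ht)).1
    · rw [norm_neg]
      exact (ContinuousLinearMap.le_opNorm _ _).trans (by gcongr; exact hCb v hv1 t ht)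
  choose! U hU0 hU hU3 hU1 using key
  have hlittle : ∀ c > 0, ∀ᶠ v in 𝓝 (0 : E), ‖U v 1 - 1 + Γ u v‖ ≤ c * ‖v‖ := by
    intro c hc
    have hev2 : ∀ᶠ w in 𝓝 u, ‖Γ w - Γ u‖ < c / 6 := by
      have := (hΓ.continuousAt (hΩ.mem_nhds hu)).eventually
        (ball_mem_nhds (Γ u) (show 0 < c / 6 by positivity))
      simpa [dist_eq_norm] using this
    obtain ⟨ε', hε', hball'⟩ := Metric.eventually_nhds_iff.1 hev2
    have hev3 : ∀ᶠ v in 𝓝 (0 : E), ‖v‖ < min δ (min ε' (c / (6 * C * C))) := by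
      have := ball_mem_nhds (0 : E) (show 0 < min δ (min ε' (c / (6 * C * C))) by positivity)
      filter_upwards [this] with v hv
      simpa using hv
    filter_upwards [hev3] with v hv
    have hvδ : ‖v‖ < δ := hv.trans_le (min_le_left _ _)
    have hvε : ‖v‖ < ε' := hv.trans_le ((min_le_right _ _).trans (min_le_left _ _))
    have hvc : ‖v‖ < c / (6 * C * C) := hv.trans_le ((min_le_right _ _).trans (min_le_right _ _))
    have h := (convex_Icc (0 : ℝ) 1).norm_image_sub_le_of_norm_hasDerivWithin_le
      (f := fun t => U v t + t • Γ u v)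
      (f' := fun t => -(Γ (u + t • v) v) * U v t + Γ u v) (C := c * ‖v‖)
      (fun s hs => by
        have h1 := hU v hvδ s ⟨by linarith [hs.1], by linarith [hs.2]⟩
        have h2 : HasDerivAt (fun t : ℝ => t • Γ u v) (Γ u v) s := by
          simpa using (hasDerivAt_id s).smul_const (Γ u v)
        exact (h1.add h2).hasDerivWithinAt)
      (fun s hs => by
        have h1 : -(Γ (u + s • v) v) * U v s + Γ u v
          = -((Γ (u + s • v) - Γ u) v * U v s) - Γ u v * (U v s - 1) := by
          simp only [sub_apply]
          noncomm_ring
        have hs' : dist (u + s • v) u < ε' := by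
          rw [dist_eq_norm, add_sub_cancel_left, norm_smul, Real.norm_of_nonneg hs.1]
          nlinarith [norm_nonneg v, hs.2]
        have h2 : ‖Γ (u + s • v) - Γ u‖ ≤ c / 6 := (hball' hs').le
        have h3 := hU3 v hvδ s hs
        have h4 := hU1 v hvδ s hs
        have h5 : ‖Γ u‖ ≤ C := by rw [hC]; linarith
        calc ‖-(Γ (u + s • v) v) * U v s + Γ u v‖
            ≤ ‖(Γ (u + s • v) - Γ u) v * U v s‖ + ‖Γ u v * (U v s - 1)‖ := by
              rw [h1, ← norm_neg ((Γ (u + s • v) - Γ u) v * U v s)]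
              exact norm_sub_le _ _
          _ ≤ (c / 6 * ‖v‖) * 3 + (C * ‖v‖) * (3 * (C * ‖v‖)) := by
              refine add_le_add ((norm_mul_le _ _).trans ?_) ((norm_mul_le _ _).trans ?_)
              · gcongr
                exact (ContinuousLinearMap.le_opNorm _ _).trans (by gcongr)
              · gcongr
                exact (ContinuousLinearMap.le_opNorm _ _).trans (by gcongr)
          _ ≤ c * ‖v‖ := by
              rw [lt_div_iff₀ (by positivity)] at hvc
              nlinarith [norm_nonneg v])
      (left_mem_Icc.2 zero_le_one) (right_mem_Icc.2 zero_le_one)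
    simp only [hU0 v hvδ, one_smul, zero_smul, add_zero, sub_zero, norm_one, mul_one] at h
    rw [show U v 1 - 1 + Γ u v = U v 1 + Γ u v - 1 by abel]
    exact h
  have hU01 : U 0 1 = 1 := by
    have := (hlittle 1 one_pos).self_of_nhds
    simpa [sub_eq_zero] using this
  refine ⟨δ, hδpos, U, fun v hv => ⟨fun t ht => ?_, hU0 v hv, fun t ht => ?_⟩, hU01, ?_⟩
  · exact (hball (hmem v (hv.trans_le (min_le_left _ _)) t (Ioo_subset_Icc_self ht))).1
  · have := hU v hv t ht
    rwa [neg_mul] at this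
  · rw [hasFDerivAt_iff_isLittleO_nhds_zero, Asymptotics.isLittleO_iff]
    intro c hc
    filter_upwards [hlittle c hc] with v hv
    simpa [hU01, sub_neg_eq_add] using hv

set_option synthInstance.maxHeartbeats 200000 in
/-- If conjugation by `P v` carries `A u` to `A (u + v)`, then `A` is differentiable at `u`. -/
lemma hasFDerivAt_of_conj [CompleteSpace R] {A P : E → R} {D : E →L[ℝ] R} {u : E}
    (hP : HasFDerivAt P D 0) (hP0 : P 0 = 1)
    (h : ∀ᶠ v in 𝓝 (0 : E), A (u + v) * P v = P v * A u) :
    HasFDerivAt A (((ContinuousLinearMap.mul ℝ R).flip (A u)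
      - ContinuousLinearMap.mul ℝ R (A u)) ∘L D) u := by
  have hinv : HasFDerivAt (fun v => Ring.inverse (P v)) (-D) 0 := by
    have h1 := hasFDerivAt_ringInverse (𝕜 := ℝ) (1 : Rˣ)
    have h2 : HasFDerivAt Ring.inverse (-ContinuousLinearMap.id ℝ R) (P 0) := by
      rw [hP0]
      refine h1.congr_fderiv (ContinuousLinearMap.ext fun x => ?_)
      change -(((1 : Rˣ)⁻¹ : Rˣ) * x * ((1 : Rˣ)⁻¹ : Rˣ) : R) = -x
      rw [inv_one, Units.val_one, one_mul, mul_one]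
    have h3 := h2.comp (0 : E) hP
    exact h3.congr_fderiv (ContinuousLinearMap.ext fun v => rfl)
  have hprod := (hP.mul_const' (A u)).mul' hinv
  have hsub : HasFDerivAt (fun y : E => y - u) (ContinuousLinearMap.id ℝ E) u :=
    (hasFDerivAt_id u).sub_const u
  have hcomp := HasFDerivAt.comp (g := fun v => P v * A u * Ring.inverse (P v)) u
    (by simpa using! hprod) hsub
  have hunit : ∀ᶠ v in 𝓝 (0 : E), IsUnit (P v) := by
    have : IsUnit (P 0) := by rw [hP0]; exact isUnit_one
    exact hP.continuousAt.eventually (Units.isOpen.mem_nhds this)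
  have hev : ∀ᶠ v in 𝓝 (0 : E), A (u + v) = P v * A u * Ring.inverse (P v) := by
    filter_upwards [h, hunit] with v hv hv'
    rw [← hv, mul_assoc, Ring.mul_inverse_cancel _ hv', mul_one]
  have htend : Filter.Tendsto (fun y : E => y - u) (𝓝 u) (𝓝 0) := by
    have : ContinuousAt (fun y : E => y - u) u := by fun_prop
    simpa [ContinuousAt] using this
  have hev' : A =ᶠ[𝓝 u] (fun v => P v * A u * Ring.inverse (P v)) ∘ fun y => y - u := by
    filter_upwards [htend.eventually hev] with y hy
    simpa using hy
  refine (hcomp.congr_of_eventuallyEq hev').congr_fderiv ?_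
  ext v
  simp [hP0]
  abel

/-- Regularity of solutions of the parallelism equation `dA = [G, A]`. -/
lemma contDiffOn_of_hasFDerivAt_bracket {Ω : Set E} (hΩ : IsOpen Ω) {A : E → R} {G : E → E →L[ℝ] R} (hG : ContDiffOn ℝ ∞ G Ω)
    (hA : ∀ u ∈ Ω, HasFDerivAt A (((ContinuousLinearMap.mul ℝ R).flip (A u)
      - ContinuousLinearMap.mul ℝ R (A u)) ∘L G u) u) :
    ContDiffOn ℝ ∞ A Ω := by
  rw [contDiffOn_infty]
  intro n
  induction n with
  | zero =>
    exact contDiffOn_zero.2 fun u hu => (hA u hu).continuousAt.continuousWithinAt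
  | succ n ih =>
    rw [show ((n + 1 : ℕ) : WithTop ℕ∞) = (n : WithTop ℕ∞) + 1 by push_cast; rfl,
      contDiffOn_succ_iff_fderiv_of_isOpen hΩ]
    refine ⟨fun u hu => (hA u hu).differentiableAt.differentiableWithinAt, by simp, ?_⟩
    have h1 : ContDiffOn ℝ n (fun u => ((ContinuousLinearMap.mul ℝ R).flip (A u)
      - ContinuousLinearMap.mul ℝ R (A u)) ∘L G u) Ω := by
      have hGn : ContDiffOn ℝ n G Ω := hG.of_le (by exact_mod_cast le_top)
      exact (((ContinuousLinearMap.contDiff _).comp_contDiffOn ih).sub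
        ((ContinuousLinearMap.contDiff _).comp_contDiffOn ih)).clm_comp hGn
    exact h1.congr fun u hu => (hA u hu).fderiv

end LinearODE

noncomputable section LocalForm

variable {E : Type*} [NormedAddCommGroup E] [NormedSpace ℝ E]
  {H : Type*} [TopologicalSpace H] {I : ModelWithCorners ℝ E H}
  {M : Type*} [TopologicalSpace M] [ChartedSpace H M]
  {F : Type*} [NormedAddCommGroup F] [NormedSpace ℝ F]
  {V : M → Type*} [TopologicalSpace (TotalSpace F V)]
  [∀ x, AddCommGroup (V x)] [∀ x, Module ℝ (V x)] [∀ x, TopologicalSpace (V x)]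
  [∀ x, IsTopologicalAddGroup (V x)] [∀ x, ContinuousSMul ℝ (V x)] [FiberBundle F V]
  [VectorBundle ℝ F V]

/-- Parallel transport along a smooth curve with prescribed end points. -/
lemma exists_isParallelTransport_of_curve {cov : CovariantDerivative I F V} {y z : M}
    {γ : ℝ → M} (hγ : ContMDiff 𝓘(ℝ, ℝ) I ∞ γ) (hy : γ 0 = y) (hz : γ 1 = z)
    (B : V y ≃ₗ[ℝ] V z)
    (hB : ∀ v, ∃ W : ∀ t, V (γ t), IsParallelAlong cov γ W ∧ HEq (W 0) v ∧ HEq (W 1) (B v)) :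
    IsParallelTransport cov y z B := by
  subst hy hz
  exact IsParallelTransport.smooth γ hγ B (by simpa using hB)

lemma mvfderiv_congr_of_eventuallyEq {f g : M → F} {x : M} (h : f =ᶠ[𝓝 x] g) :
    mvfderiv I f x = mvfderiv I g x := by
  have h1 : mfderiv I 𝓘(ℝ, F) f x = mfderiv I 𝓘(ℝ, F) g x := h.mfderiv_eq
  exact h1

variable {e : Trivialization F (π F V)} [MemTrivializationAtlas e]

lemma eventually_mem_baseSet (e : Trivialization F (π F V)) {x : M} (hx : x ∈ e.baseSet) :
    ∀ᶠ y in 𝓝 x, y ∈ e.baseSet :=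
  e.open_baseSet.mem_nhds hx

variable [ContMDiffVectorBundle 1 F V I]

lemma mdifferentiableAt_section_iff_coord {σ : Π x, V x} {x : M} (hx : x ∈ e.baseSet) :
    MDiffAt (T% σ) x ↔
      MDifferentiableAt I 𝓘(ℝ, F) (fun y => e.continuousLinearMapAt ℝ y (σ y)) x := by
  rw [e.mdifferentiableAt_section_iff I σ hx]
  refine Filter.EventuallyEq.mdifferentiableAt_iff ?_
  filter_upwards [eventually_mem_baseSet e hx] with y hy
  exact (e.continuousLinearMapAt_apply_of_mem ℝ hy _).symm

lemma mdifferentiableAt_symmL {x : M} (hx : x ∈ e.baseSet) (p : F) :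
    MDiffAt (T% (fun y => e.symmL ℝ y p)) x := by
  rw [mdifferentiableAt_section_iff_coord hx]
  refine (mdifferentiableAt_const (c := p)).congr_of_eventuallyEq ?_
  filter_upwards [eventually_mem_baseSet e hx] with y hy
  exact e.continuousLinearMapAt_symmL hy p

variable (I e) in
/-- The flat connection given by a local trivialization. -/
lemma isCovariantDerivativeOn_flat :
    IsCovariantDerivativeOn (I := I) F (fun (σ : Π x, V x) y => (e.symmL ℝ y) ∘L
      mvfderiv I (fun z => e.continuousLinearMapAt ℝ z (σ z)) y) e.baseSet where
  add {σ σ' x} hσ hσ' hx := by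
    rw [mdifferentiableAt_section_iff_coord hx] at hσ hσ'
    ext v
    simp [-Trivialization.continuousLinearMapAt_apply, mvfderiv_fun_add hσ hσ']
  leibniz {σ f x} hσ hf hx := by
    rw [mdifferentiableAt_section_iff_coord hx] at hσ
    ext v
    simp [-Trivialization.continuousLinearMapAt_apply, mvfderiv_fun_smul hf hσ, e.symmL_continuousLinearMapAt hx]

variable [FiniteDimensional ℝ E] [FiniteDimensional ℝ F] [IsManifold I 1 M]
  (cov : CovariantDerivative I F V)

variable (e) in
/-- The connection form of `cov` with respect to a local trivialization `e` of the vector bundle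
and a local trivialization `e'` of the tangent bundle. -/
def connectionForm (e' : Trivialization E (π E (TangentSpace I : M → Type _)))
    [MemTrivializationAtlas e'] (y : M) : E →L[ℝ] F →L[ℝ] F :=
  LinearMap.toContinuousLinearMap (LinearMap.toContinuousLinearMap.toLinearMap ∘ₗ
    LinearMap.mk₂ ℝ (fun (v : E) (p : F) => e.continuousLinearMapAt ℝ y
      ((cov.isCovariantDerivativeOn (s := e.baseSet)).difference
        (isCovariantDerivativeOn_flat I e) y (e.symmL ℝ y p) (e'.symmL ℝ y v)))
      (by simp) (by simp) (by simp) (by simp))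

variable {cov} {e' : Trivialization E (π E (TangentSpace I : M → Type _))}
  [MemTrivializationAtlas e']

/-- The local formula for a connection: `∇ = d + Γ`. -/
lemma coord_cov {σ : Π x, V x} {x : M} (hx : x ∈ e.baseSet) (hx' : x ∈ e'.baseSet)
    (hσ : MDiffAt (T% σ) x) (v : TangentSpace I x) :
    e.continuousLinearMapAt ℝ x (cov σ x v) =
      mvfderiv I (fun y => e.continuousLinearMapAt ℝ y (σ y)) x v
        + connectionForm e cov e' x (e'.continuousLinearMapAt ℝ x v)
          (e.continuousLinearMapAt ℝ x (σ x)) := by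
  have h := (cov.isCovariantDerivativeOn (s := e.baseSet)).difference_apply
    (isCovariantDerivativeOn_flat I e) hx hσ
  simp only [connectionForm, LinearMap.coe_toContinuousLinearMap', LinearMap.coe_comp,
    LinearEquiv.coe_coe, Function.comp_apply, LinearMap.mk₂_apply,
    e.symmL_continuousLinearMapAt hx, e'.symmL_continuousLinearMapAt hx', h]
  simp [-Trivialization.continuousLinearMapAt_apply, e.continuousLinearMapAt_symmL hx]

lemma mvfderiv_coord_symmL {x : M} (hx : x ∈ e.baseSet) (p : F) :
    mvfderiv I (fun y => e.continuousLinearMapAt ℝ y (e.symmL ℝ y p)) x = 0 := by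
  rw [mvfderiv_congr_of_eventuallyEq (g := fun _ => p), mvfderiv_const]
  filter_upwards [eventually_mem_baseSet e hx] with y hy
  exact e.continuousLinearMapAt_symmL hy p

lemma coord_cov_symmL {x : M} (hx : x ∈ e.baseSet) (hx' : x ∈ e'.baseSet) (p : F)
    (v : TangentSpace I x) :
    e.continuousLinearMapAt ℝ x (cov (fun y => e.symmL ℝ y p) x v) =
      connectionForm e cov e' x (e'.continuousLinearMapAt ℝ x v) p := by
  rw [coord_cov (e' := e') hx hx' (mdifferentiableAt_symmL hx p), mvfderiv_coord_symmL hx,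
    e.continuousLinearMapAt_symmL hx]
  simp

lemma connectionForm_apply {x : M} (hx : x ∈ e.baseSet) (hx' : x ∈ e'.baseSet) (v : E) (p : F) :
    connectionForm e cov e' x v p =
      e.continuousLinearMapAt ℝ x (cov (fun y => e.symmL ℝ y p) x (e'.symmL ℝ x v)) := by
  rw [coord_cov_symmL (e' := e') hx hx', e'.continuousLinearMapAt_symmL hx']

/-- Differentiability of a section along a curve, in terms of a local trivialization. -/
lemma mdifferentiableAt_along_iff {γ : ℝ → M} {W : ∀ t, V (γ t)} {t : ℝ} (ht : γ t ∈ e.baseSet)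
    (hγ : MDifferentiableAt 𝓘(ℝ, ℝ) I γ t) :
    MDifferentiableAt 𝓘(ℝ, ℝ) (I.prod 𝓘(ℝ, F)) (fun s => TotalSpace.mk' F (γ s) (W s)) t ↔
      DifferentiableAt ℝ (fun s => e.continuousLinearMapAt ℝ (γ s) (W s)) t := by
  rw [e.mdifferentiableAt_totalSpace_iff I _ (e.mem_source.2 ht), ← mdifferentiableAt_iff_differentiableAt]
  refine (and_iff_right hγ).trans (Filter.EventuallyEq.mdifferentiableAt_iff ?_)
  filter_upwards [hγ.continuousAt.eventually (eventually_mem_baseSet e ht)] with s hs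
  exact (e.continuousLinearMapAt_apply_of_mem ℝ hs _).symm

/-- The covariant derivative along a curve in an arbitrary local trivialization. -/
lemma coord_covDerivAlong {γ : ℝ → M} {W : ∀ t, V (γ t)} {t : ℝ}
    (ht : γ t ∈ e.baseSet) (ht' : γ t ∈ e'.baseSet)
    (hW : MDifferentiableAt 𝓘(ℝ, ℝ) (I.prod 𝓘(ℝ, F)) (fun s => TotalSpace.mk' F (γ s) (W s)) t)
    (hγ : MDifferentiableAt 𝓘(ℝ, ℝ) I γ t) :
    e.continuousLinearMapAt ℝ (γ t) (covDerivAlong cov γ W t) =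
      deriv (fun s => e.continuousLinearMapAt ℝ (γ s) (W s)) t
        + connectionForm e cov e' (γ t)
          (e'.continuousLinearMapAt ℝ (γ t) (mfderiv 𝓘(ℝ, ℝ) I γ t (1 : ℝ)))
          (e.continuousLinearMapAt ℝ (γ t) (W t)) := by
  set e₀ := trivializationAt F V (γ t) with he₀
  have ht₀ : γ t ∈ e₀.baseSet := mem_baseSet_trivializationAt' (γ t)
  set v : TangentSpace I (γ t) := mfderiv 𝓘(ℝ, ℝ) I γ t (1 : ℝ) with hv
  set w := fun s => e.continuousLinearMapAt ℝ (γ s) (W s) with hw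
  set p := w t with hp
  let g : M → F →L[ℝ] F := fun y => (e.coordChangeL ℝ e₀ y : F →L[ℝ] F)
  have hwd : DifferentiableAt ℝ w t := (mdifferentiableAt_along_iff ht hγ).1 hW
  have hg : MDifferentiableAt I 𝓘(ℝ, F →L[ℝ] F) g (γ t) := mdifferentiableAt_coordChangeL ht ht₀
  have hgγ : DifferentiableAt ℝ (fun s => g (γ s)) t := (hg.comp t hγ).differentiableAt
  have hgapp : ∀ y ∈ e.baseSet, y ∈ e₀.baseSet → ∀ q : F,
      g y q = e₀.continuousLinearMapAt ℝ y (e.symmL ℝ y q) := by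
    intro y hy hy₀ q
    change (e.coordChangeL ℝ e₀ y) q = _
    rw [e.coordChangeL_apply e₀ ⟨hy, hy₀⟩, e₀.continuousLinearMapAt_apply_of_mem ℝ hy₀,
      e.symmL_apply hy]
  have hder : deriv (fun s => (e₀ ⟨γ s, W s⟩).2) t = deriv (fun s => g (γ s)) t p
      + g (γ t) (deriv w t) := by
    have h1 : (fun s => (e₀ ⟨γ s, W s⟩).2) =ᶠ[𝓝 t] fun s => g (γ s) (w s) := by
      filter_upwards [hγ.continuousAt.eventually (eventually_mem_baseSet e ht),
        hγ.continuousAt.eventually (eventually_mem_baseSet e₀ ht₀)] with s hs hs₀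
      rw [hgapp _ hs hs₀, hw]
      simp only [e.symmL_continuousLinearMapAt hs]
      exact (e₀.continuousLinearMapAt_apply_of_mem ℝ hs₀ _).symm
    rw [h1.deriv_eq]
    exact (hgγ.hasDerivAt.clm_apply hwd.hasDerivAt).deriv
  have hτ := mdifferentiableAt_symmL (I := I) ht p
  have hgp : mvfderiv I (fun y => e₀.continuousLinearMapAt ℝ y (e.symmL ℝ y p)) (γ t) v
      = deriv (fun s => g (γ s)) t p := by
    have h1 : mvfderiv I (fun y => e₀.continuousLinearMapAt ℝ y (e.symmL ℝ y p)) (γ t)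
        = mvfderiv I (fun y => g y p) (γ t) := by
      refine mvfderiv_congr_of_eventuallyEq ?_
      filter_upwards [eventually_mem_baseSet e ht, eventually_mem_baseSet e₀ ht₀] with y hy hy₀
      exact (hgapp y hy hy₀ p).symm
    have hgp : MDifferentiableAt I 𝓘(ℝ, F) (fun y => g y p) (γ t) :=
      ((ContinuousLinearMap.apply ℝ F p).mdifferentiableAt).comp (γ t) hg
    have h2 := mfderiv_comp_apply t hgp hγ (1 : ℝ)
    have h3 : mfderiv 𝓘(ℝ, ℝ) 𝓘(ℝ, F) ((fun y => g y p) ∘ γ) t (1 : ℝ)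
        = deriv (fun s => g (γ s)) t p := by
      rw [mfderiv_eq_fderiv]
      change deriv (fun s => g (γ s) p) t = _
      simpa using (hgγ.hasDerivAt.clm_apply (hasDerivAt_const t p)).deriv
    rw [h1]
    exact h2.symm.trans h3
  have hWt : e.symmL ℝ (γ t) p = W t := e.symmL_continuousLinearMapAt ht (W t)
  have hext : cov (extend F (W t)) (γ t) v
      = cov (fun y => e₀.symmL ℝ y (e₀.continuousLinearMapAt ℝ (γ t) (W t))) (γ t) v := by
    rw [cov.isCovariantDerivativeOnUniv.congr_of_eventuallyEq (mdifferentiableAt_extend I F (W t))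
      (mdifferentiableAt_symmL ht₀ _) Filter.univ_mem]
    filter_upwards [eventually_mem_baseSet e₀ ht₀] with y hy
    rw [e₀.symmL_apply hy, e₀.continuousLinearMapAt_apply_of_mem ℝ ht₀]
    rfl
  have hmain : covDerivAlong cov γ W t
      = cov (fun y => e.symmL ℝ y p) (γ t) v + e.symmL ℝ (γ t) (deriv w t) := by
    apply (e₀.continuousLinearEquivAt ℝ (γ t) ht₀).injective
    have hcoe : ∀ q, e₀.continuousLinearEquivAt ℝ (γ t) ht₀ q
      = e₀.continuousLinearMapAt ℝ (γ t) q := fun q => by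
        rw [← e₀.coe_continuousLinearEquivAt_eq (R := ℝ) ht₀]
    rw [hcoe, hcoe, map_add, coord_cov (e' := e') ht₀ ht' hτ, hgp, covDerivAlong, map_add,
      ← he₀, ← hv, hext, coord_cov_symmL (e' := e') ht₀ ht', hder, ← e₀.symmL_apply (R := ℝ) ht₀,
      e₀.continuousLinearMapAt_symmL ht₀, hWt, ← hgapp _ ht ht₀]
    exact add_right_comm _ _ _
  rw [hmain, map_add, e.continuousLinearMapAt_symmL ht, coord_cov_symmL (e' := e') ht ht']
  exact add_comm _ _

end LocalForm

noncomputable section ParallelTransport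

variable {E : Type*} [NormedAddCommGroup E] [NormedSpace ℝ E] [FiniteDimensional ℝ E]
  {M : Type*} [TopologicalSpace M] [ChartedSpace E M] [IsManifold 𝓘(ℝ, E) ∞ M]
  {F : Type*} [NormedAddCommGroup F] [NormedSpace ℝ F] [FiniteDimensional ℝ F]
  {V : M → Type*} [TopologicalSpace (TotalSpace F V)]
  [∀ x, AddCommGroup (V x)] [∀ x, Module ℝ (V x)] [∀ x, TopologicalSpace (V x)]
  [∀ x, IsTopologicalAddGroup (V x)] [∀ x, ContinuousSMul ℝ (V x)] [FiberBundle F V]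
  [VectorBundle ℝ F V] [ContMDiffVectorBundle ∞ F V 𝓘(ℝ, E)]

/-- A connection is smooth if it takes smooth sections to smooth sections. -/
def IsSmoothConnection (cov : CovariantDerivative 𝓘(ℝ, E) F V) : Prop :=
  ∀ (σ : Π x, V x) (X : Π x : M, TangentSpace 𝓘(ℝ, E) x) (x : M),
    ContMDiffAt 𝓘(ℝ, E) (𝓘(ℝ, E).prod 𝓘(ℝ, F)) ∞ (fun y => TotalSpace.mk' F y (σ y)) x →
    ContMDiffAt 𝓘(ℝ, E) (𝓘(ℝ, E).prod 𝓘(ℝ, E)) ∞ (fun y => TotalSpace.mk' E y (X y)) x →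
    ContMDiffAt 𝓘(ℝ, E) (𝓘(ℝ, E).prod 𝓘(ℝ, F)) ∞
      (fun y => TotalSpace.mk' F y (cov σ y (X y))) x

instance : ContMDiffVectorBundle 1 F V 𝓘(ℝ, E) :=
  ContMDiffVectorBundle.of_le (n := ∞) (by simp)

lemma contMDiffAt_section_iff_coord {k : WithTop ℕ∞} [ContMDiffVectorBundle k F V 𝓘(ℝ, E)]
    {e : Trivialization F (π F V)} [MemTrivializationAtlas e]
    {σ : Π x, V x} {x : M} (hx : x ∈ e.baseSet) :
    ContMDiffAt 𝓘(ℝ, E) (𝓘(ℝ, E).prod 𝓘(ℝ, F)) k (fun y => TotalSpace.mk' F y (σ y)) x ↔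
      ContMDiffAt 𝓘(ℝ, E) 𝓘(ℝ, F) k (fun y => e.continuousLinearMapAt ℝ y (σ y)) x := by
  refine (e.contMDiffAt_section_iff hx).trans (Filter.EventuallyEq.contMDiffAt_iff ?_)
  filter_upwards [eventually_mem_baseSet e hx] with y hy
  exact (e.continuousLinearMapAt_apply_of_mem ℝ hy _).symm

lemma contMDiffAt_symmL_section {k : WithTop ℕ∞} [ContMDiffVectorBundle k F V 𝓘(ℝ, E)]
    {e : Trivialization F (π F V)} [MemTrivializationAtlas e]
    {x : M} (hx : x ∈ e.baseSet) (p : F) :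
    ContMDiffAt 𝓘(ℝ, E) (𝓘(ℝ, E).prod 𝓘(ℝ, F)) k
      (fun y => TotalSpace.mk' F y (e.symmL ℝ y p)) x := by
  rw [contMDiffAt_section_iff_coord hx]
  refine (contMDiffAt_const (c := p)).congr_of_eventuallyEq ?_
  filter_upwards [eventually_mem_baseSet e hx] with y hy
  exact e.continuousLinearMapAt_symmL hy p

variable (E F V) in
/-- The domain, in the chart at `x`, of the local form of a connection. -/
def localDomain (x : M) : Set E :=
  (extChartAt 𝓘(ℝ, E) x).target ∩
    (extChartAt 𝓘(ℝ, E) x).symm ⁻¹' (trivializationAt F V x).baseSet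

variable (E F V) in
lemma isOpen_localDomain (x : M) : IsOpen (localDomain E F V x) :=
  (continuousOn_extChartAt_symm (I := 𝓘(ℝ, E)) x).isOpen_inter_preimage
    (isOpen_extChartAt_target x)
    (trivializationAt F V x).open_baseSet

variable (E F V) in
lemma extChartAt_mem_localDomain (x : M) : extChartAt 𝓘(ℝ, E) x x ∈ localDomain E F V x := by
  refine ⟨mem_extChartAt_target x, ?_⟩
  simp only [Set.mem_preimage, extChartAt_to_inv]
  exact mem_baseSet_trivializationAt' x

lemma symm_mem_tangent_baseSet {x : M} {u : E} (hu : u ∈ localDomain E F V x) :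
    (extChartAt 𝓘(ℝ, E) x).symm u
      ∈ (trivializationAt E (TangentSpace 𝓘(ℝ, E) : M → Type _) x).baseSet := by
  rw [TangentBundle.trivializationAt_baseSet, ← extChartAt_source 𝓘(ℝ, E)]
  exact (extChartAt 𝓘(ℝ, E) x).map_target hu.1

/-- The connection form in the chart and the trivializations at `x`. -/
def localConnectionForm (cov : CovariantDerivative 𝓘(ℝ, E) F V) (x : M) (u : E) :
    E →L[ℝ] F →L[ℝ] F :=
  connectionForm (trivializationAt F V x) cov
    (trivializationAt E (TangentSpace 𝓘(ℝ, E) : M → Type _) x) ((extChartAt 𝓘(ℝ, E) x).symm u)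

lemma contDiffOn_localConnectionForm {cov : CovariantDerivative 𝓘(ℝ, E) F V}
    (hcov : IsSmoothConnection cov) (x : M) :
    ContDiffOn ℝ ∞ (localConnectionForm cov x) (localDomain E F V x) := by
  refine contDiffOn_clm_apply.2 fun v => contDiffOn_clm_apply.2 fun p => ?_
  set e := trivializationAt F V x
  set e' := trivializationAt E (TangentSpace 𝓘(ℝ, E) : M → Type _) x
  intro u hu
  set y := (extChartAt 𝓘(ℝ, E) x).symm u with hy
  have hye : y ∈ e.baseSet := hu.2
  have hye' : y ∈ e'.baseSet := symm_mem_tangent_baseSet hu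
  have h1 := hcov _ _ y (contMDiffAt_symmL_section hye p) (contMDiffAt_symmL_section hye' v)
  rw [contMDiffAt_section_iff_coord hye] at h1
  have h2 : ContMDiffAt 𝓘(ℝ, E) 𝓘(ℝ, F) ∞ (fun z => connectionForm e cov e' z v p) y := by
    refine h1.congr_of_eventuallyEq ?_
    filter_upwards [eventually_mem_baseSet e hye, eventually_mem_baseSet e' hye'] with z hz hz'
    exact connectionForm_apply hz hz' v p
  have h3 : ContMDiffAt 𝓘(ℝ, E) 𝓘(ℝ, E) ∞ (extChartAt 𝓘(ℝ, E) x).symm u :=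
    (contMDiffOn_extChartAt_symm x).contMDiffAt ((isOpen_extChartAt_target x).mem_nhds hu.1)
  exact (contMDiffAt_iff_contDiffAt.1 (h2.comp u h3)).contDiffWithinAt

/-- Curves given in the chart at `x`, and their velocity. -/
lemma coord_mfderiv_symm_comp {x : M} {c : ℝ → E} {t : ℝ} {c' : E} (hc : HasDerivAt c c' t)
    (ht : c t ∈ (extChartAt 𝓘(ℝ, E) x).target) :
    (trivializationAt E (TangentSpace 𝓘(ℝ, E) : M → Type _) x).continuousLinearMapAt ℝ
      ((extChartAt 𝓘(ℝ, E) x).symm (c t))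
      (mfderiv 𝓘(ℝ, ℝ) 𝓘(ℝ, E) (fun s => (extChartAt 𝓘(ℝ, E) x).symm (c s)) t (1 : ℝ)) = c' := by
  have hs : (extChartAt 𝓘(ℝ, E) x).symm (c t) ∈ (chartAt E x).source := by
    rw [← extChartAt_source 𝓘(ℝ, E)]
    exact (extChartAt 𝓘(ℝ, E) x).map_target ht
  have hsymm : MDifferentiableAt 𝓘(ℝ, E) 𝓘(ℝ, E) (extChartAt 𝓘(ℝ, E) x).symm (c t) :=
    ((contMDiffOn_extChartAt_symm (n := ∞) x).contMDiffAt
      ((isOpen_extChartAt_target x).mem_nhds ht)).mdifferentiableAt (by simp)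
  have hγ : MDifferentiableAt 𝓘(ℝ, ℝ) 𝓘(ℝ, E) (fun s => (extChartAt 𝓘(ℝ, E) x).symm (c s)) t :=
    hsymm.comp t hc.differentiableAt.mdifferentiableAt
  have h1 := mfderiv_comp_apply t (mdifferentiableAt_extChartAt (I := 𝓘(ℝ, E)) hs) hγ (1 : ℝ)
  rw [TangentBundle.continuousLinearMapAt_trivializationAt hs]
  refine h1.symm.trans ?_
  have h2 : (extChartAt 𝓘(ℝ, E) x) ∘ (fun s => (extChartAt 𝓘(ℝ, E) x).symm (c s)) =ᶠ[𝓝 t] c := by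
    filter_upwards [hc.continuousAt.eventually ((isOpen_extChartAt_target x).mem_nhds ht)] with s hs
    exact (extChartAt 𝓘(ℝ, E) x).right_inv hs
  rw [h2.mfderiv_eq, mfderiv_eq_fderiv]
  exact hc.deriv

/-- Short segments in the chart at `x` have parallel transports, given by the fundamental
solutions of the parallelism equation. -/
lemma exists_local_parallelTransport {cov : CovariantDerivative 𝓘(ℝ, E) F V}
    (hcov : IsSmoothConnection cov) (x : M) {u : E} (hu : u ∈ localDomain E F V x) :
    ∃ P : E → F →L[ℝ] F, P 0 = 1 ∧ HasFDerivAt P (-localConnectionForm cov x u) 0 ∧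
      ∀ᶠ v in 𝓝 (0 : E), u + v ∈ localDomain E F V x ∧
        ∃ B : V ((extChartAt 𝓘(ℝ, E) x).symm u) ≃ₗ[ℝ] V ((extChartAt 𝓘(ℝ, E) x).symm (u + v)),
          IsParallelTransport cov _ _ B ∧
          ∀ w, (trivializationAt F V x).continuousLinearMapAt ℝ _ (B w) =
            P v ((trivializationAt F V x).continuousLinearMapAt ℝ _ w) := by
  have : CompleteSpace F := FiniteDimensional.complete ℝ F
  set e := trivializationAt F V x with he
  set e' := trivializationAt E (TangentSpace 𝓘(ℝ, E) : M → Type _) x with he'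
  set ψ := (extChartAt 𝓘(ℝ, E) x).symm with hψ
  obtain ⟨δ, hδ, U, hU, hU0, hUd⟩ := exists_segment_transport
    (R := F →L[ℝ] F) ContinuousLinearMap.norm_id_le
    (isOpen_localDomain E F V x) (contDiffOn_localConnectionForm hcov x).continuousOn hu
  refine ⟨fun v => U v 1, hU0, hUd, ?_⟩
  have hunit : ∀ᶠ v in 𝓝 (0 : E), IsUnit (U v 1) := by
    have : IsUnit (U 0 1) := by rw [hU0]; exact isUnit_one
    exact hUd.continuousAt.eventually (Units.isOpen.mem_nhds this)
  filter_upwards [hunit, Metric.ball_mem_nhds (0 : E) hδ] with v hv hvδ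
  rw [mem_ball_zero_iff] at hvδ
  obtain ⟨hmem, hv0, hvd⟩ := hU v hvδ
  have hρ : ∀ s, Real.smoothTransition s ∈ Set.Ioo (-1 : ℝ) 2 := fun s =>
    ⟨by linarith [Real.smoothTransition.nonneg s], by linarith [Real.smoothTransition.le_one s]⟩
  set c : ℝ → E := fun s => u + Real.smoothTransition s • v with hc
  have hcmem : ∀ s, c s ∈ localDomain E F V x := fun s => hmem _ (hρ s)
  have hc1 : c 1 = u + v := by simp [hc]
  have hc0 : c 0 = u := by simp [hc]
  have huv : u + v ∈ localDomain E F V x := hc1 ▸ hcmem 1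
  refine ⟨huv, ?_⟩
  obtain ⟨P, hP⟩ := hv
  let Pe : F ≃ₗ[ℝ] F := (ContinuousLinearEquiv.ofUnit P).toLinearEquiv
  have hPe : ∀ q, Pe q = U v 1 q := fun q => by rw [← hP]; rfl
  let B : V (ψ u) ≃ₗ[ℝ] V (ψ (u + v)) := (e.continuousLinearEquivAt ℝ _ hu.2).toLinearEquiv.trans
    (Pe.trans (e.continuousLinearEquivAt ℝ _ huv.2).symm.toLinearEquiv)
  have hBw : ∀ w, B w = e.symmL ℝ _ (U v 1 (e.continuousLinearMapAt ℝ _ w)) := by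
    intro w
    rw [← hPe, ← e.coe_continuousLinearEquivAt_eq (R := ℝ) hu.2,
      ← e.symm_continuousLinearEquivAt_eq (R := ℝ) huv.2]
    rfl
  refine ⟨B, ?_, fun w => by rw [hBw, e.continuousLinearMapAt_symmL huv.2]⟩
  have hcsmooth : ContDiff ℝ ∞ c := by
    have : ContDiff ℝ ∞ Real.smoothTransition := Real.smoothTransition.contDiff
    fun_prop
  have hγsmooth : ContMDiff 𝓘(ℝ, ℝ) 𝓘(ℝ, E) ∞ (fun s => ψ (c s)) := fun s =>
    ((contMDiffOn_extChartAt_symm x).contMDiffAt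
      ((isOpen_extChartAt_target x).mem_nhds (hcmem s).1)).comp s hcsmooth.contMDiff.contMDiffAt
  refine exists_isParallelTransport_of_curve hγsmooth (by rw [hc0]) (by rw [hc1]) B fun w => ?_
  set q := e.continuousLinearMapAt ℝ (ψ u) w with hq
  have hρd : ∀ s, HasDerivAt Real.smoothTransition (deriv Real.smoothTransition s) s := fun s =>
    ((Real.smoothTransition.contDiff (n := 1)).differentiable one_ne_zero s).hasDerivAt
  have hcd : ∀ s, HasDerivAt c (deriv Real.smoothTransition s • v) s := fun s =>
    ((hρd s).smul_const v).const_add u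
  have hwd : ∀ s, HasDerivAt (fun s => U v (Real.smoothTransition s) q)
      (-(localConnectionForm cov x (c s) (deriv Real.smoothTransition s • v)
        (U v (Real.smoothTransition s) q))) s := by
    intro s
    have h1 := (hvd _ (hρ s)).scomp s (hρd s)
    have h2 := h1.clm_apply (hasDerivAt_const s q)
    simpa [hc] using h2
  refine ⟨fun s => e.symmL ℝ (ψ (c s)) (U v (Real.smoothTransition s) q), ?_, ?_, ?_⟩
  · have hcoord : (fun s => e.continuousLinearMapAt ℝ (ψ (c s))
        (e.symmL ℝ (ψ (c s)) (U v (Real.smoothTransition s) q)))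
        = fun s => U v (Real.smoothTransition s) q :=
      funext fun s => e.continuousLinearMapAt_symmL (hcmem s).2 _
    have hmd : MDifferentiable 𝓘(ℝ, ℝ) (𝓘(ℝ, E).prod 𝓘(ℝ, F)) (fun s => TotalSpace.mk' F (ψ (c s))
        (e.symmL ℝ (ψ (c s)) (U v (Real.smoothTransition s) q))) := by
      intro s
      rw [mdifferentiableAt_along_iff (e := e) (hcmem s).2
        ((hγsmooth s).mdifferentiableAt (by simp)), hcoord]
      exact (hwd s).differentiableAt
    refine ⟨hmd, fun s => ?_⟩
    apply (e.continuousLinearEquivAt ℝ (ψ (c s)) (hcmem s).2).injective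
    have h1 := coord_covDerivAlong (cov := cov) (e := e) (e' := e') (hcmem s).2
      (symm_mem_tangent_baseSet (hcmem s)) (hmd s) ((hγsmooth s).mdifferentiableAt (by simp))
    rw [hcoord, (hwd s).deriv, coord_mfderiv_symm_comp (hcd s) (hcmem s).1,
      e.continuousLinearMapAt_symmL (hcmem s).2] at h1
    rw [map_zero]
    have h2 : ∀ q, e.continuousLinearEquivAt ℝ (ψ (c s)) (hcmem s).2 q
      = e.continuousLinearMapAt ℝ (ψ (c s)) q := fun q => by
        rw [← e.coe_continuousLinearEquivAt_eq (R := ℝ) (hcmem s).2]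
    rw [h2, h1]
    simp [localConnectionForm, he, he', hψ]
  · have : e.symmL ℝ (ψ u) (U v 0 q) = w := by
      rw [hv0, hq]
      exact e.symmL_continuousLinearMapAt hu.2 w
    simp only [Real.smoothTransition.zero]
    rw [← this, hc0]
  · simp only [Real.smoothTransition.one]
    rw [hBw, hc1]

end ParallelTransport

section Reversal

variable {E : Type*} [NormedAddCommGroup E] [NormedSpace ℝ E]
  {H : Type*} [TopologicalSpace H] {I : ModelWithCorners ℝ E H}
  {M : Type*} [TopologicalSpace M] [ChartedSpace H M]
  {F : Type*} [NormedAddCommGroup F] [NormedSpace ℝ F]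
  {V : M → Type*} [TopologicalSpace (TotalSpace F V)]
  [∀ x, AddCommGroup (V x)] [∀ x, Module ℝ (V x)] [∀ x, TopologicalSpace (V x)]
  [∀ x, IsTopologicalAddGroup (V x)] [∀ x, ContinuousSMul ℝ (V x)] [FiberBundle F V]
  [VectorBundle ℝ F V] {cov : CovariantDerivative I F V}

lemma contMDiff_one_sub : ContMDiff 𝓘(ℝ, ℝ) 𝓘(ℝ, ℝ) ∞ (fun t : ℝ => 1 - t) := by
  rw [contMDiff_iff_contDiff]
  fun_prop

/-- The reversed section along the reversed curve is parallel. -/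
lemma IsParallelAlong.reverse {γ : ℝ → M} (hγ : ContMDiff 𝓘(ℝ, ℝ) I ∞ γ) {W : ∀ t, V (γ t)}
    (hW : IsParallelAlong cov γ W) :
    IsParallelAlong cov (fun t => γ (1 - t)) (fun t => W (1 - t)) := by
  refine ⟨fun t => (hW.1 (1 - t)).comp t ((contMDiff_one_sub t).mdifferentiableAt (by simp)),
    fun t => ?_⟩
  have h1 := hW.2 (1 - t)
  have hd := deriv_comp_const_sub
    (f := fun s => (trivializationAt F V (γ (1 - t)) ⟨γ s, W s⟩).2) (1 : ℝ) t
  have hm : mfderiv 𝓘(ℝ, ℝ) I (fun s => γ (1 - s)) t (1 : ℝ)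
      = -mfderiv 𝓘(ℝ, ℝ) I γ (1 - t) (1 : ℝ) := by
    have h2 := mfderiv_comp_apply t ((hγ (1 - t)).mdifferentiableAt (by simp))
      ((contMDiff_one_sub t).mdifferentiableAt (by simp)) (1 : ℝ)
    have h3 : mfderiv 𝓘(ℝ, ℝ) 𝓘(ℝ, ℝ) (fun t : ℝ => 1 - t) t (1 : ℝ) = (-1 : ℝ) := by
      rw [mfderiv_eq_fderiv]
      have : HasDerivAt (fun t : ℝ => 1 - t) (-1) t := by
        simpa using (hasDerivAt_id t).const_sub 1
      exact this.deriv
    refine h2.trans ?_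
    rw [h3]
    exact map_neg (mfderiv 𝓘(ℝ, ℝ) I γ (1 - t)) (1 : ℝ)
  have hmem := mem_baseSet_trivializationAt F V (γ (1 - t))
  rw [covDerivAlong, ← Trivialization.symmL_apply (R := ℝ) _ hmem] at h1 ⊢
  rw [hm, hd, map_neg, map_neg, ← neg_add, h1, neg_zero]

lemma IsParallelTransport.symm {x y : M} {B : V x ≃ₗ[ℝ] V y} (hB : IsParallelTransport cov x y B) :
    IsParallelTransport cov y x B.symm := by
  induction hB with
  | refl x => exact IsParallelTransport.refl x
  | smooth γ hγ B hB =>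
    refine exists_isParallelTransport_of_curve (hγ.comp contMDiff_one_sub) (by simp) (by simp)
      B.symm fun v => ?_
    obtain ⟨W, hW, h0, h1⟩ := hB (B.symm v)
    have hcongr : ∀ {s t : ℝ}, s = t → HEq (W s) (W t) := by rintro _ _ rfl; rfl
    refine ⟨fun t => W (1 - t), hW.reverse hγ, ?_, ?_⟩
    · exact (hcongr (sub_zero 1)).trans (heq_of_eq (h1.trans (B.apply_symm_apply v)))
    · exact (hcongr (sub_self 1)).trans (heq_of_eq h0)
  | trans _ _ h1 h2 => exact IsParallelTransport.trans h2 h1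

end Reversal

noncomputable section ParallelEndomorphisms

variable {E : Type*} [NormedAddCommGroup E] [NormedSpace ℝ E] [FiniteDimensional ℝ E]
  {M : Type*} [TopologicalSpace M] [ChartedSpace E M] [IsManifold 𝓘(ℝ, E) ∞ M]
  {F : Type*} [NormedAddCommGroup F] [NormedSpace ℝ F] [FiniteDimensional ℝ F]
  {V : M → Type*} [TopologicalSpace (TotalSpace F V)]
  [∀ x, AddCommGroup (V x)] [∀ x, Module ℝ (V x)] [∀ x, TopologicalSpace (V x)]
  [∀ x, IsTopologicalAddGroup (V x)] [∀ x, ContinuousSMul ℝ (V x)] [FiberBundle F V]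
  [VectorBundle ℝ F V] [ContMDiffVectorBundle ∞ F V 𝓘(ℝ, E)]
  {cov : CovariantDerivative 𝓘(ℝ, E) F V}

/-- On a connected manifold any two points are joined by a parallel transport. -/
lemma exists_isParallelTransport [ConnectedSpace M] (hcov : IsSmoothConnection cov) (x y : M) :
    ∃ B : V x ≃ₗ[ℝ] V y, IsParallelTransport cov x y B := by
  refine PreconnectedSpace.induction₂' (fun x y : M => ∃ B : V x ≃ₗ[ℝ] V y,
    IsParallelTransport cov x y B) (fun x => ?_)
    ⟨fun a b c ⟨B, hB⟩ ⟨C, hC⟩ => ⟨B.trans C, hB.trans hC⟩⟩ x y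
  obtain ⟨P, -, -, hP⟩ := exists_local_parallelTransport hcov x (extChartAt_mem_localDomain E F V x)
  have htend : Filter.Tendsto (fun y => extChartAt 𝓘(ℝ, E) x y - extChartAt 𝓘(ℝ, E) x x)
      (𝓝 x) (𝓝 0) := by
    have h : ContinuousAt (fun y => extChartAt 𝓘(ℝ, E) x y - extChartAt 𝓘(ℝ, E) x x) x :=
      (continuousAt_extChartAt (I := 𝓘(ℝ, E)) x).sub continuousAt_const
    simpa only [sub_self] using h.tendsto
  have hcongr : ∀ {a b a' b' : M}, a = a' → b = b' →
      (∃ B : V a ≃ₗ[ℝ] V b, IsParallelTransport cov a b B) →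
      ∃ B : V a' ≃ₗ[ℝ] V b', IsParallelTransport cov a' b' B := by
    rintro _ _ _ _ rfl rfl h
    exact h
  filter_upwards [htend.eventually hP, extChartAt_source_mem_nhds (I := 𝓘(ℝ, E)) x] with y hy hys
  obtain ⟨-, B, hB, -⟩ := hy
  obtain ⟨C, hC⟩ := hcongr (extChartAt_to_inv x)
    (by rw [add_sub_cancel, (extChartAt 𝓘(ℝ, E) x).left_inv hys]) ⟨B, hB⟩
  exact ⟨⟨C, hC⟩, ⟨C.symm, hC.symm⟩⟩

/-- A field of endomorphisms in the chart and the trivialization at `x`. -/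
def localEndomorphism (A : ∀ x, V x →L[ℝ] V x) (x : M) (u : E) : F →L[ℝ] F :=
  (trivializationAt F V x).continuousLinearMapAt ℝ ((extChartAt 𝓘(ℝ, E) x).symm u) ∘L
    A ((extChartAt 𝓘(ℝ, E) x).symm u) ∘L
    (trivializationAt F V x).symmL ℝ ((extChartAt 𝓘(ℝ, E) x).symm u)

lemma localEndomorphism_apply_coord (A : ∀ x, V x →L[ℝ] V x) {x : M} {u : E}
    (hu : u ∈ localDomain E F V x) {z : M} (hz : (extChartAt 𝓘(ℝ, E) x).symm u = z) (w : V z) :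
    localEndomorphism A x u ((trivializationAt F V x).continuousLinearMapAt ℝ z w) =
      (trivializationAt F V x).continuousLinearMapAt ℝ z (A z w) := by
  subst hz
  simp only [localEndomorphism, ContinuousLinearMap.comp_apply]
  rw [(trivializationAt F V x).symmL_continuousLinearMapAt hu.2]

/-- A field of endomorphisms that commutes with all parallel transports satisfies the parallelism
equation. -/
lemma hasFDerivAt_localEndomorphism (hcov : IsSmoothConnection cov) {A : ∀ x, V x →L[ℝ] V x}
    (hA : ∀ x y (B : V x ≃ₗ[ℝ] V y), IsParallelTransport cov x y B → ∀ w, A y (B w) = B (A x w))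
    (x : M) {u : E} (hu : u ∈ localDomain E F V x) :
    HasFDerivAt (localEndomorphism A x)
      (((ContinuousLinearMap.mul ℝ (F →L[ℝ] F)).flip (localEndomorphism A x u)
        - ContinuousLinearMap.mul ℝ (F →L[ℝ] F) (localEndomorphism A x u)) ∘L
        (-localConnectionForm cov x u)) u := by
  have : CompleteSpace F := FiniteDimensional.complete ℝ F
  obtain ⟨P, hP0, hPd, hP⟩ := exists_local_parallelTransport hcov x hu
  refine hasFDerivAt_of_conj hPd hP0 ?_
  filter_upwards [hP] with v hv
  obtain ⟨hv, B, hB, hBw⟩ := hv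
  ext q
  have hq : (trivializationAt F V x).continuousLinearMapAt ℝ _
    ((trivializationAt F V x).symmL ℝ ((extChartAt 𝓘(ℝ, E) x).symm u) q) = q :=
    (trivializationAt F V x).continuousLinearMapAt_symmL hu.2 q
  change localEndomorphism A x (u + v) (P v q) = P v (localEndomorphism A x u q)
  rw [← hq, ← hBw, localEndomorphism_apply_coord A hv rfl, localEndomorphism_apply_coord A hu rfl, ← hBw,
    hA _ _ B hB]

/-- A field of endomorphisms that commutes with all parallel transports is smooth. -/
lemma contMDiff_of_commute_parallelTransport (hcov : IsSmoothConnection cov)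
    {A : ∀ x, V x →L[ℝ] V x}
    (hA : ∀ x y (B : V x ≃ₗ[ℝ] V y), IsParallelTransport cov x y B → ∀ w, A y (B w) = B (A x w)) :
    ContMDiff 𝓘(ℝ, E) (𝓘(ℝ, E).prod 𝓘(ℝ, F →L[ℝ] F)) ∞
      (fun x => TotalSpace.mk' (F →L[ℝ] F) (E := fun x => V x →L[ℝ] V x) x (A x)) := by
  intro x
  rw [contMDiffAt_hom_bundle]
  refine ⟨contMDiffAt_id, ?_⟩
  have h1 : ContDiffOn ℝ ∞ (localEndomorphism A x) (localDomain E F V x) :=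
    contDiffOn_of_hasFDerivAt_bracket (isOpen_localDomain E F V x)
      (contDiffOn_localConnectionForm hcov x).neg
      fun u hu => hasFDerivAt_localEndomorphism hcov hA x hu
  have h2 : ContDiffAt ℝ ∞ (localEndomorphism A x) (extChartAt 𝓘(ℝ, E) x x) :=
    h1.contDiffAt ((isOpen_localDomain E F V x).mem_nhds (extChartAt_mem_localDomain E F V x))
  have h3 := h2.contMDiffAt.comp x (contMDiffAt_extChartAt (I := 𝓘(ℝ, E)) (n := ∞))
  refine h3.congr_of_eventuallyEq ?_
  filter_upwards [extChartAt_source_mem_nhds (I := 𝓘(ℝ, E)) x] with y hy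
  have key : ∀ z, z = y → ContinuousLinearMap.inCoordinates F V F V x y x y (A y) =
      (trivializationAt F V x).continuousLinearMapAt ℝ z ∘L A z ∘L
        (trivializationAt F V x).symmL ℝ z := by
    rintro _ rfl
    rfl
  exact key _ ((extChartAt 𝓘(ℝ, E) x).left_inv hy)

/-- The derivative of a function on a manifold, in the chart at `x`. -/
lemma mvfderiv_eq_fderiv_symm {f : M → F} {x y : M} (hy : y ∈ (chartAt E x).source)
    (hf : DifferentiableAt ℝ (fun u => f ((extChartAt 𝓘(ℝ, E) x).symm u)) (extChartAt 𝓘(ℝ, E) x y))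
    (v : TangentSpace 𝓘(ℝ, E) y) :
    mvfderiv 𝓘(ℝ, E) f y v =
      fderiv ℝ (fun u => f ((extChartAt 𝓘(ℝ, E) x).symm u)) (extChartAt 𝓘(ℝ, E) x y)
        ((trivializationAt E (TangentSpace 𝓘(ℝ, E) : M → Type _) x).continuousLinearMapAt ℝ y v)
      := by
  have hy' : y ∈ (extChartAt 𝓘(ℝ, E) x).source := by rwa [extChartAt_source]
  have h1 : f =ᶠ[𝓝 y] (fun u => f ((extChartAt 𝓘(ℝ, E) x).symm u)) ∘ extChartAt 𝓘(ℝ, E) x := by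
    filter_upwards [(isOpen_extChartAt_source x).mem_nhds hy'] with z hz
    simp only [Function.comp_apply, (extChartAt 𝓘(ℝ, E) x).left_inv hz]
  rw [mvfderiv_congr_of_eventuallyEq h1, TangentBundle.continuousLinearMapAt_trivializationAt hy]
  have h2 := mfderiv_comp_apply y hf.mdifferentiableAt
    (mdifferentiableAt_extChartAt (I := 𝓘(ℝ, E)) hy) v
  rw [mfderiv_eq_fderiv] at h2
  exact h2

/-- A field of endomorphisms that commutes with all parallel transports is parallel. -/
lemma cov_apply_of_commute_parallelTransport (hcov : IsSmoothConnection cov)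
    {A : ∀ x, V x →L[ℝ] V x}
    (hA : ∀ x y (B : V x ≃ₗ[ℝ] V y), IsParallelTransport cov x y B → ∀ w, A y (B w) = B (A x w))
    {σ : Π x, V x} {x : M} (hσ : MDiffAt (T% σ) x) (v : TangentSpace 𝓘(ℝ, E) x) :
    cov (fun y => A y (σ y)) x v = A x (cov σ x v) := by
  set e := trivializationAt F V x with he
  set e' := trivializationAt E (TangentSpace 𝓘(ℝ, E) : M → Type _) x with he'
  have hx : x ∈ e.baseSet := mem_baseSet_trivializationAt' x
  have hx' : x ∈ e'.baseSet := mem_baseSet_trivializationAt' x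
  have hu := extChartAt_mem_localDomain E F V x
  have hxs : x ∈ (chartAt E x).source := mem_chart_source E x
  have hφx : (extChartAt 𝓘(ℝ, E) x).symm (extChartAt 𝓘(ℝ, E) x x) = x := extChartAt_to_inv x
  have hsymm : MDifferentiableAt 𝓘(ℝ, E) 𝓘(ℝ, E) (extChartAt 𝓘(ℝ, E) x).symm (extChartAt 𝓘(ℝ, E) x x) :=
    ((contMDiffOn_extChartAt_symm (n := ∞) x).contMDiffAt
      ((isOpen_extChartAt_target x).mem_nhds hu.1)).mdifferentiableAt (by simp)
  have hσ' := (mdifferentiableAt_section_iff_coord hx).1 hσ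
  have hs : DifferentiableAt ℝ (fun u => e.continuousLinearMapAt ℝ ((extChartAt 𝓘(ℝ, E) x).symm u) (σ ((extChartAt 𝓘(ℝ, E) x).symm u)))
      (extChartAt 𝓘(ℝ, E) x x) := by
    have h1 : MDifferentiableAt 𝓘(ℝ, E) 𝓘(ℝ, F) (fun y => e.continuousLinearMapAt ℝ y (σ y))
      ((extChartAt 𝓘(ℝ, E) x).symm (extChartAt 𝓘(ℝ, E) x x)) := by rwa [hφx]
    exact (h1.comp (extChartAt 𝓘(ℝ, E) x x) hsymm).differentiableAt
  have hAd := hasFDerivAt_localEndomorphism hcov hA x hu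
  have hprod := hAd.clm_apply hs.hasFDerivAt
  have hev : (fun u => e.continuousLinearMapAt ℝ ((extChartAt 𝓘(ℝ, E) x).symm u) (A ((extChartAt 𝓘(ℝ, E) x).symm u) (σ ((extChartAt 𝓘(ℝ, E) x).symm u))))
      =ᶠ[𝓝 (extChartAt 𝓘(ℝ, E) x x)] fun u => localEndomorphism A x u
        (e.continuousLinearMapAt ℝ ((extChartAt 𝓘(ℝ, E) x).symm u) (σ ((extChartAt 𝓘(ℝ, E) x).symm u))) := by
    filter_upwards [(isOpen_localDomain E F V x).mem_nhds hu] with u hu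
    exact (localEndomorphism_apply_coord A hu rfl _).symm
  have hprod' := hprod.congr_of_eventuallyEq hev
  have hAσ : MDiffAt (T% (fun y => A y (σ y))) x := by
    have h := MDifferentiableAt.clm_bundle_apply (F₁ := F) (F₂ := F)
      (E₁ := V) (E₂ := V) (b := id)
      ((contMDiff_of_commute_parallelTransport hcov hA x).mdifferentiableAt (by simp)) hσ
    exact h
  have hleft := coord_cov (cov := cov) (e := e) (e' := e') hx hx' hAσ v
  have hright := coord_cov (cov := cov) (e := e) (e' := e') hx hx' hσ v
  rw [mvfderiv_eq_fderiv_symm hxs hprod'.differentiableAt, hprod'.fderiv] at hleft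
  rw [mvfderiv_eq_fderiv_symm hxs hs] at hright
  have hAx : ∀ w, localEndomorphism A x (extChartAt 𝓘(ℝ, E) x x) (e.continuousLinearMapAt ℝ x w) =
      e.continuousLinearMapAt ℝ x (A x w) := by
    exact localEndomorphism_apply_coord A hu hφx
  apply (e.continuousLinearEquivAt ℝ x hx).injective
  have hcoe : ∀ q, e.continuousLinearEquivAt ℝ x hx q = e.continuousLinearMapAt ℝ x q :=
    fun q => by rw [← e.coe_continuousLinearEquivAt_eq (R := ℝ) hx]
  rw [hcoe, hcoe, hleft, ← hAx (cov σ x v), hright, map_add, ← hAx (σ x)]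
  have hΓ : localConnectionForm cov x (extChartAt 𝓘(ℝ, E) x x) = connectionForm e cov e' x := by
    rw [localConnectionForm, hφx]
  have hσx : ∀ z, z = x → e.continuousLinearMapAt ℝ z (σ z) = e.continuousLinearMapAt ℝ x (σ x) := by
    rintro _ rfl
    rfl
  rw [hΓ, hσx _ hφx]
  simp only [add_apply, ContinuousLinearMap.comp_apply, neg_apply, sub_apply,
    ContinuousLinearMap.flip_apply, ContinuousLinearMap.mul_apply', map_neg]
  have key : ∀ (G L : F →L[ℝ] F) (s q : F),
      L s + -(G (L q) - L (G q)) + G (L q) = L s + L (G q) := fun G L s q => by abel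
  let t : E := (trivializationAt E (TangentSpace 𝓘(ℝ, E) : M → Type _) x).continuousLinearMapAt ℝ x v
  exact key (connectionForm e cov e' x t) (localEndomorphism A x (extChartAt 𝓘(ℝ, E) x x)) _ _

end ParallelEndomorphisms

noncomputable section SmoothLeviCivita

variable {E : Type*} [NormedAddCommGroup E] [NormedSpace ℝ E] [FiniteDimensional ℝ E]
  {M : Type*} [TopologicalSpace M] [ChartedSpace E M] [IsManifold 𝓘(ℝ, E) ∞ M]

/-- A smooth function may be differentiated along a smooth vector field. -/
lemma contMDiffAt_mvfderiv_apply {F : Type*} [NormedAddCommGroup F] [NormedSpace ℝ F]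
    [FiniteDimensional ℝ F]
    {f : M → F} {X : Π x : M, TangentSpace 𝓘(ℝ, E) x} {x : M}
    (hf : ContMDiffAt 𝓘(ℝ, E) 𝓘(ℝ, F) ∞ f x)
    (hX : ContMDiffAt 𝓘(ℝ, E) (𝓘(ℝ, E).prod 𝓘(ℝ, E)) ∞ (fun y => TotalSpace.mk' E y (X y)) x) :
    ContMDiffAt 𝓘(ℝ, E) 𝓘(ℝ, F) ∞ (fun y => mvfderiv 𝓘(ℝ, E) f y (X y)) x := by
  have hx' : x ∈ (trivializationAt E (TangentSpace 𝓘(ℝ, E) : M → Type _) x).baseSet :=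
    mem_baseSet_trivializationAt' x
  have hX' := (contMDiffAt_section_iff_coord hx').1 hX
  have hφx : (extChartAt 𝓘(ℝ, E) x).symm (extChartAt 𝓘(ℝ, E) x x) = x := extChartAt_to_inv x
  have hsymm : ContMDiffAt 𝓘(ℝ, E) 𝓘(ℝ, E) ∞ (extChartAt 𝓘(ℝ, E) x).symm (extChartAt 𝓘(ℝ, E) x x) :=
    (contMDiffOn_extChartAt_symm x).contMDiffAt
      ((isOpen_extChartAt_target x).mem_nhds (mem_extChartAt_target x))
  have hfc : ContDiffAt ℝ ∞ (fun u => f ((extChartAt 𝓘(ℝ, E) x).symm u))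
      (extChartAt 𝓘(ℝ, E) x x) := by
    have h1 : ContMDiffAt 𝓘(ℝ, E) 𝓘(ℝ, F) ∞ f
      ((extChartAt 𝓘(ℝ, E) x).symm (extChartAt 𝓘(ℝ, E) x x)) := by rwa [hφx]
    exact contMDiffAt_iff_contDiffAt.1 (h1.comp (extChartAt 𝓘(ℝ, E) x x) hsymm)
  have hext : ContMDiffAt 𝓘(ℝ, E) 𝓘(ℝ, E) ∞ (extChartAt 𝓘(ℝ, E) x) x := contMDiffAt_extChartAt
  have hd := (hfc.fderiv_right (m := ∞) (by simp)).contMDiffAt.comp x hext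
  have hdiff : ∀ᶠ u in 𝓝 (extChartAt 𝓘(ℝ, E) x x),
      DifferentiableAt ℝ (fun u => f ((extChartAt 𝓘(ℝ, E) x).symm u)) u := by
    filter_upwards [(hfc.of_le (m := 1) (by simp)).eventually (by simp)] with u hu
    exact hu.differentiableAt (by simp)
  refine (hd.clm_apply hX').congr_of_eventuallyEq ?_
  filter_upwards [(chartAt E x).open_source.mem_nhds (mem_chart_source E x),
    (continuousAt_extChartAt x).eventually hdiff] with y hy hy'
  exact mvfderiv_eq_fderiv_symm hy hy' _

variable [RiemannianBundle (fun x : M => TangentSpace 𝓘(ℝ, E) x)]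
  [IsContMDiffRiemannianBundle 𝓘(ℝ, E) ∞ E (fun x : M => TangentSpace 𝓘(ℝ, E) x)]

lemma contMDiffAt_inner_tangent {X Y : Π x : M, TangentSpace 𝓘(ℝ, E) x} {x : M}
    (hX : ContMDiffAt 𝓘(ℝ, E) (𝓘(ℝ, E).prod 𝓘(ℝ, E)) ∞ (fun y => TotalSpace.mk' E y (X y)) x)
    (hY : ContMDiffAt 𝓘(ℝ, E) (𝓘(ℝ, E).prod 𝓘(ℝ, E)) ∞ (fun y => TotalSpace.mk' E y (Y y)) x) :
    ContMDiffAt 𝓘(ℝ, E) 𝓘(ℝ, ℝ) ∞ (fun y => (inner ℝ (X y) (Y y) : ℝ)) x :=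
  ContMDiffAt.inner_bundle (IB := 𝓘(ℝ, E)) (F := E) (E := fun x : M => TangentSpace 𝓘(ℝ, E) x) hX hY

lemma contMDiffAt_koszul {X Y Z : Π x : M, TangentSpace 𝓘(ℝ, E) x} {x : M}
    (hX : ContMDiffAt 𝓘(ℝ, E) (𝓘(ℝ, E).prod 𝓘(ℝ, E)) ∞ (fun y => TotalSpace.mk' E y (X y)) x)
    (hY : ContMDiffAt 𝓘(ℝ, E) (𝓘(ℝ, E).prod 𝓘(ℝ, E)) ∞ (fun y => TotalSpace.mk' E y (Y y)) x)
    (hZ : ContMDiffAt 𝓘(ℝ, E) (𝓘(ℝ, E).prod 𝓘(ℝ, E)) ∞ (fun y => TotalSpace.mk' E y (Z y)) x) :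
    ContMDiffAt 𝓘(ℝ, E) 𝓘(ℝ, ℝ) ∞ (koszul 𝓘(ℝ, E) X Y Z) x := by
  have hb {U V : Π x : M, TangentSpace 𝓘(ℝ, E) x}
      (hU : ContMDiffAt 𝓘(ℝ, E) (𝓘(ℝ, E).prod 𝓘(ℝ, E)) ∞ (fun y => TotalSpace.mk' E y (U y)) x)
      (hV : ContMDiffAt 𝓘(ℝ, E) (𝓘(ℝ, E).prod 𝓘(ℝ, E)) ∞ (fun y => TotalSpace.mk' E y (V y)) x) :
      ContMDiffAt 𝓘(ℝ, E) (𝓘(ℝ, E).prod 𝓘(ℝ, E)) ∞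
        (fun y => TotalSpace.mk' E y (mlieBracket 𝓘(ℝ, E) U V y)) x := by
    have : IsManifold 𝓘(ℝ, E) (minSmoothness ℝ 2) M := by
      rw [minSmoothness_of_isRCLikeNormedField]
      infer_instance
    have : IsManifold 𝓘(ℝ, E) (((⊤ : ℕ∞) : WithTop ℕ∞) + 1) M := .of_le (n := ∞) (by simp)
    exact ContMDiffAt.mlieBracket_vectorField (m := ⊤) (n := ⊤) hU hV (by simp)
  have h1 := contMDiffAt_mvfderiv_apply (contMDiffAt_inner_tangent hY hZ) hX
  have h2 := contMDiffAt_mvfderiv_apply (contMDiffAt_inner_tangent hX hZ) hY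
  have h3 := contMDiffAt_mvfderiv_apply (contMDiffAt_inner_tangent hX hY) hZ
  have h4 := contMDiffAt_inner_tangent (hb hX hY) hZ
  have h5 := contMDiffAt_inner_tangent (hb hX hZ) hY
  have h6 := contMDiffAt_inner_tangent (hb hY hZ) hX
  exact (contMDiffAt_const (c := (1 / 2 : ℝ))).mul
    (((((h1.add h2).sub h3).add h4).sub h5).sub h6)

/-- A vector field is smooth if its products with all smooth fields are smooth. -/
lemma contMDiffAt_of_inner {W : Π x : M, TangentSpace 𝓘(ℝ, E) x} {x : M}
    (h : ∀ Z : Π x : M, TangentSpace 𝓘(ℝ, E) x,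
      ContMDiffAt 𝓘(ℝ, E) (𝓘(ℝ, E).prod 𝓘(ℝ, E)) ∞ (fun y => TotalSpace.mk' E y (Z y)) x →
      ContMDiffAt 𝓘(ℝ, E) 𝓘(ℝ, ℝ) ∞ (fun y => (inner ℝ (W y) (Z y) : ℝ)) x) :
    ContMDiffAt 𝓘(ℝ, E) (𝓘(ℝ, E).prod 𝓘(ℝ, E)) ∞ (fun y => TotalSpace.mk' E y (W y)) x := by
  let e' := trivializationAt E (TangentSpace 𝓘(ℝ, E) : M → Type _) x
  have hx' : x ∈ e'.baseSet := mem_baseSet_trivializationAt' x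
  let b := Module.finBasis ℝ E
  let s (i) (y : M) : TangentSpace 𝓘(ℝ, E) y := e'.symmL ℝ y (b i)
  have hs (i) : ContMDiffAt 𝓘(ℝ, E) (𝓘(ℝ, E).prod 𝓘(ℝ, E)) ∞
      (fun y => TotalSpace.mk' E y (s i y)) x := contMDiffAt_symmL_section (k := ∞) hx' (b i)
  have hsum (y : M) (p : E) : (e'.symmL ℝ y p : TangentSpace 𝓘(ℝ, E) y) = ∑ j, b.repr p j • s j y := by
    conv_lhs => rw [← b.sum_repr p]
    rw [map_sum]
    exact Finset.sum_congr rfl fun j _ => map_smul _ _ _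
  let G (y : M) : E →L[ℝ] E := ∑ i, ∑ j, (inner ℝ (s j y) (s i y) : ℝ) •
    (LinearMap.toContinuousLinearMap (b.coord j)).smulRight (b i)
  have hG : ContMDiffAt 𝓘(ℝ, E) 𝓘(ℝ, E →L[ℝ] E) ∞ G x :=
    ContMDiffAt.sum fun i _ => ContMDiffAt.sum fun j _ =>
      (contMDiffAt_inner_tangent (hs j) (hs i)).smul contMDiffAt_const
  have hGapp (y : M) (p : E) :
      G y p = ∑ i, (inner ℝ (e'.symmL ℝ y p : TangentSpace 𝓘(ℝ, E) y) (s i y) : ℝ) • b i := by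
    simp only [G, sum_apply, smul_apply, ContinuousLinearMap.smulRight_apply, hsum, sum_inner,
      Finset.sum_smul, real_inner_smul_left]
    refine Finset.sum_congr rfl fun i _ => Finset.sum_congr rfl fun j _ => ?_
    rw [smul_smul, mul_comm]
    rfl
  have hinj (y : M) (hy : y ∈ e'.baseSet) : Function.Injective (G y) := by
    refine (injective_iff_map_eq_zero _).2 fun p hp => ?_
    rw [hGapp] at hp
    have h1 := Fintype.linearIndependent_iff.1 b.linearIndependent _ hp
    have h2 : (inner ℝ (e'.symmL ℝ y p : TangentSpace 𝓘(ℝ, E) y) (∑ j, b.repr p j • s j y) : ℝ)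
        = 0 := by
      rw [inner_sum]
      refine Finset.sum_eq_zero fun j _ => ?_
      rw [real_inner_smul_right, h1, mul_zero]
    rw [← hsum, inner_self_eq_zero] at h2
    have h3 := e'.continuousLinearMapAt_symmL (R := ℝ) hy p
    rw [← h3]
    exact (congrArg _ h2).trans (map_zero _)
  let G' (y : M) (hy : y ∈ e'.baseSet) : E ≃L[ℝ] E :=
    (LinearEquiv.ofInjectiveEndo (G y).toLinearMap (hinj y hy)).toContinuousLinearEquiv
  have hG' (y : M) (hy : y ∈ e'.baseSet) : (G' y hy : E →L[ℝ] E) = G y := by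
    ext p
    rfl
  let l (y : M) : E := ∑ i, (inner ℝ (W y) (s i y) : ℝ) • b i
  have hl : ContMDiffAt 𝓘(ℝ, E) 𝓘(ℝ, E) ∞ l x :=
    ContMDiffAt.sum fun i _ => (h _ (hs i)).smul contMDiffAt_const
  have hinv : ContMDiffAt 𝓘(ℝ, E) 𝓘(ℝ, E →L[ℝ] E) ∞ (fun y => (G y).inverse) x := by
    have h1 : ContDiffAt ℝ ∞ ContinuousLinearMap.inverse (G x) := by
      rw [← hG' x hx']
      exact contDiffAt_map_inverse _
    exact h1.contMDiffAt.comp x hG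
  refine (contMDiffAt_section_iff_coord hx').2 ((hinv.clm_apply hl).congr_of_eventuallyEq ?_)
  filter_upwards [eventually_mem_baseSet e' hx'] with y hy
  have h4 : l y = G' y hy (e'.continuousLinearMapAt ℝ y (W y)) := by
    have h5 : e'.symmL ℝ y (e'.continuousLinearMapAt ℝ y (W y)) = W y :=
      e'.symmL_continuousLinearMapAt hy (W y)
    refine Eq.trans ?_ (hGapp y _).symm
    rw [h5]
  rw [← hG' y hy, ContinuousLinearMap.inverse_equiv, h4]
  exact ((G' y hy).symm_apply_apply _).symm

/-- The Levi-Civita connection is smooth. -/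
lemma isSmoothConnection_leviCivita : IsSmoothConnection (leviCivita 𝓘(ℝ, E) M) := by
  intro Y X x hY hX
  refine contMDiffAt_of_inner fun Z hZ => ?_
  refine (contMDiffAt_koszul hX hY hZ).congr_of_eventuallyEq ?_
  have hev {U : Π x : M, TangentSpace 𝓘(ℝ, E) x}
      (hU : ContMDiffAt 𝓘(ℝ, E) (𝓘(ℝ, E).prod 𝓘(ℝ, E)) ∞ (fun y => TotalSpace.mk' E y (U y)) x) :
      ∀ᶠ y in 𝓝 x, MDiffAt (T% U) y := by
    filter_upwards [(contMDiffAt_iff_contMDiffAt_nhds (n := 1) (by simp)).1 (hU.of_le (by simp))] with y hy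
    exact hy.mdifferentiableAt (by simp)
  filter_upwards [hev hX, hev hY, hev hZ] with y h1 h2 h3
  exact inner_leviCivitaFun h1 h2 h3

lemma contMDiffAt_rolling_iff {k : WithTop ℕ∞} {σ : Π x, RollingBundle 𝓘(ℝ, E) M x} {x : M} :
    ContMDiffAt 𝓘(ℝ, E) (𝓘(ℝ, E).prod 𝓘(ℝ, E × ℝ)) k (fun y => TotalSpace.mk' (E × ℝ) y (σ y)) x ↔
      ContMDiffAt 𝓘(ℝ, E) (𝓘(ℝ, E).prod 𝓘(ℝ, E)) k (fun y => TotalSpace.mk' E y (σ y).1) x ∧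
      ContMDiffAt 𝓘(ℝ, E) 𝓘(ℝ, ℝ) k (fun y => ((σ y).2 : ℝ)) x := by
  rw [contMDiffAt_section, contMDiffAt_section]
  exact contMDiffAt_prod_module_iff _

lemma mdifferentiableAt_rolling_iff {σ : Π x, RollingBundle 𝓘(ℝ, E) M x} {x : M} :
    MDifferentiableAt 𝓘(ℝ, E) (𝓘(ℝ, E).prod 𝓘(ℝ, E × ℝ)) (fun y => TotalSpace.mk' (E × ℝ) y (σ y)) x ↔
      MDifferentiableAt 𝓘(ℝ, E) (𝓘(ℝ, E).prod 𝓘(ℝ, E)) (fun y => TotalSpace.mk' E y (σ y).1) x ∧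
      MDifferentiableAt 𝓘(ℝ, E) 𝓘(ℝ, ℝ) (fun y => ((σ y).2 : ℝ)) x := by
  rw [mdifferentiableAt_section, mdifferentiableAt_section]
  exact mdifferentiableAt_prod_module_iff _

/-- The rolling connection is smooth. -/
lemma isSmoothConnection_rollingConnection (c : ℝ) :
    IsSmoothConnection (rollingConnection 𝓘(ℝ, E) M c) := by
  intro σ X x hσ hX
  rw [contMDiffAt_rolling_iff] at hσ ⊢
  obtain ⟨h1, h2⟩ := hσ
  refine ⟨?_, ?_⟩
  · exact (isSmoothConnection_leviCivita _ _ x h1 hX).add_section (h2.smul_section hX)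
  · exact (contMDiffAt_mvfderiv_apply h2 hX).sub
      (contMDiffAt_const.mul (contMDiffAt_inner_tangent h1 hX))

end SmoothLeviCivita

noncomputable section MetricConnection

lemma sum_repr_mul_bilin {F ι : Type*} [AddCommGroup F] [Module ℝ F] [Fintype ι]
    (b : Module.Basis ι ℝ F) (B : F →ₗ[ℝ] F →ₗ[ℝ] ℝ) (T S : F →ₗ[ℝ] F) (x y : F) :
    ∑ i, ∑ j, b.repr x i * b.repr y j * B (T (b i)) (S (b j)) = B (T x) (S y) := by
  conv_rhs => rw [← b.sum_repr x, ← b.sum_repr y]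
  simp only [map_sum, map_smul, LinearMap.sum_apply, LinearMap.smul_apply, smul_eq_mul,
    Finset.mul_sum]
  rw [Finset.sum_comm]
  exact Finset.sum_congr rfl fun i _ => Finset.sum_congr rfl fun j _ => by ring

variable {E : Type*} [NormedAddCommGroup E] [NormedSpace ℝ E]
  {H : Type*} [TopologicalSpace H] {I : ModelWithCorners ℝ E H}
  {M : Type*} [TopologicalSpace M] [ChartedSpace H M]
  {F : Type*} [NormedAddCommGroup F] [NormedSpace ℝ F]
  {V : M → Type*} [TopologicalSpace (TotalSpace F V)]
  [∀ x, AddCommGroup (V x)] [∀ x, Module ℝ (V x)] [∀ x, TopologicalSpace (V x)]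
  [∀ x, IsTopologicalAddGroup (V x)] [∀ x, ContinuousSMul ℝ (V x)] [FiberBundle F V]
  [VectorBundle ℝ F V] [ContMDiffVectorBundle 1 F V I]
  [FiniteDimensional ℝ E] [FiniteDimensional ℝ F] [IsManifold I 1 M]

/-- The connection `cov` is compatible with the bilinear forms `h` on the fibres. -/
def IsCompatibleConnection (cov : CovariantDerivative I F V)
    (h : ∀ x, V x →ₗ[ℝ] V x →ₗ[ℝ] ℝ) : Prop :=
  ∀ (σ τ : Π x, V x) (x : M), MDiffAt (T% σ) x → MDiffAt (T% τ) x →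
    MDifferentiableAt I 𝓘(ℝ, ℝ) (fun y => h y (σ y) (τ y)) x ∧
    ∀ v : TangentSpace I x, mvfderiv I (F := ℝ) (fun y => h y (σ y) (τ y)) x v =
      h x (cov σ x v) (τ x) + h x (σ x) (cov τ x v)

variable {cov : CovariantDerivative I F V} {h : ∀ x, V x →ₗ[ℝ] V x →ₗ[ℝ] ℝ}

lemma IsCompatibleConnection.hasDerivAt_of_isParallelAlong (hc : IsCompatibleConnection cov h)
    {γ : ℝ → M} (hγ : ContMDiff 𝓘(ℝ, ℝ) I ∞ γ) {W W' : ∀ t, V (γ t)}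
    (hW : IsParallelAlong cov γ W) (hW' : IsParallelAlong cov γ W') (t : ℝ) :
    HasDerivAt (fun s => h (γ s) (W s) (W' s)) 0 t := by
  let e := trivializationAt F V (γ t)
  let e' := trivializationAt E (TangentSpace I : M → Type _) (γ t)
  have ht : γ t ∈ e.baseSet := mem_baseSet_trivializationAt' _
  have ht' : γ t ∈ e'.baseSet := mem_baseSet_trivializationAt' _
  have hγt : MDifferentiableAt 𝓘(ℝ, ℝ) I γ t := (hγ t).mdifferentiableAt (by simp)
  let b := Module.finBasis ℝ F
  let v : TangentSpace I (γ t) := mfderiv 𝓘(ℝ, ℝ) I γ t (1 : ℝ)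
  let Γ : F →L[ℝ] F := connectionForm e cov e' (γ t) (e'.continuousLinearMapAt ℝ (γ t) v)
  let B (y : M) : F →ₗ[ℝ] F →ₗ[ℝ] ℝ :=
    (h y).compl₁₂ (e.symmL ℝ y).toLinearMap (e.symmL ℝ y).toLinearMap
  have hB (y p q) : B y p q = h y (e.symmL ℝ y p) (e.symmL ℝ y q) := rfl
  have hΓ (p : F) : e.symmL ℝ (γ t) (Γ p) = cov (fun y => e.symmL ℝ y p) (γ t) v := by
    have h1 := coord_cov_symmL (cov := cov) (e := e) (e' := e') ht ht' p v
    change e.symmL ℝ (γ t) (connectionForm e cov e' (γ t) (e'.continuousLinearMapAt ℝ (γ t) v) p) = _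
    rw [← h1, e.symmL_continuousLinearMapAt ht]
  have hβ (p q : F) : HasDerivAt (fun s => B (γ s) p q) (B (γ t) (Γ p) q + B (γ t) p (Γ q)) t := by
    obtain ⟨h1, h2⟩ := hc _ _ (γ t) (mdifferentiableAt_symmL (e := e) ht p)
      (mdifferentiableAt_symmL (e := e) ht q)
    have h3 := (h1.comp t hγt).differentiableAt.hasDerivAt
    have h4 := mfderiv_comp_apply t h1 hγt (1 : ℝ)
    rw [mfderiv_eq_fderiv] at h4
    have h5 := h4.trans (h2 v)
    simp only [hB, hΓ]
    rw [← h5]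
    exact h3
  have hcoord {W : ∀ t, V (γ t)} (hW : IsParallelAlong cov γ W) :
      HasDerivAt (fun s => e.continuousLinearMapAt ℝ (γ s) (W s))
        (-Γ (e.continuousLinearMapAt ℝ (γ t) (W t))) t := by
    have h1 := ((mdifferentiableAt_along_iff (e := e) ht hγt).1 (hW.1 t)).hasDerivAt
    have h2 := coord_covDerivAlong (cov := cov) (e := e) (e' := e') ht ht' (hW.1 t) hγt
    rw [hW.2 t, map_zero] at h2
    rwa [eq_neg_of_add_eq_zero_left h2.symm] at h1
  let w (W : ∀ t, V (γ t)) (i) (s : ℝ) : ℝ := b.repr (e.continuousLinearMapAt ℝ (γ s) (W s)) i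
  have hw {W : ∀ t, V (γ t)} (hW : IsParallelAlong cov γ W) (i) : HasDerivAt (w W i)
      (-b.repr (Γ (e.continuousLinearMapAt ℝ (γ t) (W t))) i) t := by
    have h1 := (LinearMap.toContinuousLinearMap (b.coord i)).hasFDerivAt.comp_hasDerivAt t
      (hcoord hW)
    rw [map_neg] at h1
    exact h1
  have hsum := HasDerivAt.fun_sum (u := Finset.univ) fun i _ =>
    HasDerivAt.fun_sum (u := Finset.univ) fun j _ =>
      ((hw hW i).fun_mul (hw hW' j)).fun_mul (hβ (b i) (b j))
  refine (hsum.congr_of_eventuallyEq ?_).congr_deriv ?_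
  · filter_upwards [hγt.continuousAt.eventually (eventually_mem_baseSet e ht)] with s hs
    refine Eq.trans ?_ (sum_repr_mul_bilin b (B (γ s)) LinearMap.id LinearMap.id _ _).symm
    simp only [LinearMap.id_apply, hB]
    rw [e.symmL_continuousLinearMapAt hs, e.symmL_continuousLinearMapAt hs]
  · have key := fun T S => sum_repr_mul_bilin b (B (γ t)) T S
      (e.continuousLinearMapAt ℝ (γ t) (W t)) (e.continuousLinearMapAt ℝ (γ t) (W' t))
    have k1 := key Γ.toLinearMap LinearMap.id
    have k2 := key LinearMap.id Γ.toLinearMap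
    have k3 := sum_repr_mul_bilin b (B (γ t)) LinearMap.id LinearMap.id
      (Γ (e.continuousLinearMapAt ℝ (γ t) (W t))) (e.continuousLinearMapAt ℝ (γ t) (W' t))
    have k4 := sum_repr_mul_bilin b (B (γ t)) LinearMap.id LinearMap.id
      (e.continuousLinearMapAt ℝ (γ t) (W t)) (Γ (e.continuousLinearMapAt ℝ (γ t) (W' t)))
    simp only [LinearMap.id_apply, ContinuousLinearMap.coe_coe] at k1 k2 k3 k4
    have := congrArg₂ (· - ·) (congrArg₂ (· + ·) k1 k2) (congrArg₂ (· + ·) k3 k4)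
    simp only [← Finset.sum_add_distrib, ← Finset.sum_sub_distrib] at this
    refine Eq.trans ?_ (this.trans (sub_self _))
    refine Finset.sum_congr rfl fun i _ => Finset.sum_congr rfl fun j _ => ?_
    simp only [w]
    ring

/-- Parallel transport of a compatible connection preserves the bilinear forms. -/
lemma IsCompatibleConnection.apply_parallelTransport (hc : IsCompatibleConnection cov h)
    {x y : M} {B : V x ≃ₗ[ℝ] V y} (hB : IsParallelTransport cov x y B) (p q : V x) :
    h y (B p) (B q) = h x p q := by
  induction hB with
  | refl x => rfl
  | smooth γ hγ B hB =>
    obtain ⟨W, hW, rfl, h1⟩ := hB p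
    obtain ⟨W', hW', rfl, h1'⟩ := hB q
    rw [← h1, ← h1']
    have hd := hc.hasDerivAt_of_isParallelAlong hγ hW hW'
    exact is_const_of_deriv_eq_zero (fun t => (hd t).differentiableAt) (fun t => (hd t).deriv) 1 0
  | trans _ _ h1 h2 => exact (h2 _ _).trans (h1 _ _)

end MetricConnection

noncomputable section RollingMetric

variable {E : Type*} [NormedAddCommGroup E] [NormedSpace ℝ E] [FiniteDimensional ℝ E]
  {M : Type*} [TopologicalSpace M] [ChartedSpace E M] [IsManifold 𝓘(ℝ, E) ∞ M]
  [RiemannianBundle (fun x : M => TangentSpace 𝓘(ℝ, E) x)]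

/-- The metric `rollingMetric c` as a bilinear form. -/
def rollingForm (c : ℝ) (x : M) :
    RollingBundle 𝓘(ℝ, E) M x →ₗ[ℝ] RollingBundle 𝓘(ℝ, E) M x →ₗ[ℝ] ℝ :=
  LinearMap.mk₂ ℝ (rollingMetric (I := 𝓘(ℝ, E)) c x)
    (fun p p' q => by
      have h1 : (inner ℝ ((p.1 : TangentSpace 𝓘(ℝ, E) x) + p'.1) q.1 : ℝ) = _ := inner_add_left _ _ _
      change inner ℝ ((p.1 : TangentSpace 𝓘(ℝ, E) x) + p'.1) q.1
        + c⁻¹ * ((p.2 + p'.2 : ℝ) * (q.2 : ℝ)) = _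
      rw [h1]
      simp only [rollingMetric]
      ring)
    (fun a p q => by
      have h1 : (inner ℝ (a • (p.1 : TangentSpace 𝓘(ℝ, E) x)) q.1 : ℝ) = _ :=
        real_inner_smul_left _ _ _
      change inner ℝ (a • (p.1 : TangentSpace 𝓘(ℝ, E) x)) q.1
        + c⁻¹ * ((a * p.2 : ℝ) * (q.2 : ℝ)) = _
      rw [h1]
      simp only [rollingMetric, smul_eq_mul]
      ring)
    (fun p q q' => by
      have h1 : (inner ℝ (p.1 : TangentSpace 𝓘(ℝ, E) x) (q.1 + q'.1) : ℝ) = _ := inner_add_right _ _ _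
      change inner ℝ (p.1 : TangentSpace 𝓘(ℝ, E) x) (q.1 + q'.1)
        + c⁻¹ * ((p.2 : ℝ) * (q.2 + q'.2 : ℝ)) = _
      rw [h1]
      simp only [rollingMetric]
      ring)
    (fun a p q => by
      have h1 : (inner ℝ (p.1 : TangentSpace 𝓘(ℝ, E) x) (a • q.1) : ℝ) = _ :=
        real_inner_smul_right _ _ _
      change inner ℝ (p.1 : TangentSpace 𝓘(ℝ, E) x) (a • q.1)
        + c⁻¹ * ((p.2 : ℝ) * (a * q.2 : ℝ)) = _
      rw [h1]
      simp only [rollingMetric, smul_eq_mul]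
      ring)

lemma rollingForm_apply (c : ℝ) (x : M) (p q : RollingBundle 𝓘(ℝ, E) M x) :
    rollingForm c x p q = rollingMetric (I := 𝓘(ℝ, E)) c x p q := rfl

variable [IsContMDiffRiemannianBundle 𝓘(ℝ, E) ∞ E (fun x : M => TangentSpace 𝓘(ℝ, E) x)]

lemma isCompatibleConnection_rollingConnection {c : ℝ} (hc : c ≠ 0) :
    IsCompatibleConnection (rollingConnection 𝓘(ℝ, E) M c) (rollingForm c) := by
  intro σ τ x hσ hτ
  obtain ⟨h1, h2⟩ := mdifferentiableAt_rolling_iff.1 hσ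
  obtain ⟨k1, k2⟩ := mdifferentiableAt_rolling_iff.1 hτ
  have hin : MDifferentiableAt 𝓘(ℝ, E) 𝓘(ℝ, ℝ)
    (fun y => (inner ℝ ((σ y).1 : TangentSpace 𝓘(ℝ, E) y) (τ y).1 : ℝ)) x :=
      mdifferentiableAt_inner_tangent h1 k1
  have hmul : MDifferentiableAt 𝓘(ℝ, E) 𝓘(ℝ, ℝ) (fun y => ((σ y).2 : ℝ) * (τ y).2) x := h2.mul k2
  have hcm : MDifferentiableAt 𝓘(ℝ, E) 𝓘(ℝ, ℝ) (fun y => c⁻¹ * (((σ y).2 : ℝ) * (τ y).2)) x :=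
    mdifferentiableAt_const.mul hmul
  refine ⟨hin.add hcm, fun v => ?_⟩
  have e1 : mvfderiv 𝓘(ℝ, E) (F := ℝ) (fun y => rollingForm c y (σ y) (τ y)) x v =
      mvfderiv 𝓘(ℝ, E) (F := ℝ) (fun y => (inner ℝ ((σ y).1 : TangentSpace 𝓘(ℝ, E) y) (τ y).1 : ℝ)) x v
      + c⁻¹ * ((σ x).2 * mvfderiv 𝓘(ℝ, E) (F := ℝ) (fun y => ((τ y).2 : ℝ)) x v
        + (τ x).2 * mvfderiv 𝓘(ℝ, E) (F := ℝ) (fun y => ((σ y).2 : ℝ)) x v) := by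
    have a1 := DFunLike.congr_fun (mvfderiv_fun_add hin hcm) v
    have a2 := DFunLike.congr_fun (mvfderiv_fun_mul (mdifferentiableAt_const (c := c⁻¹)) hmul) v
    have a3 := DFunLike.congr_fun (mvfderiv_fun_mul h2 k2) v
    refine a1.trans ?_
    simp at a2 a3 ⊢
    rw [a2, a3, mvfderiv_const]
    simp
  have e2 := leviCivita_metric h1 k1 v
  rw [e1, e2, rollingForm_apply, rollingForm_apply]
  change _ = (inner ℝ (leviCivita 𝓘(ℝ, E) M (fun y => (σ y).1) x v + ((σ x).2 : ℝ) • v) ((τ x).1 : TangentSpace 𝓘(ℝ, E) x)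
    + c⁻¹ * ((mvfderiv 𝓘(ℝ, E) (F := ℝ) (fun y => ((σ y).2 : ℝ)) x v - c * inner ℝ ((σ x).1 : TangentSpace 𝓘(ℝ, E) x) v) * (τ x).2))
    + (inner ℝ ((σ x).1 : TangentSpace 𝓘(ℝ, E) x) (leviCivita 𝓘(ℝ, E) M (fun y => (τ y).1) x v + ((τ x).2 : ℝ) • v)
    + c⁻¹ * ((σ x).2 * (mvfderiv 𝓘(ℝ, E) (F := ℝ) (fun y => ((τ y).2 : ℝ)) x v - c * inner ℝ ((τ x).1 : TangentSpace 𝓘(ℝ, E) x) v)))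
  rw [inner_add_left, inner_add_right, real_inner_smul_left, real_inner_smul_right,
    real_inner_comm v ((τ x).1 : TangentSpace 𝓘(ℝ, E) x)]
  field_simp
  ring

end RollingMetric

noncomputable section ComplexStructure

variable {E : Type*} [NormedAddCommGroup E] [NormedSpace ℝ E] [FiniteDimensional ℝ E]
  {M : Type*} [TopologicalSpace M] [ChartedSpace E M] [IsManifold 𝓘(ℝ, E) ∞ M]
  [RiemannianBundle (fun x : M => TangentSpace 𝓘(ℝ, E) x)]
  [IsContMDiffRiemannianBundle 𝓘(ℝ, E) ∞ E (fun x : M => TangentSpace 𝓘(ℝ, E) x)]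

/-- Multiplication by `i`, carried over to a real vector space. -/
def frameComplexStructure {V : Type*} [AddCommGroup V] [Module ℝ V] {k : ℕ}
    (φ : V ≃ₗ[ℝ] EuclideanSpace ℂ (Fin k)) : V →ₗ[ℝ] V :=
  φ.symm.toLinearMap ∘ₗ
    ((LinearMap.lsmul ℂ (EuclideanSpace ℂ (Fin k)) Complex.I).restrictScalars ℝ) ∘ₗ φ.toLinearMap

lemma apply_frameComplexStructure {V : Type*} [AddCommGroup V] [Module ℝ V] {k : ℕ}
    (φ : V ≃ₗ[ℝ] EuclideanSpace ℂ (Fin k)) (p : V) :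
    φ (frameComplexStructure φ p) = Complex.I • φ p := by
  simp [frameComplexStructure]

lemma frameComplexStructure_sq {V : Type*} [AddCommGroup V] [Module ℝ V] {k : ℕ}
    (φ : V ≃ₗ[ℝ] EuclideanSpace ℂ (Fin k)) (p : V) :
    frameComplexStructure φ (frameComplexStructure φ p) = -p := by
  apply φ.injective
  rw [apply_frameComplexStructure, apply_frameComplexStructure, smul_smul, Complex.I_mul_I, map_neg,
    neg_one_smul]

/-- A unitary holonomy group commutes with the complex structure. -/
lemma frameComplexStructure_commute {x₀ : M} {k : ℕ}
    {φ : RollingBundle 𝓘(ℝ, E) M x₀ ≃ₗ[ℝ] EuclideanSpace ℂ (Fin k)}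
    (hU : RollingHolonomySubsetUnitary φ)
    {B : RollingBundle 𝓘(ℝ, E) M x₀ ≃ₗ[ℝ] RollingBundle 𝓘(ℝ, E) M x₀}
    (hB : IsParallelTransport (rollingConnection 𝓘(ℝ, E) M 1) x₀ x₀ B)
    (p : RollingBundle 𝓘(ℝ, E) M x₀) :
    frameComplexStructure φ (B p) = B (frameComplexStructure φ p) := by
  obtain ⟨U, -, hU⟩ := hU B (Subgroup.subset_closure hB)
  apply φ.injective
  rw [apply_frameComplexStructure, hU, hU, apply_frameComplexStructure, WithLp.ofLp_smul,
    Matrix.mulVec_smul, WithLp.toLp_smul]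

lemma rollingMetric_frameComplexStructure {x₀ : M} {k : ℕ}
    {φ : RollingBundle 𝓘(ℝ, E) M x₀ ≃ₗ[ℝ] EuclideanSpace ℂ (Fin k)} (hφ : IsUnitaryFrame φ)
    (p q : RollingBundle 𝓘(ℝ, E) M x₀) :
    rollingMetric (I := 𝓘(ℝ, E)) 1 x₀ (frameComplexStructure φ p) (frameComplexStructure φ q) =
      rollingMetric (I := 𝓘(ℝ, E)) 1 x₀ p q := by
  rw [← hφ, ← hφ, apply_frameComplexStructure, apply_frameComplexStructure, inner_smul_left,
    inner_smul_right, ← mul_assoc]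
  simp

/-- A complex structure on the fibre at `x₀` that commutes with the holonomy extends to a field
that commutes with all parallel transports. -/
lemma exists_commute_parallelTransport {F : Type*} [NormedAddCommGroup F] [NormedSpace ℝ F]
    [FiniteDimensional ℝ F]
    {V : M → Type*} [TopologicalSpace (TotalSpace F V)]
    [∀ x, AddCommGroup (V x)] [∀ x, Module ℝ (V x)] [∀ x, TopologicalSpace (V x)]
    [∀ x, IsTopologicalAddGroup (V x)] [∀ x, ContinuousSMul ℝ (V x)] [FiberBundle F V]
    [VectorBundle ℝ F V] [ContMDiffVectorBundle ∞ F V 𝓘(ℝ, E)]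
    [∀ x, FiniteDimensional ℝ (V x)] [∀ x, T2Space (V x)]
    [ConnectedSpace M] {cov : CovariantDerivative 𝓘(ℝ, E) F V} (hcov : IsSmoothConnection cov)
    {x₀ : M} (A₀ : V x₀ →ₗ[ℝ] V x₀)
    (hA₀ : ∀ B, IsParallelTransport cov x₀ x₀ B → ∀ p, A₀ (B p) = B (A₀ p)) :
    ∃ A : ∀ x, V x →L[ℝ] V x,
      (∀ x B, IsParallelTransport cov x₀ x B → ∀ p, A x (B p) = B (A₀ p)) ∧
      ∀ x y (B : V x ≃ₗ[ℝ] V y), IsParallelTransport cov x y B → ∀ w, A y (B w) = B (A x w) := by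
  choose P hP using exists_isParallelTransport hcov x₀
  let A (x : M) : V x →L[ℝ] V x :=
    LinearMap.toContinuousLinearMap ((P x).toLinearMap ∘ₗ A₀ ∘ₗ (P x).symm.toLinearMap)
  have hA (x B) (hB : IsParallelTransport cov x₀ x B) (p : V x₀) : A x (B p) = B (A₀ p) := by
    have h1 := hA₀ _ (hB.trans (hP x).symm) p
    simp only [LinearEquiv.trans_apply] at h1
    change P x (A₀ ((P x).symm (B p))) = _
    rw [h1, LinearEquiv.apply_symm_apply]
  refine ⟨A, hA, fun x y B hB w => ?_⟩
  have h1 := hA y _ ((hP x).trans hB) ((P x).symm w)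
  have h2 := hA x _ (hP x) ((P x).symm w)
  simp only [LinearEquiv.trans_apply, LinearEquiv.apply_symm_apply] at h1 h2
  rw [h1, h2]

/-- Unitary rolling holonomy gives a smooth parallel complex structure. -/
lemma exists_isParallelComplexStructure [ConnectedSpace M] {x₀ : M} {k : ℕ}
    {φ : RollingBundle 𝓘(ℝ, E) M x₀ ≃ₗ[ℝ] EuclideanSpace ℂ (Fin k)} (hφ : IsUnitaryFrame φ)
    (hU : RollingHolonomySubsetUnitary φ) :
    ∃ JR : ∀ x : M, RollingBundle 𝓘(ℝ, E) M x →L[ℝ] RollingBundle 𝓘(ℝ, E) M x,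
      IsParallelComplexStructure JR ∧ (∀ p, φ (JR x₀ p) = Complex.I • φ p) ∧
      ContMDiff 𝓘(ℝ, E) (𝓘(ℝ, E).prod 𝓘(ℝ, (E × ℝ) →L[ℝ] (E × ℝ))) ∞
        (fun x => TotalSpace.mk' ((E × ℝ) →L[ℝ] (E × ℝ)) (E := fun x => RollingBundle 𝓘(ℝ, E) M x →L[ℝ] RollingBundle 𝓘(ℝ, E) M x) x (JR x)) := by
  have hcov := isSmoothConnection_rollingConnection (M := M) (E := E) 1
  have : ∀ x : M, FiniteDimensional ℝ (RollingBundle 𝓘(ℝ, E) M x) := fun x =>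
    inferInstanceAs (FiniteDimensional ℝ (E × ℝ))
  have : ∀ x : M, T2Space (RollingBundle 𝓘(ℝ, E) M x) := fun x =>
    inferInstanceAs (T2Space (E × ℝ))
  obtain ⟨JR, h1, h2⟩ := exists_commute_parallelTransport hcov (frameComplexStructure φ)
    (fun B hB p => frameComplexStructure_commute hU hB p)
  refine ⟨JR, ⟨fun x p => ?_, fun x p q => ?_, fun σ x hσ v => ?_⟩, fun p => ?_,
    contMDiff_of_commute_parallelTransport hcov h2⟩
  · obtain ⟨P, hP⟩ := exists_isParallelTransport hcov x₀ x
    obtain ⟨p, rfl⟩ := P.surjective p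
    rw [h1 x P hP, h1 x P hP, frameComplexStructure_sq, map_neg]
  · obtain ⟨P, hP⟩ := exists_isParallelTransport hcov x₀ x
    obtain ⟨p, rfl⟩ := P.surjective p
    obtain ⟨q, rfl⟩ := P.surjective q
    have hiso := (isCompatibleConnection_rollingConnection (M := M) (E := E)
      one_ne_zero).apply_parallelTransport hP
    simp only [rollingForm_apply] at hiso
    rw [h1 x P hP, h1 x P hP, hiso, hiso, rollingMetric_frameComplexStructure hφ]
  · exact cov_apply_of_commute_parallelTransport hcov h2 hσ v
  · rw [← apply_frameComplexStructure]
    exact congrArg φ (h1 x₀ _ (IsParallelTransport.refl x₀) p)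

end ComplexStructure

noncomputable section SmoothHom

variable {E : Type*} [NormedAddCommGroup E] [NormedSpace ℝ E] [FiniteDimensional ℝ E]
  {M : Type*} [TopologicalSpace M] [ChartedSpace E M] [IsManifold 𝓘(ℝ, E) ∞ M]
  {F₁ : Type*} [NormedAddCommGroup F₁] [NormedSpace ℝ F₁] [FiniteDimensional ℝ F₁]
  {V₁ : M → Type*} [TopologicalSpace (TotalSpace F₁ V₁)]
  [∀ x, AddCommGroup (V₁ x)] [∀ x, Module ℝ (V₁ x)] [∀ x, TopologicalSpace (V₁ x)]
  [∀ x, IsTopologicalAddGroup (V₁ x)] [∀ x, ContinuousSMul ℝ (V₁ x)] [FiberBundle F₁ V₁]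
  [VectorBundle ℝ F₁ V₁] [ContMDiffVectorBundle ∞ F₁ V₁ 𝓘(ℝ, E)]
  {F₂ : Type*} [NormedAddCommGroup F₂] [NormedSpace ℝ F₂] [FiniteDimensional ℝ F₂]
  {V₂ : M → Type*} [TopologicalSpace (TotalSpace F₂ V₂)]
  [∀ x, AddCommGroup (V₂ x)] [∀ x, Module ℝ (V₂ x)] [∀ x, TopologicalSpace (V₂ x)]
  [∀ x, IsTopologicalAddGroup (V₂ x)] [∀ x, ContinuousSMul ℝ (V₂ x)] [FiberBundle F₂ V₂]
  [VectorBundle ℝ F₂ V₂] [ContMDiffVectorBundle ∞ F₂ V₂ 𝓘(ℝ, E)]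

/-- A field of linear maps is smooth if it maps smooth sections to smooth sections. -/
lemma contMDiff_hom_of_apply {A : ∀ x, V₁ x →L[ℝ] V₂ x}
    (hA : ∀ (σ : Π x, V₁ x) (x : M),
      ContMDiffAt 𝓘(ℝ, E) (𝓘(ℝ, E).prod 𝓘(ℝ, F₁)) ∞ (fun y => TotalSpace.mk' F₁ y (σ y)) x →
      ContMDiffAt 𝓘(ℝ, E) (𝓘(ℝ, E).prod 𝓘(ℝ, F₂)) ∞ (fun y => TotalSpace.mk' F₂ y (A y (σ y))) x) :
    ContMDiff 𝓘(ℝ, E) (𝓘(ℝ, E).prod 𝓘(ℝ, F₁ →L[ℝ] F₂)) ∞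
      (fun x => TotalSpace.mk' (F₁ →L[ℝ] F₂) (E := fun x => V₁ x →L[ℝ] V₂ x) x (A x)) := by
  intro x
  rw [contMDiffAt_hom_bundle]
  refine ⟨contMDiffAt_id, ?_⟩
  let b := Module.finBasis ℝ F₁
  let e₁ := trivializationAt F₁ V₁ x
  let e₂ := trivializationAt F₂ V₂ x
  have h1 (i) : ContMDiffAt 𝓘(ℝ, E) 𝓘(ℝ, F₂) ∞
      (fun y => e₂.continuousLinearMapAt ℝ y (A y (e₁.symmL ℝ y (b i)))) x :=
    (contMDiffAt_section_iff_coord (mem_baseSet_trivializationAt' x)).1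
      (hA _ x (contMDiffAt_symmL_section (mem_baseSet_trivializationAt' x) (b i)))
  have h2 : ContMDiffAt 𝓘(ℝ, E) 𝓘(ℝ, F₁ →L[ℝ] F₂) ∞ (fun y => ∑ i,
      ContinuousLinearMap.smulRightL ℝ F₁ F₂ (LinearMap.toContinuousLinearMap (b.coord i))
        (e₂.continuousLinearMapAt ℝ y (A y (e₁.symmL ℝ y (b i))))) x :=
    ContMDiffAt.sum fun i _ => contMDiffAt_const.clm_apply (h1 i)
  refine h2.congr_of_eventuallyEq (Filter.Eventually.of_forall fun y => ?_)
  ext p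
  change e₂.continuousLinearMapAt ℝ y (A y (e₁.symmL ℝ y p)) = _
  conv_lhs => rw [← b.sum_repr p]
  simp only [map_sum, map_smul, sum_apply, ContinuousLinearMap.smulRightL_apply_apply,
    ContinuousLinearMap.smulRight_apply]
  rfl

end SmoothHom

noncomputable section RollingPair

variable {E : Type*} [NormedAddCommGroup E] [NormedSpace ℝ E] [FiniteDimensional ℝ E]
  {M : Type*} [TopologicalSpace M] [ChartedSpace E M] [IsManifold 𝓘(ℝ, E) ∞ M]
  [RiemannianBundle (fun x : M => TangentSpace 𝓘(ℝ, E) x)]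
  [IsContMDiffRiemannianBundle 𝓘(ℝ, E) ∞ E (fun x : M => TangentSpace 𝓘(ℝ, E) x)]

/-- The identities satisfied by the components of a parallel complex structure on `TM ⊕ ℝ`. -/
structure IsRollingPair (Z : Π x : M, TangentSpace 𝓘(ℝ, E) x)
    (J : Π x : M, TangentSpace 𝓘(ℝ, E) x →L[ℝ] TangentSpace 𝓘(ℝ, E) x) : Prop where
  smooth_vectorField : SmoothVectorField Z
  smooth_tensor : SmoothEndomorphismField J
  inner_self : ∀ x, (inner ℝ (Z x) (Z x) : ℝ) = 1
  apply_vectorField : ∀ x, J x (Z x) = 0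
  sq : ∀ x v, J x (J x v) = -v + (inner ℝ (Z x) v : ℝ) • Z x
  inner_apply : ∀ x v, (inner ℝ (Z x) (J x v) : ℝ) = 0
  skew : ∀ x v w, (inner ℝ (J x v) w : ℝ) = -inner ℝ v (J x w)
  cov_vectorField : ∀ x v, leviCivita 𝓘(ℝ, E) M Z x v = J x v
  cov_tensor : ∀ (Y : Π x : M, TangentSpace 𝓘(ℝ, E) x) (x : M), MDiffAt (T% Y) x → ∀ v,
    leviCivita 𝓘(ℝ, E) M (fun y => J y (Y y)) x v =
      J x (leviCivita 𝓘(ℝ, E) M Y x v) + (inner ℝ (Z x) (Y x) : ℝ) • v - (inner ℝ v (Y x) : ℝ) • Z x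

section Components

variable {JR : ∀ x : M, RollingBundle 𝓘(ℝ, E) M x →L[ℝ] RollingBundle 𝓘(ℝ, E) M x}

variable (JR) in
/-- The vector field component of an endomorphism of `TM ⊕ ℝ`. -/
def vectorPart (x : M) : TangentSpace 𝓘(ℝ, E) x := (JR x (0, (1 : ℝ))).1

variable (JR) in
/-- The tensor component of an endomorphism of `TM ⊕ ℝ`. -/
def tensorPart (x : M) : TangentSpace 𝓘(ℝ, E) x →L[ℝ] TangentSpace 𝓘(ℝ, E) x :=
  ContinuousLinearMap.fst ℝ (TangentSpace 𝓘(ℝ, E) x) ℝ ∘L JR x ∘L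
    ContinuousLinearMap.inl ℝ (TangentSpace 𝓘(ℝ, E) x) ℝ

lemma IsParallelComplexStructure.skew (h : IsParallelComplexStructure JR) (x : M)
    (p q : RollingBundle 𝓘(ℝ, E) M x) :
    rollingMetric (I := 𝓘(ℝ, E)) 1 x (JR x p) q = -rollingMetric (I := 𝓘(ℝ, E)) 1 x p (JR x q) := by
  have h1 := h.orthogonal x p (JR x q)
  rw [h.sq] at h1
  rw [← h1, ← rollingForm_apply, ← rollingForm_apply, map_neg, neg_neg]

lemma rollingMetric_one_apply (x : M) (p q : RollingBundle 𝓘(ℝ, E) M x) :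
    rollingMetric (I := 𝓘(ℝ, E)) 1 x p q =
      inner ℝ (p.1 : TangentSpace 𝓘(ℝ, E) x) q.1 + (p.2 : ℝ) * (q.2 : ℝ) := by
  simp [rollingMetric]

lemma IsParallelComplexStructure.apply_zero_one (h : IsParallelComplexStructure JR) (x : M) :
    JR x (0, (1 : ℝ)) = (vectorPart JR x, (0 : ℝ)) := by
  refine Prod.ext rfl ?_
  have h1 := h.skew x (0, (1 : ℝ)) (0, (1 : ℝ))
  rw [rollingMetric_one_apply, rollingMetric_one_apply] at h1
  simp only [inner_zero_left, inner_zero_right, mul_one, one_mul, zero_add] at h1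
  exact self_eq_neg.1 h1

lemma IsParallelComplexStructure.apply_inl (h : IsParallelComplexStructure JR) (x : M)
    (v : TangentSpace 𝓘(ℝ, E) x) :
    JR x (v, (0 : ℝ)) = (tensorPart JR x v, -dualOneForm (vectorPart JR) x v) := by
  refine Prod.ext rfl ?_
  have h1 := h.skew x (v, (0 : ℝ)) (0, (1 : ℝ))
  rw [rollingMetric_one_apply, rollingMetric_one_apply, h.apply_zero_one] at h1
  simp only [inner_zero_right, mul_one, mul_zero, zero_add, add_zero] at h1
  rw [real_inner_comm] at h1
  exact h1

lemma IsParallelComplexStructure.apply_eq (h : IsParallelComplexStructure JR) (x : M)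
    (v : TangentSpace 𝓘(ℝ, E) x) (r : ℝ) :
    JR x (v, r) = (tensorPart JR x v + r • vectorPart JR x, -inner ℝ (vectorPart JR x) v) := by
  have h1 : ((v, r) : RollingBundle 𝓘(ℝ, E) M x) = (v, (0 : ℝ)) + r • (0, (1 : ℝ)) := by
    refine Prod.ext ?_ ?_
    · change v = v + r • 0
      simp
    · change r = 0 + r * 1
      simp
  rw [h1, map_add, map_smul, h.apply_inl, h.apply_zero_one]
  refine Prod.ext rfl ?_
  change -inner ℝ (vectorPart JR x) v + r * 0 = _
  simp

lemma rollingConnection_apply (σ : Π x, RollingBundle 𝓘(ℝ, E) M x) (x : M)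
    (v : TangentSpace 𝓘(ℝ, E) x) :
    rollingConnection 𝓘(ℝ, E) M 1 σ x v =
      (leviCivita 𝓘(ℝ, E) M (fun y => (σ y).1) x v + ((σ x).2 : ℝ) • v,
        mvfderiv 𝓘(ℝ, E) (F := ℝ) (fun y => (σ y).2) x v
          - inner ℝ ((σ x).1 : TangentSpace 𝓘(ℝ, E) x) v) := by
  refine Prod.ext rfl ?_
  change _ - 1 * inner ℝ ((σ x).1 : TangentSpace 𝓘(ℝ, E) x) v = _
  rw [one_mul]
  rfl

lemma IsParallelComplexStructure.isRollingPair (h : IsParallelComplexStructure JR)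
    (hs : ContMDiff 𝓘(ℝ, E) (𝓘(ℝ, E).prod 𝓘(ℝ, (E × ℝ) →L[ℝ] (E × ℝ))) ∞
      (fun x => TotalSpace.mk' ((E × ℝ) →L[ℝ] (E × ℝ))
        (E := fun x => RollingBundle 𝓘(ℝ, E) M x →L[ℝ] RollingBundle 𝓘(ℝ, E) M x) x (JR x))) :
    IsRollingPair (vectorPart JR) (tensorPart JR) := by
  have hsapp {σ : Π x, RollingBundle 𝓘(ℝ, E) M x} {x : M}
      (hσ : ContMDiffAt 𝓘(ℝ, E) (𝓘(ℝ, E).prod 𝓘(ℝ, E × ℝ)) ∞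
        (fun y => TotalSpace.mk' (E × ℝ) y (σ y)) x) :
      ContMDiffAt 𝓘(ℝ, E) (𝓘(ℝ, E).prod 𝓘(ℝ, E × ℝ)) ∞
        (fun y => TotalSpace.mk' (E × ℝ) y (JR y (σ y))) x :=
    ContMDiffAt.clm_bundle_apply (F₁ := E × ℝ) (F₂ := E × ℝ)
      (E₁ := RollingBundle 𝓘(ℝ, E) M) (E₂ := RollingBundle 𝓘(ℝ, E) M) (b := id) (hs x) hσ
  have hzero (x : M) : ContMDiffAt 𝓘(ℝ, E) (𝓘(ℝ, E).prod 𝓘(ℝ, E)) ∞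
      (fun y => TotalSpace.mk' E y (0 : TangentSpace 𝓘(ℝ, E) y)) x :=
    Bundle.contMDiff_zeroSection ℝ (fun x : M => TangentSpace 𝓘(ℝ, E) x) x
  have h01 (x : M) : ContMDiffAt 𝓘(ℝ, E) (𝓘(ℝ, E).prod 𝓘(ℝ, E × ℝ)) ∞
      (fun y => TotalSpace.mk' (E × ℝ) (E := RollingBundle 𝓘(ℝ, E) M) y (0, (1 : ℝ))) x :=
    contMDiffAt_rolling_iff.2 ⟨hzero x, contMDiffAt_const⟩
  have e1 (x : M) := h.sq x (0, (1 : ℝ))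
  have e2 (x : M) (v : TangentSpace 𝓘(ℝ, E) x) := h.sq x (v, (0 : ℝ))
  simp only [h.apply_eq, zero_smul, add_zero, one_smul, zero_add, map_zero, inner_zero_right, neg_zero]
    at e1 e2
  have hskew (x : M) (v w : TangentSpace 𝓘(ℝ, E) x) := h.skew x (v, (0 : ℝ)) (w, (0 : ℝ))
  simp only [rollingMetric_one_apply, h.apply_eq, zero_smul, add_zero, mul_zero, zero_mul] at hskew
  refine ⟨fun x => (contMDiffAt_rolling_iff.1 (hsapp (h01 x))).1,
    contMDiff_hom_of_apply fun Y x hY =>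
      (contMDiffAt_rolling_iff.1 (hsapp ((contMDiffAt_rolling_iff (σ := fun y => (Y y, (0 : ℝ)))).2
        ⟨hY, contMDiffAt_const⟩))).1,
    fun x => ?_, fun x => ?_, fun x v => ?_, fun x v => ?_, hskew, fun x v => ?_, fun Y x hY v => ?_⟩
  · exact neg_injective (congrArg Prod.snd (e1 x))
  · exact (congrArg Prod.fst (e1 x)).trans neg_zero
  · have := congrArg Prod.fst (e2 x v)
    change tensorPart JR x (tensorPart JR x v) + (-inner ℝ (vectorPart JR x) v) • vectorPart JR x = -v
      at this
    rw [← this, neg_smul]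
    abel
  · exact neg_injective ((congrArg Prod.snd (e2 x v)).trans (by rfl))
  · have h3 := h.parallel _ x ((h01 x).mdifferentiableAt (by simp)) v
    have h4 := congrArg Prod.fst h3
    simp only [rollingConnection_apply, h.apply_eq, map_zero, zero_add, one_smul] at h4
    have h5 : leviCivita 𝓘(ℝ, E) M (fun y => (0 : TangentSpace 𝓘(ℝ, E) y)) = 0 :=
      (leviCivita 𝓘(ℝ, E) M).zero
    rw [h5, mvfderiv_const, inner_zero_left, inner_zero_right] at h4
    simpa using h4
  · have h3 := h.parallel (fun y => (Y y, (0 : ℝ))) x (mdifferentiableAt_rolling_iff.2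
      ⟨hY, mdifferentiableAt_const⟩) v
    have h4 := congrArg Prod.fst h3
    simp only [rollingConnection_apply, h.apply_eq, zero_smul, add_zero] at h4
    rw [mvfderiv_const, real_inner_comm v] at h4
    refine (eq_sub_of_add_eq h4).trans ?_
    rw [zero_apply, zero_sub, neg_smul, neg_smul]
    abel

end Components

variable {Z : Π x : M, TangentSpace 𝓘(ℝ, E) x}
  {J : Π x : M, TangentSpace 𝓘(ℝ, E) x →L[ℝ] TangentSpace 𝓘(ℝ, E) x}

lemma leviCivita_sub_leviCivita {X Y : Π x : M, TangentSpace 𝓘(ℝ, E) x} {x : M}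
    (hX : MDiffAt (T% X) x) (hY : MDiffAt (T% Y) x) :
    leviCivita 𝓘(ℝ, E) M Y x (X x) - leviCivita 𝓘(ℝ, E) M X x (Y x) = mlieBracket 𝓘(ℝ, E) X Y x :=
  (CovariantDerivative.torsion_eq_zero_iff _).1 leviCivita_torsion hX hY

namespace IsRollingPair

lemma mdifferentiableAt_vectorField (h : IsRollingPair Z J) (x : M) : MDiffAt (T% Z) x :=
  (h.smooth_vectorField x).mdifferentiableAt (by simp)

lemma smoothOneForm (h : IsRollingPair Z J) : SmoothOneForm (dualOneForm Z) := by
  refine contMDiff_hom_of_apply (V₂ := Bundle.Trivial M ℝ) fun Y x hY => ?_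
  rw [contMDiffAt_section]
  exact contMDiffAt_inner_tangent (h.smooth_vectorField x) hY

lemma inner_apply_apply (h : IsRollingPair Z J) (x : M) (v w : TangentSpace 𝓘(ℝ, E) x) :
    (inner ℝ (J x v) (J x w) : ℝ) = inner ℝ v w - inner ℝ (Z x) v * inner ℝ (Z x) w := by
  rw [h.skew, h.sq, inner_add_right, inner_neg_right, real_inner_smul_right, real_inner_comm (Z x) v]
  ring

lemma extDeriv_eq (h : IsRollingPair Z J) (x : M) (v w : TangentSpace 𝓘(ℝ, E) x) :
    extDerivOneForm (dualOneForm Z) x v w = 2 * inner ℝ (J x v) w := by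
  have hV : MDiffAt (T% (extend E v)) x := mdifferentiableAt_extend ..
  have hW : MDiffAt (T% (extend E w)) x := mdifferentiableAt_extend ..
  have hZ := h.mdifferentiableAt_vectorField x
  have h1 := leviCivita_metric hZ hW v
  have h2 := leviCivita_metric hZ hV w
  have h3 := leviCivita_sub_leviCivita hV hW
  simp only [extend_apply_self, h.cov_vectorField] at h1 h2 h3
  change mvfderiv 𝓘(ℝ, E) (F := ℝ) (fun y => inner ℝ (Z y) (extend E w y)) x v
    - mvfderiv 𝓘(ℝ, E) (F := ℝ) (fun y => inner ℝ (Z y) (extend E v y)) x w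
    - inner ℝ (Z x) (mlieBracket 𝓘(ℝ, E) (extend E v) (extend E w) x) = _
  rw [h1, h2, ← h3, inner_sub_right, h.skew x w v, real_inner_comm w]
  ring

lemma isKillingField (h : IsRollingPair Z J) : IsKillingField Z := by
  refine ⟨h.smooth_vectorField, fun X Y hX hY x => ?_⟩
  have hX := (hX x).mdifferentiableAt (n := ∞) (by simp)
  have hY := (hY x).mdifferentiableAt (n := ∞) (by simp)
  have hZ := h.mdifferentiableAt_vectorField x
  rw [leviCivita_metric hX hY, ← leviCivita_sub_leviCivita hZ hX, ← leviCivita_sub_leviCivita hZ hY,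
    h.cov_vectorField, h.cov_vectorField, inner_sub_left, inner_sub_right, h.skew]
  ring

lemma isContactForm (h : IsRollingPair Z J) : IsContactForm (dualOneForm Z) := by
  refine ⟨h.smoothOneForm, fun x h0 => ?_, fun x v hv hd => ?_⟩
  · have h1 := h.inner_self x
    have h2 : dualOneForm Z x (Z x) = 0 := by rw [h0]; rfl
    exact one_ne_zero (h1.symm.trans h2)
  · have h1 := hd (J x v) (h.inner_apply x v)
    have hv : (inner ℝ (Z x) v : ℝ) = 0 := hv
    rw [h.extDeriv_eq, h.inner_apply_apply, hv] at h1
    exact inner_self_eq_zero.1 (by linarith : (inner ℝ v v : ℝ) = 0)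

lemma isReebField (h : IsRollingPair Z J) : IsReebField (dualOneForm Z) Z := by
  refine ⟨h.smooth_vectorField, h.inner_self, fun x w => ?_⟩
  rw [h.extDeriv_eq, h.apply_vectorField, inner_zero_left, mul_zero]

lemma isContactMetricStructure (h : IsRollingPair Z J) : IsContactMetricStructure Z (dualOneForm Z) J where
  smooth_vectorField := h.smooth_vectorField
  smooth_form := h.smoothOneForm
  smooth_tensor := h.smooth_tensor
  form_apply := h.inner_self
  tensor_sq := h.sq
  contact := h.isContactForm
  reeb := h.isReebField
  compatible := h.inner_apply_apply
  extDeriv_eq := h.extDeriv_eq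

end IsRollingPair

end RollingPair

noncomputable section BracketCoordinates

variable {E : Type*} [NormedAddCommGroup E] [NormedSpace ℝ E] [FiniteDimensional ℝ E]
  {H : Type*} [TopologicalSpace H] {I : ModelWithCorners ℝ E H}
  {M : Type*} [TopologicalSpace M] [ChartedSpace H M] [I.Boundaryless] [IsManifold I ∞ M]

variable (E) in
/-- A constant vector field on a vector space. -/
def constField (v : E) (u : E) : TangentSpace 𝓘(ℝ, E) u := v

lemma mlieBracket_constField (v w u : E) :
    mlieBracket 𝓘(ℝ, E) (constField E v) (constField E w) u = 0 := by
  rw [← mlieBracketWithin_univ, mlieBracketWithin_eq_lieBracketWithin]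
  change fderivWithin ℝ (fun _ => w) Set.univ u v - fderivWithin ℝ (fun _ => v) Set.univ u w = 0
  simp

lemma mdifferentiableAt_constField (v u : E) : MDiffAt (T% (constField E v)) u := by
  rw [mdifferentiableAt_section]
  simpa [constField] using mdifferentiableAt_const

/-- Coordinate fields commute. -/
lemma mlieBracket_symmL (x : M) (v w : E) :
    mlieBracket I (fun y => (trivializationAt E (TangentSpace I : M → Type _) x).symmL ℝ y v)
      (fun y => (trivializationAt E (TangentSpace I : M → Type _) x).symmL ℝ y w) x = 0 := by
  have hpull (v : E) : mpullback I 𝓘(ℝ, E) (extChartAt I x) (constField E v) =ᶠ[𝓝 x]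
      fun y => (trivializationAt E (TangentSpace I : M → Type _) x).symmL ℝ y v := by
    filter_upwards [(chartAt H x).open_source.mem_nhds (mem_chart_source H x)] with y hy
    have hy' : y ∈ (trivializationAt E (TangentSpace I : M → Type _) x).baseSet := by
      rwa [TangentBundle.trivializationAt_baseSet]
    have h1 := TangentBundle.continuousLinearMapAt_trivializationAt (I := I) hy
    have h2 := (trivializationAt E (TangentSpace I : M → Type _) x).continuousLinearMapAt_symmL
      (R := ℝ) hy' v
    have h3 : (mfderiv I 𝓘(ℝ, E) (extChartAt I x) y).IsInvertible :=
      isInvertible_mfderiv_extChartAt (by rwa [extChartAt_source])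
    rw [← h1] at h3
    refine (mpullback_apply ..).trans ?_
    rw [← h1]
    exact h3.inverse_apply_eq.2 h2.symm
  have : IsManifold I (minSmoothness ℝ 2) M := by
    rw [minSmoothness_of_isRCLikeNormedField]
    infer_instance
  rw [← (hpull v).mlieBracket_vectorField_eq (hpull w),
    ← mpullback_mlieBracket (n := 2) (mdifferentiableAt_constField v _)
      (mdifferentiableAt_constField w _) contMDiffAt_extChartAt (by simp),
    mpullback_apply, mlieBracket_constField]
  exact map_zero _

/-- The Lie bracket in the coordinates at a point. -/
lemma coord_mlieBracket {V W : Π x : M, TangentSpace I x} {x : M} (hV : MDiffAt (T% V) x)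
    (hW : MDiffAt (T% W) x) :
    (trivializationAt E (TangentSpace I : M → Type _) x).continuousLinearMapAt ℝ x
        (mlieBracket I V W x) =
      mvfderiv I (fun y => (trivializationAt E (TangentSpace I : M → Type _) x).continuousLinearMapAt
        ℝ y (W y)) x (V x)
      - mvfderiv I (fun y => (trivializationAt E (TangentSpace I : M → Type _) x).continuousLinearMapAt
        ℝ y (V y)) x (W x) := by
  let e := trivializationAt E (TangentSpace I : M → Type _) x
  have hx : x ∈ e.baseSet := mem_baseSet_trivializationAt' x
  let c (y : M) : TangentSpace I y →L[ℝ] E := e.continuousLinearMapAt ℝ y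
  have hc {V : Π x : M, TangentSpace I x} (hV : MDiffAt (T% V) x) :
      MDifferentiableAt I 𝓘(ℝ, E) (fun y => c y (V y)) x :=
    (mdifferentiableAt_section_iff_coord hx).1 hV
  let Φ (V W : Π x : M, TangentSpace I x) : E :=
    c x (mlieBracket I V W x) - (mvfderiv I (fun y => c y (W y)) x (V x)
      - mvfderiv I (fun y => c y (V y)) x (W x))
  have key : Φ V W = Φ (fun y => e.symmL ℝ y (c x (V x))) (fun y => e.symmL ℝ y (c x (W x))) := by
    refine TensorialAt.pointwise₂ (I := I) (F := E) (F' := E) (Φ := Φ)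
      (fun W hW => ⟨?_, ?_⟩) (fun V hV => ⟨?_, ?_⟩) hV (mdifferentiableAt_symmL hx _) hW
      (mdifferentiableAt_symmL hx _) (e.symmL_continuousLinearMapAt hx _).symm
      (e.symmL_continuousLinearMapAt hx _).symm
    · intro f V hf hV
      simp [Φ, mlieBracket_smul_left hf hV, mvfderiv_fun_smul hf (hc hV)]
      module
    · intro V V' hV hV'
      simp [Φ, mlieBracket_add_left hV hV', mvfderiv_fun_add (hc hV) (hc hV')]
      abel
    · intro f W hf hW
      simp [Φ, mlieBracket_smul_right hf hW, mvfderiv_fun_smul hf (hc hW)]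
      module
    · intro W W' hW hW'
      simp [Φ, mlieBracket_add_right hW hW', mvfderiv_fun_add (hc hW) (hc hW')]
      abel
  have hz : Φ (fun y => e.symmL ℝ y (c x (V x))) (fun y => e.symmL ℝ y (c x (W x))) = 0 := by
    have h1 (v : E) : mvfderiv I (fun y => c y (e.symmL ℝ y v)) x = 0 := mvfderiv_coord_symmL hx v
    have h2 := mlieBracket_symmL (I := I) x (c x (V x)) (c x (W x))
    simp only [Φ, h1]
    change c x (mlieBracket I (fun y => e.symmL ℝ y (c x (V x))) (fun y => e.symmL ℝ y (c x (W x))) x) - _ = _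
    rw [h2]
    simp
  rw [hz] at key
  exact sub_eq_zero.1 key

end BracketCoordinates

noncomputable section ProductBracket

variable {E : Type*} [NormedAddCommGroup E] [NormedSpace ℝ E] [FiniteDimensional ℝ E]
  {H : Type*} [TopologicalSpace H] {I : ModelWithCorners ℝ E H}
  {M : Type*} [TopologicalSpace M] [ChartedSpace H M] [I.Boundaryless] [IsManifold I ∞ M]
  {E' : Type*} [NormedAddCommGroup E'] [NormedSpace ℝ E'] [FiniteDimensional ℝ E']
  {H' : Type*} [TopologicalSpace H'] {I' : ModelWithCorners ℝ E' H'}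
  {N : Type*} [TopologicalSpace N] [ChartedSpace H' N] [I'.Boundaryless] [IsManifold I' ∞ N]

lemma mfderiv_prodMap_space {F₁ F₂ : Type*} [NormedAddCommGroup F₁] [NormedSpace ℝ F₁]
    [NormedAddCommGroup F₂] [NormedSpace ℝ F₂] {f : M → F₁} {g : N → F₂} {p : M × N}
    (hf : MDifferentiableAt I 𝓘(ℝ, F₁) f p.1) (hg : MDifferentiableAt I' 𝓘(ℝ, F₂) g p.2)
    (v : TangentSpace I p.1) (w : TangentSpace I' p.2) :
    mfderiv (I.prod I') 𝓘(ℝ, F₁ × F₂) (Prod.map f g) p (v, w) =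
      (mfderiv I 𝓘(ℝ, F₁) f p.1 v, mfderiv I' 𝓘(ℝ, F₂) g p.2 w) := by
  have h1 := hf.hasMFDerivAt.comp p (hasMFDerivAt_fst (I := I) (I' := I') p)
  have h2 := hg.hasMFDerivAt.comp p (hasMFDerivAt_snd (I := I) (I' := I') p)
  have h : HasMFDerivAt (I.prod I') 𝓘(ℝ, F₁ × F₂) (Prod.map f g) p _ :=
    ⟨h1.1.prodMk h2.1, h1.2.prodMk h2.2⟩
  exact DFunLike.congr_fun h.mfderiv (v, w)

/-- The coordinates of a tangent vector of a product. -/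
lemma continuousLinearMapAt_prod {p q : M × N} (hq₁ : q.1 ∈ (chartAt H p.1).source)
    (hq₂ : q.2 ∈ (chartAt H' p.2).source) (v : TangentSpace I q.1) (w : TangentSpace I' q.2) :
    (trivializationAt (E × E') (TangentSpace (I.prod I') : M × N → Type _) p).continuousLinearMapAt
        ℝ q (v, w) =
      ((trivializationAt E (TangentSpace I : M → Type _) p.1).continuousLinearMapAt ℝ q.1 v,
        (trivializationAt E' (TangentSpace I' : N → Type _) p.2).continuousLinearMapAt ℝ q.2 w) := by
  have hq : q ∈ (chartAt (ModelProd H H') p).source := ⟨hq₁, hq₂⟩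
  rw [TangentBundle.continuousLinearMapAt_trivializationAt hq,
    TangentBundle.continuousLinearMapAt_trivializationAt hq₁,
    TangentBundle.continuousLinearMapAt_trivializationAt hq₂]
  have h := mfderiv_prodMap_space (p := q) (mdifferentiableAt_extChartAt (I := I) hq₁)
    (mdifferentiableAt_extChartAt (I := I') hq₂)
  have h' : (extChartAt (I.prod I') p : M × N → E × E') =
      Prod.map (extChartAt I p.1) (extChartAt I' p.2) := by
    rw [extChartAt_prod]
    rfl
  rw [h']
  exact h v w

/-- A vector field on a product, given by its two components. -/
lemma mdifferentiableAt_prod_iff {V : Π q : M × N, TangentSpace I q.1}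
    {W : Π q : M × N, TangentSpace I' q.2} {p : M × N} :
    MDifferentiableAt (I.prod I') ((I.prod I').prod 𝓘(ℝ, E × E'))
      (fun q => TotalSpace.mk' (E × E') (E := (TangentSpace (I.prod I') : M × N → Type _)) q
        (V q, W q)) p ↔
    MDifferentiableAt (I.prod I') 𝓘(ℝ, E) (fun q =>
      (trivializationAt E (TangentSpace I : M → Type _) p.1).continuousLinearMapAt ℝ q.1 (V q)) p ∧
    MDifferentiableAt (I.prod I') 𝓘(ℝ, E') (fun q =>
      (trivializationAt E' (TangentSpace I' : N → Type _) p.2).continuousLinearMapAt ℝ q.2 (W q)) p := by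
  have hp : p ∈ (trivializationAt (E × E') (TangentSpace (I.prod I') : M × N → Type _) p).baseSet :=
    mem_baseSet_trivializationAt' p
  refine (mdifferentiableAt_section_iff_coord hp).trans ?_
  refine Iff.trans ?_ (mdifferentiableAt_prod_module_iff (fun q : M × N =>
    ((trivializationAt E (TangentSpace I : M → Type _) p.1).continuousLinearMapAt ℝ q.1 (V q),
      (trivializationAt E' (TangentSpace I' : N → Type _) p.2).continuousLinearMapAt ℝ q.2 (W q))))
  refine Filter.EventuallyEq.mdifferentiableAt_iff ?_
  filter_upwards [(chartAt (ModelProd H H') p).open_source.mem_nhds (mem_chart_source _ p)] with q hq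
  exact continuousLinearMapAt_prod hq.1 hq.2 _ _

/-- The sum of the lifts of vector fields on the factors. -/
def prodField (X : Π x : M, TangentSpace I x) (U : Π x : N, TangentSpace I' x) (q : M × N) :
    TangentSpace (I.prod I') q := (X q.1, U q.2)

lemma mdifferentiableAt_prodField {X : Π x : M, TangentSpace I x} {U : Π x : N, TangentSpace I' x}
    {p : M × N} (hX : MDiffAt (T% X) p.1) (hU : MDiffAt (T% U) p.2) :
    MDiffAt (T% (prodField X U)) p :=
  mdifferentiableAt_prod_iff.2
    ⟨((mdifferentiableAt_section_iff_coord (mem_baseSet_trivializationAt' p.1)).1 hX).comp p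
      mdifferentiableAt_fst,
    ((mdifferentiableAt_section_iff_coord (mem_baseSet_trivializationAt' p.2)).1 hU).comp p
      mdifferentiableAt_snd⟩

/-- The Lie bracket of lifted vector fields on a product. -/
lemma mlieBracket_prodField {X Y : Π x : M, TangentSpace I x} {U W : Π x : N, TangentSpace I' x}
    {p : M × N} (hX : MDiffAt (T% X) p.1) (hY : MDiffAt (T% Y) p.1) (hU : MDiffAt (T% U) p.2)
    (hW : MDiffAt (T% W) p.2) :
    mlieBracket (I.prod I') (prodField X U) (prodField Y W) p =
      (mlieBracket I X Y p.1, mlieBracket I' U W p.2) := by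
  have hp : p ∈ (trivializationAt (E × E') (TangentSpace (I.prod I') : M × N → Type _) p).baseSet :=
    mem_baseSet_trivializationAt' p
  apply ((trivializationAt (E × E') (TangentSpace (I.prod I') : M × N → Type _)
    p).continuousLinearEquivAt ℝ p hp).injective
  have hcoe : ∀ q, (trivializationAt (E × E') (TangentSpace (I.prod I') : M × N → Type _)
    p).continuousLinearEquivAt ℝ p hp q = (trivializationAt (E × E') (TangentSpace (I.prod I') : M × N → Type _)
    p).continuousLinearMapAt ℝ p q :=
    fun q => by rw [← Trivialization.coe_continuousLinearEquivAt_eq (R := ℝ) _ hp]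
  have hder {X : Π x : M, TangentSpace I x} {U : Π x : N, TangentSpace I' x}
      (hX : MDiffAt (T% X) p.1) (hU : MDiffAt (T% U) p.2) (v : TangentSpace I p.1)
      (w : TangentSpace I' p.2) :
      mvfderiv (I.prod I') (fun q => (trivializationAt (E × E')
        (TangentSpace (I.prod I') : M × N → Type _) p).continuousLinearMapAt ℝ q (prodField X U q)) p
        (v, w) =
      (mvfderiv I (fun x => (trivializationAt E (TangentSpace I : M → Type _) p.1).continuousLinearMapAt
        ℝ x (X x)) p.1 v,
       mvfderiv I' (fun x => (trivializationAt E' (TangentSpace I' : N → Type _) p.2).continuousLinearMapAt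
        ℝ x (U x)) p.2 w) := by
    have h1 := (mdifferentiableAt_section_iff_coord (mem_baseSet_trivializationAt' p.1)).1 hX
    have h2 := (mdifferentiableAt_section_iff_coord (mem_baseSet_trivializationAt' p.2)).1 hU
    have h3 := mfderiv_prodMap_space (p := p) h1 h2 v w
    have h4 : (fun q => (trivializationAt (E × E')
        (TangentSpace (I.prod I') : M × N → Type _) p).continuousLinearMapAt ℝ q (prodField X U q))
        =ᶠ[𝓝 p] Prod.map (fun x => (trivializationAt E (TangentSpace I : M → Type _)
          p.1).continuousLinearMapAt ℝ x (X x)) (fun x => (trivializationAt E'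
          (TangentSpace I' : N → Type _) p.2).continuousLinearMapAt ℝ x (U x)) := by
      filter_upwards [(chartAt (ModelProd H H') p).open_source.mem_nhds (mem_chart_source _ p)]
        with q hq
      exact continuousLinearMapAt_prod hq.1 hq.2 _ _
    rw [mvfderiv_congr_of_eventuallyEq h4]
    exact h3
  refine (hcoe _).trans (Eq.trans ?_ (hcoe _).symm)
  rw [coord_mlieBracket (mdifferentiableAt_prodField hX hU) (mdifferentiableAt_prodField hY hW)]
  refine Eq.trans ?_ (continuousLinearMapAt_prod (mem_chart_source _ _) (mem_chart_source _ _)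
    _ _).symm
  rw [coord_mlieBracket hX hY, coord_mlieBracket hU hW]
  exact congrArg₂ (· - ·) (hder hY hW _ _) (hder hX hU _ _)

end ProductBracket

noncomputable section Nijenhuis

variable {E : Type*} [NormedAddCommGroup E] [NormedSpace ℝ E] [FiniteDimensional ℝ E]
  {H : Type*} [TopologicalSpace H] {I : ModelWithCorners ℝ E H}
  {M : Type*} [TopologicalSpace M] [ChartedSpace H M] [IsManifold I ∞ M]

/-- The Nijenhuis expression of a field of endomorphisms. -/
def nijenhuis (K : Π x : M, TangentSpace I x →L[ℝ] TangentSpace I x)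
    (V W : Π x : M, TangentSpace I x) (x : M) : TangentSpace I x :=
  mlieBracket I (fun y => K y (V y)) (fun y => K y (W y)) x
    - K x (mlieBracket I (fun y => K y (V y)) W x)
    - K x (mlieBracket I V (fun y => K y (W y)) x)
    - mlieBracket I V W x

/-- The Nijenhuis expression of an almost complex structure is tensorial. -/
lemma nijenhuis_pointwise {K : Π x : M, TangentSpace I x →L[ℝ] TangentSpace I x} {x : M}
    (hsq : ∀ v, K x (K x v) = -v)
    (hK : ∀ V : Π x : M, TangentSpace I x, MDiffAt (T% V) x → MDiffAt (T% (fun y => K y (V y))) x)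
    {V V' W W' : Π x : M, TangentSpace I x} (hV : MDiffAt (T% V) x) (hV' : MDiffAt (T% V') x)
    (hW : MDiffAt (T% W) x) (hW' : MDiffAt (T% W') x) (hVV : V x = V' x) (hWW : W x = W' x) :
    nijenhuis K V W x = nijenhuis K V' W' x := by
  have hKs (f : M → ℝ) (V : Π x : M, TangentSpace I x) :
      (fun y => K y ((f • V) y)) = f • fun y => K y (V y) := funext fun y => map_smul _ _ _
  have hKa (V V' : Π x : M, TangentSpace I x) :
      (fun y => K y ((V + V') y)) = (fun y => K y (V y)) + fun y => K y (V' y) :=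
    funext fun y => map_add _ _ _
  refine TensorialAt.pointwise₂ (I := I) (F := E) (F' := E) (Φ := fun V W => nijenhuis K V W x)
    (fun W hW => ⟨?_, ?_⟩) (fun V hV => ⟨?_, ?_⟩) hV hV' hW hW' hVV hWW
  · intro f V hf hV
    simp only [nijenhuis, hKs, mlieBracket_smul_left hf hV, mlieBracket_smul_left hf (hK V hV),
      map_add, map_smul, hsq]
    module
  · intro V V' hV hV'
    simp only [nijenhuis, hKa, mlieBracket_add_left hV hV', mlieBracket_add_left (hK V hV) (hK V' hV'),
      map_add]
    abel
  · intro f W hf hW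
    simp only [nijenhuis, hKs, mlieBracket_smul_right hf hW, mlieBracket_smul_right hf (hK W hW),
      map_add, map_smul, hsq]
    module
  · intro W W' hW hW'
    simp only [nijenhuis, hKa, mlieBracket_add_right hW hW', mlieBracket_add_right (hK W hW) (hK W' hW'),
      map_add]
    abel

end Nijenhuis

noncomputable section Cone

/-- The Euler field `s ∂_s` on the half line. -/
def eulerField (s : halfLine) : TangentSpace 𝓘(ℝ, ℝ) s := (s : ℝ)

lemma continuousLinearMapAt_halfLine (s₀ s : halfLine) (b : TangentSpace 𝓘(ℝ, ℝ) s) :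
    (trivializationAt ℝ (TangentSpace 𝓘(ℝ, ℝ) : halfLine → Type _) s₀).continuousLinearMapAt ℝ s b
      = b := by
  have h1 : s ∈ (chartAt ℝ s₀).source := by
    have : chartAt ℝ s₀ = chartAt ℝ s := rfl
    rw [this]
    exact mem_chart_source ℝ s
  have h2 : achart ℝ s₀ = achart ℝ s := rfl
  rw [TangentBundle.continuousLinearMapAt_trivializationAt_eq_core h1, h2]
  exact (tangentBundleCore 𝓘(ℝ, ℝ) halfLine).coordChange_self (achart ℝ s) s
    (mem_chart_source ℝ s) b

lemma mdifferentiableAt_coe_halfLine (s : halfLine) :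
    MDifferentiableAt 𝓘(ℝ, ℝ) 𝓘(ℝ, ℝ) (fun t : halfLine => (t : ℝ)) s :=
  (contMDiff_subtype_val (I := 𝓘(ℝ, ℝ)) (U := halfLine) (n := ∞) s).mdifferentiableAt (by simp)

lemma mdifferentiableAt_eulerField (s : halfLine) : MDiffAt (T% eulerField) s := by
  rw [mdifferentiableAt_section_iff_coord (mem_baseSet_trivializationAt' s)]
  simp only [continuousLinearMapAt_halfLine]
  exact mdifferentiableAt_coe_halfLine s

variable {E : Type*} [NormedAddCommGroup E] [NormedSpace ℝ E] [FiniteDimensional ℝ E]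
  {M : Type*} [TopologicalSpace M] [ChartedSpace E M] [IsManifold 𝓘(ℝ, E) ∞ M]

/-- The vector field `A + f s ∂_s` on the cone. -/
def coneField (A : Π x : M, TangentSpace 𝓘(ℝ, E) x) (f : M → ℝ) (p : M × halfLine) :
    TangentSpace (𝓘(ℝ, E).prod 𝓘(ℝ, ℝ)) p := (A p.1, f p.1 * (p.2 : ℝ))

lemma coneField_eq (A : Π x : M, TangentSpace 𝓘(ℝ, E) x) (f : M → ℝ) :
    coneField A f = prodField A (0 : Π s : halfLine, TangentSpace 𝓘(ℝ, ℝ) s)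
      + (fun p : M × halfLine => f p.1) • prodField (0 : Π x : M, TangentSpace 𝓘(ℝ, E) x) eulerField := by
  funext p
  refine Prod.ext ?_ ?_
  · change A p.1 = A p.1 + f p.1 • (0 : TangentSpace 𝓘(ℝ, E) p.1)
    rw [smul_zero, add_zero]
  · change f p.1 * (p.2 : ℝ) = 0 + f p.1 * (p.2 : ℝ)
    rw [zero_add]

lemma mdifferentiableAt_zeroField {H' : Type*} [TopologicalSpace H'] {E' : Type*}
    [NormedAddCommGroup E'] [NormedSpace ℝ E'] {I' : ModelWithCorners ℝ E' H'} {N : Type*}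
    [TopologicalSpace N] [ChartedSpace H' N] [IsManifold I' 1 N] (x : N) :
    MDiffAt (T% (0 : Π x : N, TangentSpace I' x)) x :=
  Bundle.mdifferentiable_zeroSection ℝ (fun x : N => TangentSpace I' x) x

lemma mdifferentiableAt_coneField {A : Π x : M, TangentSpace 𝓘(ℝ, E) x} {f : M → ℝ}
    {p : M × halfLine} (hA : MDiffAt (T% A) p.1) (hf : MDifferentiableAt 𝓘(ℝ, E) 𝓘(ℝ, ℝ) f p.1) :
    MDiffAt (T% (coneField A f)) p := by
  rw [coneField_eq]
  exact mdifferentiableAt_add_section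
    (mdifferentiableAt_prodField hA (mdifferentiableAt_zeroField p.2))
    ((hf.comp p mdifferentiableAt_fst).smul_section
      (mdifferentiableAt_prodField (mdifferentiableAt_zeroField p.1) (mdifferentiableAt_eulerField _)))

lemma mlieBracket_coneField {A B : Π x : M, TangentSpace 𝓘(ℝ, E) x} {f g : M → ℝ}
    {p : M × halfLine} (hA : MDiffAt (T% A) p.1) (hB : MDiffAt (T% B) p.1)
    (hf : MDifferentiableAt 𝓘(ℝ, E) 𝓘(ℝ, ℝ) f p.1) (hg : MDifferentiableAt 𝓘(ℝ, E) 𝓘(ℝ, ℝ) g p.1) :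
    mlieBracket (𝓘(ℝ, E).prod 𝓘(ℝ, ℝ)) (coneField A f) (coneField B g) p =
      (mlieBracket 𝓘(ℝ, E) A B p.1,
        (mvfderiv 𝓘(ℝ, E) g p.1 (A p.1) - mvfderiv 𝓘(ℝ, E) f p.1 (B p.1)) * (p.2 : ℝ)) := by
  have hz := mdifferentiableAt_zeroField (I' := 𝓘(ℝ, E)) p.1
  have hz' := mdifferentiableAt_zeroField (I' := 𝓘(ℝ, ℝ)) p.2
  have hU := mdifferentiableAt_eulerField p.2
  have hA' := mdifferentiableAt_prodField hA hz'
  have hB' := mdifferentiableAt_prodField hB hz'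
  have hU' := mdifferentiableAt_prodField hz hU
  have hf' : MDifferentiableAt (𝓘(ℝ, E).prod 𝓘(ℝ, ℝ)) 𝓘(ℝ, ℝ) (fun p : M × halfLine => f p.1) p :=
    hf.comp p mdifferentiableAt_fst
  have hg' : MDifferentiableAt (𝓘(ℝ, E).prod 𝓘(ℝ, ℝ)) 𝓘(ℝ, ℝ) (fun p : M × halfLine => g p.1) p :=
    hg.comp p mdifferentiableAt_fst
  have hder {f : M → ℝ} (hf : MDifferentiableAt 𝓘(ℝ, E) 𝓘(ℝ, ℝ) f p.1)
      (v : TangentSpace (𝓘(ℝ, E).prod 𝓘(ℝ, ℝ)) p) :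
      mvfderiv (𝓘(ℝ, E).prod 𝓘(ℝ, ℝ)) (fun p : M × halfLine => f p.1) p v =
        mvfderiv 𝓘(ℝ, E) f p.1 v.1 := by
    have h1 := (hf.hasMFDerivAt.comp p (hasMFDerivAt_fst (I := 𝓘(ℝ, E)) (I' := 𝓘(ℝ, ℝ)) p)).mfderiv
    exact DFunLike.congr_fun h1 v
  rw [coneField_eq, coneField_eq, mlieBracket_add_left hA' (hf'.smul_section hU'),
    mlieBracket_add_right hB' (hg'.smul_section hU'), mlieBracket_add_right hB' (hg'.smul_section hU'),
    mlieBracket_smul_right hg' hU', mlieBracket_smul_right hg' hU', mlieBracket_smul_left hf' hU',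
    mlieBracket_smul_left hf' hU', mlieBracket_self]
  have e1 := mlieBracket_prodField hA hB hz' hz'
  have e2 := mlieBracket_prodField hA hz hz' hU
  have e3 := mlieBracket_prodField hz hB hU hz'
  simp only [mlieBracket_zero_right, mlieBracket_zero_left, Pi.zero_apply] at e1 e2 e3
  rw [e1, e2, e3, hder hg, hder hg, hder hf, hder hf]
  have k1 : mvfderiv 𝓘(ℝ, E) g p.1 (((fun p : M × halfLine => f p.1) •
      prodField (0 : Π x : M, TangentSpace 𝓘(ℝ, E) x) eulerField) p).1 = 0 := by
    change mvfderiv 𝓘(ℝ, E) g p.1 (f p.1 • (0 : TangentSpace 𝓘(ℝ, E) p.1)) = 0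
    rw [smul_zero, map_zero]
  have k2 : mvfderiv 𝓘(ℝ, E) f p.1
      (prodField (0 : Π x : M, TangentSpace 𝓘(ℝ, E) x) eulerField p).1 = 0 :=
    map_zero (mvfderiv 𝓘(ℝ, E) f p.1)
  rw [k1, k2]
  set a : ℝ := mvfderiv 𝓘(ℝ, E) g p.1 (A p.1)
  set b : ℝ := mvfderiv 𝓘(ℝ, E) f p.1 (B p.1)
  refine Prod.ext ?_ ?_
  · change mlieBracket 𝓘(ℝ, E) A B p.1
      + (a • (0 : TangentSpace 𝓘(ℝ, E) p.1) + g p.1 • (0 : TangentSpace 𝓘(ℝ, E) p.1))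
      + (-b • (0 : TangentSpace 𝓘(ℝ, E) p.1) + f p.1 • (0 : TangentSpace 𝓘(ℝ, E) p.1)
        + ((0 : ℝ) • (0 : TangentSpace 𝓘(ℝ, E) p.1) + g p.1 •
          (-(0 : ℝ) • (0 : TangentSpace 𝓘(ℝ, E) p.1) + f p.1 • (0 : TangentSpace 𝓘(ℝ, E) p.1))))
      = mlieBracket 𝓘(ℝ, E) A B p.1
    simp only [smul_zero, add_zero]
  · change 0 + (a * (p.2 : ℝ) + g p.1 * 0) + (-b * (p.2 : ℝ) + f p.1 * 0
      + (0 * (p.2 : ℝ) + g p.1 * (-0 * (p.2 : ℝ) + f p.1 * 0))) = (a - b) * (p.2 : ℝ)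
    ring

variable {Z : Π x : M, TangentSpace 𝓘(ℝ, E) x} {α : Π x : M, TangentSpace 𝓘(ℝ, E) x →L[ℝ] ℝ}
  {J : Π x : M, TangentSpace 𝓘(ℝ, E) x →L[ℝ] TangentSpace 𝓘(ℝ, E) x}

lemma coneComplexStructure_apply (p : M × halfLine) (v : TangentSpace 𝓘(ℝ, E) p.1) (b : ℝ) :
    coneComplexStructure Z α J p (v, b) =
      (J p.1 v + ((p.2 : ℝ)⁻¹ * b) • Z p.1, -(p.2 : ℝ) * α p.1 v) := rfl

lemma coe_halfLine_ne_zero (s : halfLine) : (s : ℝ) ≠ 0 := ne_of_gt s.2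

lemma coneComplexStructure_combination {p : M × halfLine} {X₁ X₂ X₃ X₄ : TangentSpace 𝓘(ℝ, E) p.1}
    {f₁ f₂ f₃ f₄ : ℝ} {T₁ T₂ T₃ T₄ : TangentSpace (𝓘(ℝ, E).prod 𝓘(ℝ, ℝ)) p}
    (h₁ : T₁ = (X₁, f₁ * (p.2 : ℝ))) (h₂ : T₂ = (X₂, f₂ * (p.2 : ℝ)))
    (h₃ : T₃ = (X₃, f₃ * (p.2 : ℝ))) (h₄ : T₄ = (X₄, f₄ * (p.2 : ℝ)))
    (hX : X₁ - (J p.1 X₂ + f₂ • Z p.1) - (J p.1 X₃ + f₃ • Z p.1) - X₄ = 0)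
    (hf : f₁ + α p.1 X₂ + α p.1 X₃ - f₄ = 0) :
    T₁ - coneComplexStructure Z α J p T₂ - coneComplexStructure Z α J p T₃ - T₄ = 0 := by
  subst h₁ h₂ h₃ h₄
  have h := coe_halfLine_ne_zero p.2
  have h1 (t : ℝ) : (p.2 : ℝ)⁻¹ * (t * (p.2 : ℝ)) = t := by field_simp
  refine Prod.ext ?_ ?_
  · change X₁ - (J p.1 X₂ + ((p.2 : ℝ)⁻¹ * (f₂ * (p.2 : ℝ))) • Z p.1)
      - (J p.1 X₃ + ((p.2 : ℝ)⁻¹ * (f₃ * (p.2 : ℝ))) • Z p.1) - X₄ = 0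
    rw [h1, h1, hX]
  change f₁ * (p.2 : ℝ) - -(p.2 : ℝ) * α p.1 X₂ - -(p.2 : ℝ) * α p.1 X₃ - f₄ * (p.2 : ℝ) = 0
  linear_combination (p.2 : ℝ) * hf

lemma coneComplexStructure_coneField (A : Π x : M, TangentSpace 𝓘(ℝ, E) x) (f : M → ℝ) :
    (fun p => coneComplexStructure Z α J p (coneField A f p)) =
      coneField (fun x => J x (A x) + f x • Z x) (fun x => -α x (A x)) := by
  funext p
  rw [coneField, coneComplexStructure_apply, coneField]
  have h := coe_halfLine_ne_zero p.2
  have h1 : (p.2 : ℝ)⁻¹ * (f p.1 * (p.2 : ℝ)) = f p.1 := by field_simp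
  rw [h1]
  refine Prod.ext rfl ?_
  change -(p.2 : ℝ) * α p.1 (A p.1) = -α p.1 (A p.1) * (p.2 : ℝ)
  ring

/-- The almost complex structure of the cone preserves differentiability. -/
lemma mdifferentiableAt_coneComplexStructure (hZ : SmoothVectorField Z) (hα : SmoothOneForm α)
    (hJ : SmoothEndomorphismField J) {p : M × halfLine}
    {V : Π p : M × halfLine, TangentSpace (𝓘(ℝ, E).prod 𝓘(ℝ, ℝ)) p} (hV : MDiffAt (T% V) p) :
    MDiffAt (T% (fun q => coneComplexStructure Z α J q (V q))) p := by
  have hV' := (mdifferentiableAt_prod_iff (I := 𝓘(ℝ, E)) (I' := 𝓘(ℝ, ℝ)) (p := p)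
    (V := fun q => (V q).1) (W := fun q => (V q).2)).1 hV
  obtain ⟨h1, h2⟩ := hV'
  have h2 : MDifferentiableAt (𝓘(ℝ, E).prod 𝓘(ℝ, ℝ)) 𝓘(ℝ, ℝ) (fun q => ((V q).2 : ℝ)) p :=
    h2.congr_of_eventuallyEq (Filter.Eventually.of_forall fun q =>
      (continuousLinearMapAt_halfLine p.2 q.2 _).symm)
  refine (mdifferentiableAt_prod_iff (I := 𝓘(ℝ, E)) (I' := 𝓘(ℝ, ℝ)) (p := p)
    (V := fun q => J q.1 (V q).1 + ((q.2 : ℝ)⁻¹ * (V q).2) • Z q.1)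
    (W := fun q => (-(q.2 : ℝ) * α q.1 (V q).1 : ℝ))).2 ?_
  have hp : p.1 ∈ (trivializationAt E (TangentSpace 𝓘(ℝ, E) : M → Type _) p.1).baseSet :=
    mem_baseSet_trivializationAt' p.1
  have hev : ∀ᶠ q : M × halfLine in 𝓝 p,
      q.1 ∈ (trivializationAt E (TangentSpace 𝓘(ℝ, E) : M → Type _) p.1).baseSet :=
    continuousAt_fst.eventually (eventually_mem_baseSet _ hp)
  have hs : MDifferentiableAt (𝓘(ℝ, E).prod 𝓘(ℝ, ℝ)) 𝓘(ℝ, ℝ) (fun q : M × halfLine => (q.2 : ℝ)) p :=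
    (mdifferentiableAt_coe_halfLine p.2).comp p mdifferentiableAt_snd
  have hsinv : MDifferentiableAt (𝓘(ℝ, E).prod 𝓘(ℝ, ℝ)) 𝓘(ℝ, ℝ)
      (fun q : M × halfLine => (q.2 : ℝ)⁻¹) p :=
    (differentiableAt_inv (coe_halfLine_ne_zero p.2)).mdifferentiableAt.comp p hs
  have hZ' : MDifferentiableAt (𝓘(ℝ, E).prod 𝓘(ℝ, ℝ)) 𝓘(ℝ, E) (fun q : M × halfLine =>
      (trivializationAt E (TangentSpace 𝓘(ℝ, E) : M → Type _) p.1).continuousLinearMapAt ℝ q.1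
        (Z q.1)) p :=
    ((mdifferentiableAt_section_iff_coord hp).1
      ((hZ p.1).mdifferentiableAt (by simp))).comp p mdifferentiableAt_fst
  have hJ' := ((contMDiffAt_hom_bundle _).1 (hJ p.1)).2.mdifferentiableAt (by simp)
  have hα' := ((contMDiffAt_hom_bundle _).1 (hα p.1)).2.mdifferentiableAt (by simp)
  have hJ'' := (hJ'.comp p mdifferentiableAt_fst).clm_apply h1
  have hα'' := (hα'.comp p mdifferentiableAt_fst).clm_apply h1
  constructor
  · refine (hJ''.add ((hsinv.mul h2).smul hZ')).congr_of_eventuallyEq ?_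
    filter_upwards [hev] with q hq
    have key (v : TangentSpace 𝓘(ℝ, E) q.1) (t : ℝ) :
        (trivializationAt E (TangentSpace 𝓘(ℝ, E) : M → Type _) p.1).continuousLinearMapAt ℝ q.1
          (J q.1 v + t • Z q.1) =
        (trivializationAt E (TangentSpace 𝓘(ℝ, E) : M → Type _) p.1).continuousLinearMapAt ℝ q.1
          (J q.1 ((trivializationAt E (TangentSpace 𝓘(ℝ, E) : M → Type _) p.1).symmL ℝ q.1
            ((trivializationAt E (TangentSpace 𝓘(ℝ, E) : M → Type _) p.1).continuousLinearMapAt ℝ q.1 v)))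
        + t • (trivializationAt E (TangentSpace 𝓘(ℝ, E) : M → Type _) p.1).continuousLinearMapAt ℝ q.1
          (Z q.1) := by
      rw [Trivialization.symmL_continuousLinearMapAt _ hq, map_add, map_smul]
    exact key _ _
  · refine (hs.neg.mul hα'').congr_of_eventuallyEq ?_
    filter_upwards [hev] with q hq
    refine (continuousLinearMapAt_halfLine p.2 q.2 _).trans ?_
    have key (v : TangentSpace 𝓘(ℝ, E) q.1) : α q.1 v =
        (trivializationAt ℝ (Bundle.Trivial M ℝ) p.1).continuousLinearMapAt ℝ q.1
          (α q.1 ((trivializationAt E (TangentSpace 𝓘(ℝ, E) : M → Type _) p.1).symmL ℝ q.1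
            ((trivializationAt E (TangentSpace 𝓘(ℝ, E) : M → Type _) p.1).continuousLinearMapAt ℝ q.1 v)))
        := by
      rw [Trivialization.symmL_continuousLinearMapAt _ hq]
      change _ = (Bundle.Trivial.trivialization M ℝ).continuousLinearMapAt ℝ q.1 (α q.1 v)
      rw [Bundle.Trivial.continuousLinearMapAt_trivialization]
      rfl
    exact congrArg (-(q.2 : ℝ) * ·) (key _)

end Cone

noncomputable section ConeIntegrable

variable {E : Type*} [NormedAddCommGroup E] [NormedSpace ℝ E] [FiniteDimensional ℝ E]
  {M : Type*} [TopologicalSpace M] [ChartedSpace E M] [IsManifold 𝓘(ℝ, E) ∞ M]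
  [RiemannianBundle (fun x : M => TangentSpace 𝓘(ℝ, E) x)]
  [IsContMDiffRiemannianBundle 𝓘(ℝ, E) ∞ E (fun x : M => TangentSpace 𝓘(ℝ, E) x)]
  {Z : Π x : M, TangentSpace 𝓘(ℝ, E) x}
  {J : Π x : M, TangentSpace 𝓘(ℝ, E) x →L[ℝ] TangentSpace 𝓘(ℝ, E) x}

namespace IsRollingPair

lemma mdifferentiableAt_tensor (h : IsRollingPair Z J) {A : Π x : M, TangentSpace 𝓘(ℝ, E) x} {x : M}
    (hA : MDiffAt (T% A) x) : MDiffAt (T% (fun y => J y (A y))) x :=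
  MDifferentiableAt.clm_bundle_apply (F₁ := E) (F₂ := E)
      (E₁ := fun x : M => TangentSpace 𝓘(ℝ, E) x) (E₂ := fun x : M => TangentSpace 𝓘(ℝ, E) x) (b := id)
      ((h.smooth_tensor x).mdifferentiableAt (by simp)) hA

lemma mdifferentiableAt_tensor_add (h : IsRollingPair Z J) {A : Π x : M, TangentSpace 𝓘(ℝ, E) x}
    {x : M} (hA : MDiffAt (T% A) x) (c : ℝ) : MDiffAt (T% (fun y => J y (A y) + c • Z y)) x :=
  mdifferentiableAt_add_section (h.mdifferentiableAt_tensor hA)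
    (mdifferentiableAt_const.smul_section (h.mdifferentiableAt_vectorField x))

lemma cov_tensor_add (h : IsRollingPair Z J) {A : Π x : M, TangentSpace 𝓘(ℝ, E) x}
    {x : M} (hA : MDiffAt (T% A) x) (c : ℝ) (v : TangentSpace 𝓘(ℝ, E) x) :
    leviCivita 𝓘(ℝ, E) M (fun y => J y (A y) + c • Z y) x v =
      J x (leviCivita 𝓘(ℝ, E) M A x v) + (inner ℝ (Z x) (A x) : ℝ) • v
        - (inner ℝ v (A x) : ℝ) • Z x + c • J x v := by
  have h1 := (leviCivita 𝓘(ℝ, E) M).isCovariantDerivativeOnUniv.add (h.mdifferentiableAt_tensor hA)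
    ((mdifferentiableAt_const (c := c)).smul_section (h.mdifferentiableAt_vectorField x))
  have h2 := (leviCivita 𝓘(ℝ, E) M).isCovariantDerivativeOnUniv.smul_const c
    (h.mdifferentiableAt_vectorField x)
  refine (DFunLike.congr_fun h1 v).trans ?_
  rw [add_apply]
  refine congrArg₂ (· + ·) (h.cov_tensor A x hA v) ?_
  refine (DFunLike.congr_fun h2 v).trans ?_
  rw [smul_apply, h.cov_vectorField]

lemma mvfderiv_dualOneForm (h : IsRollingPair Z J) {A : Π x : M, TangentSpace 𝓘(ℝ, E) x}
    {x : M} (hA : MDiffAt (T% A) x) (v : TangentSpace 𝓘(ℝ, E) x) :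
    mvfderiv 𝓘(ℝ, E) (F := ℝ) (fun y => -dualOneForm Z y (A y)) x v =
      -(inner ℝ (J x v) (A x) + inner ℝ (Z x) (leviCivita 𝓘(ℝ, E) M A x v)) := by
  have h1 := leviCivita_metric (h.mdifferentiableAt_vectorField x) hA v
  rw [h.cov_vectorField] at h1
  rw [← h1]
  have h2 : mfderiv 𝓘(ℝ, E) 𝓘(ℝ, ℝ) (-fun y => dualOneForm Z y (A y)) x = _ := mfderiv_neg
  exact DFunLike.congr_fun h2 v

lemma mdifferentiableAt_dualOneForm (h : IsRollingPair Z J) {A : Π x : M, TangentSpace 𝓘(ℝ, E) x}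
    {x : M} (hA : MDiffAt (T% A) x) :
    MDifferentiableAt 𝓘(ℝ, E) 𝓘(ℝ, ℝ) (fun y => -dualOneForm Z y (A y)) x :=
  (mdifferentiableAt_inner_tangent (h.mdifferentiableAt_vectorField x) hA).neg

lemma nijenhuis_coneField (h : IsRollingPair Z J) {A B : Π x : M, TangentSpace 𝓘(ℝ, E) x} (c d : ℝ)
    {p : M × halfLine} (hA : MDiffAt (T% A) p.1) (hB : MDiffAt (T% B) p.1) :
    nijenhuis (I := 𝓘(ℝ, E).prod 𝓘(ℝ, ℝ)) (coneComplexStructure Z (dualOneForm Z) J)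
      (coneField A fun _ => c) (coneField B fun _ => d) p = 0 := by
  have hc (c : ℝ) : MDifferentiableAt 𝓘(ℝ, E) 𝓘(ℝ, ℝ) (fun _ : M => c) p.1 := mdifferentiableAt_const
  have hA' := h.mdifferentiableAt_tensor_add hA c
  have hB' := h.mdifferentiableAt_tensor_add hB d
  have hfA := h.mdifferentiableAt_dualOneForm hA
  have hfB := h.mdifferentiableAt_dualOneForm hB
  rw [nijenhuis, coneComplexStructure_coneField, coneComplexStructure_coneField]
  refine coneComplexStructure_combination (mlieBracket_coneField hA' hB' hfA hfB)
    (mlieBracket_coneField hA' hB hfA (hc d)) (mlieBracket_coneField hA hB' (hc c) hfB)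
    (mlieBracket_coneField hA hB (hc c) (hc d)) ?_ ?_
  · rw [← leviCivita_sub_leviCivita hA' hB', ← leviCivita_sub_leviCivita hA' hB,
      ← leviCivita_sub_leviCivita hA hB', ← leviCivita_sub_leviCivita hA hB]
    simp only [h.cov_tensor_add hA, h.cov_tensor_add hB, h.mvfderiv_dualOneForm hA,
      h.mvfderiv_dualOneForm hB, mvfderiv_const, zero_apply, zero_sub, sub_zero]
    generalize leviCivita 𝓘(ℝ, E) M A p.1 = Q
    generalize leviCivita 𝓘(ℝ, E) M B p.1 = P
    generalize A p.1 = a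
    generalize B p.1 = b
    have hab : (inner ℝ (J p.1 b) a : ℝ) = -inner ℝ (J p.1 a) b := by
      rw [h.skew, real_inner_comm]
    simp only [map_add, map_sub, map_smul, h.sq, h.apply_vectorField, inner_add_left,
      real_inner_smul_left, hab, real_inner_comm a b]
    module
  · rw [← leviCivita_sub_leviCivita hA' hB, ← leviCivita_sub_leviCivita hA hB']
    simp only [h.cov_tensor_add hA, h.cov_tensor_add hB, h.mvfderiv_dualOneForm hA,
      h.mvfderiv_dualOneForm hB, mvfderiv_const, zero_apply, sub_zero]
    generalize leviCivita 𝓘(ℝ, E) M A p.1 = Q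
    generalize leviCivita 𝓘(ℝ, E) M B p.1 = P
    generalize A p.1 = a
    generalize B p.1 = b
    have hdual (v : TangentSpace 𝓘(ℝ, E) p.1) : dualOneForm Z p.1 v = inner ℝ (Z p.1) v := rfl
    simp only [hdual, map_add, map_smul, h.sq, h.apply_vectorField, h.inner_apply,
      inner_add_left, inner_add_right, inner_sub_right, real_inner_smul_left,
      real_inner_smul_right, inner_neg_left, h.inner_self, smul_zero, inner_zero_left]
    rw [real_inner_comm b a]
    ring

end IsRollingPair
end ConeIntegrable

section Sasakian

variable {E : Type*} [NormedAddCommGroup E] [NormedSpace ℝ E] [FiniteDimensional ℝ E]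
  {M : Type*} [TopologicalSpace M] [ChartedSpace E M]
  [RiemannianBundle (fun x : M => TangentSpace 𝓘(ℝ, E) x)] [IsManifold 𝓘(ℝ, E) ∞ M]
  [IsContMDiffRiemannianBundle 𝓘(ℝ, E) ∞ E (fun x : M => TangentSpace 𝓘(ℝ, E) x)]
  {Z : Π x : M, TangentSpace 𝓘(ℝ, E) x}
  {J : Π x : M, TangentSpace 𝓘(ℝ, E) x →L[ℝ] TangentSpace 𝓘(ℝ, E) x}

namespace IsRollingPair

lemma coneComplexStructure_sq (h : IsRollingPair Z J) (p : M × halfLine)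
    (v : TangentSpace (𝓘(ℝ, E).prod 𝓘(ℝ, ℝ)) p) :
    coneComplexStructure Z (dualOneForm Z) J p (coneComplexStructure Z (dualOneForm Z) J p v)
      = -v := by
  suffices H : ∀ (w : TangentSpace 𝓘(ℝ, E) p.1) (b : ℝ),
      coneComplexStructure Z (dualOneForm Z) J p
        (coneComplexStructure Z (dualOneForm Z) J p (w, b)) = (-w, -b) from H v.1 v.2
  intro w b
  have hp := coe_halfLine_ne_zero p.2
  have hdual (v : TangentSpace 𝓘(ℝ, E) p.1) : dualOneForm Z p.1 v = inner ℝ (Z p.1) v := rfl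
  refine (congrArg _ (coneComplexStructure_apply p w b)).trans
    ((coneComplexStructure_apply p _ _).trans (Prod.ext ?_ ?_))
  · change J p.1 (J p.1 w + ((p.2 : ℝ)⁻¹ * b) • Z p.1)
      + ((p.2 : ℝ)⁻¹ * (-(p.2 : ℝ) * dualOneForm Z p.1 w)) • Z p.1 = -w
    rw [hdual, map_add, map_smul, h.sq, h.apply_vectorField, ← mul_assoc, mul_neg,
      inv_mul_cancel₀ hp]
    module
  · change -(p.2 : ℝ) * dualOneForm Z p.1 (J p.1 w + ((p.2 : ℝ)⁻¹ * b) • Z p.1) = -b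
    rw [hdual, inner_add_right, h.inner_apply, real_inner_smul_right, h.inner_self]
    field_simp
    ring

lemma isIntegrable (h : IsRollingPair Z J) :
    IsIntegrableComplexStructure (I := 𝓘(ℝ, E).prod 𝓘(ℝ, ℝ))
      (coneComplexStructure Z (dualOneForm Z) J) := by
  refine ⟨h.coneComplexStructure_sq, fun V W hV hW p => ?_⟩
  have hext (v : TangentSpace (𝓘(ℝ, E).prod 𝓘(ℝ, ℝ)) p) :
      v = coneField (extend E (x := p.1) v.1)
        (fun _ => (v.2 : ℝ) / (p.2 : ℝ)) p := by
    refine Prod.ext ?_ ?_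
    · exact (extend_apply_self (E := fun x : M => TangentSpace 𝓘(ℝ, E) x)
        (x := p.1) E v.1).symm
    · exact (div_mul_cancel₀ (v.2 : ℝ) (coe_halfLine_ne_zero p.2)).symm
  have hmd (v : TangentSpace 𝓘(ℝ, E) p.1) : MDiffAt (T% (extend E v)) p.1 :=
    mdifferentiableAt_extend ..
  have h1 := nijenhuis_pointwise (K := coneComplexStructure Z (dualOneForm Z) J) (x := p)
    (h.coneComplexStructure_sq p)
    (fun V hV => mdifferentiableAt_coneComplexStructure h.smooth_vectorField h.smoothOneForm
      h.smooth_tensor hV)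
    ((hV p).mdifferentiableAt (by simp))
    (mdifferentiableAt_coneField (hmd (V p).1) mdifferentiableAt_const)
    ((hW p).mdifferentiableAt (by simp))
    (mdifferentiableAt_coneField (hmd (W p).1) mdifferentiableAt_const) (hext _) (hext _)
  exact h1.trans (h.nijenhuis_coneField _ _ (hmd _) (hmd _))

lemma isSasakianStructure (h : IsRollingPair Z J) : IsSasakianStructure Z (dualOneForm Z) J :=
  { h.isContactMetricStructure with integrable := h.isIntegrable }

end IsRollingPair
end Sasakian

end RollingHolonomy

open RollingHolonomy

theorem mainTheorem2 (m : ℕ)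
    {M : Type*} [TopologicalSpace M] [T2Space M] [SecondCountableTopology M] [ConnectedSpace M]
    [ChartedSpace (EuclideanSpace ℝ (Fin (2 * m + 1))) M]
    [IsManifold (𝓡 (2 * m + 1)) ∞ M]
    [RiemannianBundle (fun x : M => TangentSpace (𝓡 (2 * m + 1)) x)]
    [IsContMDiffRiemannianBundle (𝓡 (2 * m + 1)) ∞ (EuclideanSpace ℝ (Fin (2 * m + 1)))
      (fun x : M => TangentSpace (𝓡 (2 * m + 1)) x)]
    (x₀ : M)
    (φ : RollingBundle (𝓡 (2 * m + 1)) M x₀ ≃ₗ[ℝ] EuclideanSpace ℂ (Fin (m + 1)))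
    (hφ : IsUnitaryFrame φ)
    (hU : RollingHolonomySubsetUnitary φ) :
    ∃ (JR : ∀ x : M, RollingBundle (𝓡 (2 * m + 1)) M x →L[ℝ] RollingBundle (𝓡 (2 * m + 1)) M x)
      (Z : ∀ x : M, TangentSpace (𝓡 (2 * m + 1)) x)
      (J : ∀ x : M, TangentSpace (𝓡 (2 * m + 1)) x →L[ℝ] TangentSpace (𝓡 (2 * m + 1)) x),
      -- the parallel complex structure on `TM ⊕ ℝ` extending the one of `ℂ^(m+1)` at `x₀`
      IsParallelComplexStructure JR ∧
      (∀ p, φ (JR x₀ p) = Complex.I • φ p) ∧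
      -- `Z` and `J` are its components
      (∀ x, JR x (0, (1 : ℝ)) = (Z x, (0 : ℝ))) ∧
      (∀ x (v : TangentSpace (𝓡 (2 * m + 1)) x),
        JR x (v, (0 : ℝ)) = (J x v, -dualOneForm Z x v)) ∧
      -- `Z` is a Killing field of unit length
      IsKillingField Z ∧
      (∀ x, ‖Z x‖ = 1) ∧
      -- `J X = ∇_X Z` and `(∇_X J) Y = g(Z, Y) X - g(X, Y) Z`
      SmoothEndomorphismField J ∧
      (∀ x v, J x v = leviCivita (𝓡 (2 * m + 1)) M Z x v) ∧
      (∀ (Y : ∀ x : M, TangentSpace (𝓡 (2 * m + 1)) x), SmoothVectorField Y →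
        ∀ x (v : TangentSpace (𝓡 (2 * m + 1)) x),
        leviCivita (𝓡 (2 * m + 1)) M (fun y => J y (Y y)) x v
            - J x (leviCivita (𝓡 (2 * m + 1)) M Y x v)
          = (inner ℝ (Z x) (Y x) : ℝ) • v - (inner ℝ v (Y x) : ℝ) • Z x) ∧
      -- `α = g(Z, ·)` is a contact form with Reeb field `Z`
      IsContactForm (dualOneForm Z) ∧
      IsReebField (dualOneForm Z) Z ∧
      -- `J` restricts to a compatible almost complex structure on `ker α`
      (∀ x v, dualOneForm Z x v = 0 → dualOneForm Z x (J x v) = 0 ∧ J x (J x v) = -v) ∧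
      (∀ x v w, dualOneForm Z x v = 0 → dualOneForm Z x w = 0 →
        (inner ℝ (J x v) (J x w) : ℝ) = inner ℝ v w) ∧
      IsSasakianStructure Z (dualOneForm Z) J := by
  obtain ⟨JR, h1, h2, h3⟩ := exists_isParallelComplexStructure hφ hU
  have h := h1.isRollingPair h3
  refine ⟨JR, vectorPart JR, tensorPart JR, h1, h2, h1.apply_zero_one, h1.apply_inl,
    h.isKillingField, fun x => ?_, h.smooth_tensor, fun x v => (h.cov_vectorField x v).symm,
    fun Y hY x v => ?_, h.isContactForm, h.isReebField, fun x v hv => ⟨h.inner_apply x v, ?_⟩,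
    fun x v w hv hw => ?_, h.isSasakianStructure⟩
  · have h4 := h.inner_self x
    rw [real_inner_self_eq_norm_sq] at h4
    exact (pow_eq_one_iff_of_nonneg (norm_nonneg _) two_ne_zero).1 h4
  · rw [h.cov_tensor Y x ((hY x).mdifferentiableAt (by simp)) v]
    abel
  · have h4 : (inner ℝ (vectorPart JR x) v : ℝ) = 0 := hv
    rw [h.sq, h4, zero_smul, add_zero]
  · have h4 : (inner ℝ (vectorPart JR x) v : ℝ) = 0 := hv
    rw [h.inner_apply_apply, h4, zero_mul, sub_zero]
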